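/- A $k$-subgraph of a graph $G$ is a subgraph induced on exactly $k$ vertices, and the optimum is the largest average degree of a $k$-subgraph of $G$. Write $f=\tilde O(g)$ if $f(n)=O(g(n)(\log n)^{c})$ for some constant $c$. Algorithms are programs for a random access machine with unit cost per operation, with addition and truncated subtraction as its only arithmetic operations, that can toss fair coins at unit cost. For every $\varepsilon>0$ there are a randomized algorithm, a function $T(n)=O\big(2^{n^{6\varepsilon}}\big)$ and a function $\rho(n)=\tilde O\big(\max\{1,n^{(1-\varepsilon)/4}\}\big)$ such that, for every simple undirected graph $G$ on $n$ vertices, given by its adjacency matrix, and every integer $1\le k\le n$, the algorithm on input $(G,k)$ halts within $T(n)$ steps for every outcome of its coin tosses, and with probability at least $1-1/n$ it outputs the vertex set of a $k$-subgraph of $G$ with average degree $d'$ such that the optimum is at most $\rho(n)\,d'$. -/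

import Mathlib

open MeasureTheory Filter Asymptotics

namespace DkS

/-! ### Randomized random access machines

Programs are structured programs for a random access machine.  The machine has registers
`x₀, x₁, …` and memory banks `A₀, A₁, …`; every register and every memory cell holds a natural
number.  A program is a finite object, so it mentions only finitely many registers and banks, and
the banks are addressed indirectly through registers.  Arithmetic is restricted to addition and
truncated subtraction (there is no multiplication and no shift, so that a number grows by at most
one bit per step), and every elementary operation and every test costs one unit of time.  Random
bits are read one at a time, each at unit cost, from a one-way tape of fair coin tosses. -/

/-- Programs of the randomized random access machine. -/
inductive Prog : Type
  /-- `x := c` for a fixed number `c` -/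
  | const (x c : ℕ)
  /-- `x := y` -/
  | copy (x y : ℕ)
  /-- `x := y + z` -/
  | add (x y z : ℕ)
  /-- `x := max (y - z) 0` -/
  | sub (x y z : ℕ)
  /-- `x := Aₐ[y]` -/
  | load (x a y : ℕ)
  /-- `Aₐ[y] := x` -/
  | store (a y x : ℕ)
  /-- `x :=` a fresh random bit -/
  | coin (x : ℕ)
  /-- `p ; q` -/
  | seq (p q : Prog)
  /-- `if x ≠ 0 then p else q` -/
  | ite (x : ℕ) (p q : Prog)
  /-- `while x ≠ 0 do p` -/
  | loop (x : ℕ) (p : Prog)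

/-- A state of the machine: the contents of the registers, the contents of the memory banks
(`arr a i` is cell `i` of bank `a`), and the part of the random tape that is still unread. -/
structure State where
  reg : ℕ → ℕ
  arr : ℕ → ℕ → ℕ
  tape : ℕ → Bool

/-- The state after writing `v` into register `x`. -/
def State.setReg (s : State) (x v : ℕ) : State :=
  { s with reg := Function.update s.reg x v }

/-- The state after writing `v` into cell `i` of bank `a`. -/
def State.setArr (s : State) (a i v : ℕ) : State :=
  { s with arr := Function.update s.arr a (Function.update (s.arr a) i v) }

/-- The state after moving the head of the random tape past one bit. -/
def State.advance (s : State) : State :=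
  { s with tape := fun i => s.tape (i + 1) }

/-- `Exec p s s' t`: the program `p`, started in the state `s`, halts in the state `s'` after
exactly `t` steps. -/
inductive Exec : Prog → State → State → ℕ → Prop
  | const (s : State) (x c : ℕ) : Exec (.const x c) s (s.setReg x c) 1
  | copy (s : State) (x y : ℕ) : Exec (.copy x y) s (s.setReg x (s.reg y)) 1
  | add (s : State) (x y z : ℕ) : Exec (.add x y z) s (s.setReg x (s.reg y + s.reg z)) 1
  | sub (s : State) (x y z : ℕ) : Exec (.sub x y z) s (s.setReg x (s.reg y - s.reg z)) 1
  | load (s : State) (x a y : ℕ) : Exec (.load x a y) s (s.setReg x (s.arr a (s.reg y))) 1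
  | store (s : State) (a y x : ℕ) : Exec (.store a y x) s (s.setArr a (s.reg y) (s.reg x)) 1
  | coin (s : State) (x : ℕ) : Exec (.coin x) s (s.advance.setReg x (s.tape 0).toNat) 1
  | seq {p q : Prog} {s s' s'' : State} {t t' : ℕ} :
      Exec p s s' t → Exec q s' s'' t' → Exec (.seq p q) s s'' (t + t')
  | iteTrue {x : ℕ} {p q : Prog} {s s' : State} {t : ℕ} :
      s.reg x ≠ 0 → Exec p s s' t → Exec (.ite x p q) s s' (t + 1)
  | iteFalse {x : ℕ} {p q : Prog} {s s' : State} {t : ℕ} :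
      s.reg x = 0 → Exec q s s' t → Exec (.ite x p q) s s' (t + 1)
  | loopDone {x : ℕ} {p : Prog} {s : State} : s.reg x = 0 → Exec (.loop x p) s s 1
  | loopStep {x : ℕ} {p : Prog} {s s' s'' : State} {t t' : ℕ} :
      s.reg x ≠ 0 → Exec p s s' t → Exec (.loop x p) s' s'' t' →
      Exec (.loop x p) s s'' (t + t' + 1)

/-- `p` halts within `T` steps when started in the state `s`. -/
def HaltsWithin (p : Prog) (s : State) (T : ℕ) : Prop :=
  ∃ s' t, Exec p s s' t ∧ t ≤ T

/-- The law of an infinite sequence of independent fair coin tosses. -/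
noncomputable def fairCoins : Measure (ℕ → Bool) :=
  Measure.infinitePi fun _ : ℕ => (PMF.uniformOfFintype Bool).toMeasure

/-! ### The densest `k`-subgraph problem -/

open Classical in
/-- The initial state on the instance `(G, k)` with random tape `ω`: register `0` holds the number
`n` of vertices, register `1` holds `k`, and bank `0` holds the adjacency matrix of `G`, row by
row.  Everything else is `0`. -/
noncomputable def initState {n : ℕ} (G : SimpleGraph (Fin n)) (k : ℕ) (ω : ℕ → Bool) : State where
  reg x := if x = 0 then n else if x = 1 then k else 0
  arr a i := if a = 0 ∧ ∃ u v : Fin n, G.Adj u v ∧ i = u.val * n + v.val then 1 else 0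
  tape := ω

/-- The vertex set that is output in a halting state: bank `1` holds its indicator. -/
def output (n : ℕ) (s : State) : Finset (Fin n) :=
  Finset.univ.filter fun v => s.arr 1 v.val ≠ 0

open Classical in
/-- The average degree of the subgraph of `G` induced on `S`. -/
noncomputable def avgDegree {n : ℕ} (G : SimpleGraph (Fin n)) (S : Finset (Fin n)) : ℝ :=
  (∑ v ∈ S, ((S.filter fun u => G.Adj v u).card : ℝ)) / S.card

/-- `S` induces a `k`-subgraph of `G` whose average degree is within a factor `ρ` of the largest
average degree of a `k`-subgraph of `G`. -/
def IsApproxDensest {n : ℕ} (G : SimpleGraph (Fin n)) (k : ℕ) (ρ : ℝ) (S : Finset (Fin n)) :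
    Prop :=
  S.card = k ∧ ∀ H : Finset (Fin n), H.card = k → avgDegree G H ≤ ρ * avgDegree G S

/-- `f = Õ(g)`: `f = O(g · (log n) ^ c)` for some constant `c`. -/
def IsSoftO (f g : ℕ → ℝ) : Prop :=
  ∃ c : ℕ, f =O[atTop] fun n : ℕ => g n * Real.log n ^ c

end DkS

/-!
The algorithm tosses no coins.  It builds the output `W` greedily: as long as `W` has fewer than
`k` vertices, it adds a set `A` of unused vertices that fits and has the largest gain per vertex,
where the gain is the increase of the sum of the degrees inside `W`.  The candidates are all sets
that a straight-line program of `O(m)` instructions computes from `W`, its complement and `∅`.  An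
instruction (`select`) takes the first `t` vertices of a set whose degree into another set lies
between two thresholds, and adds a third set and a single vertex.  With `m ≤ n ^ (4 ε)` there are
`n ^ O(m)` such programs, each of which runs in polynomial time, so that all of them can be tried
within `2 ^ (n ^ (6 ε))` steps (`isBigO_mainTime`).

*Why short programs suffice* (`exists_dense`).  Let `H` have average degree `d`, write `h(S)` for
`|S ∩ H|`, and suppose that no short program finds a set of density `ρ = d / R` and size at most
`2 |H|`.  Then there are few edges between a computed set and any small set
(`Sparse.sum_nbrCount_le`): otherwise two threshold instructions find a dense set.  It follows that
the vertices of large degree can be removed, such that all degrees are at most about `ρ n / |H|`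
and a part of `H` of minimum degree `d / 4` survives (`Sparse.exists_bounded_degree`).  Now guess
`m` vertices of `H`, and improve the guessed set step by step.  If `S` is smaller than `H`, it is
replaced by the vertices with many neighbours in `S` (`Sparse.backbone`); otherwise by the vertices
of `S` with a neighbour in a further cluster of `m` guessed vertices (`Sparse.hair`).  For a
suitable weight `θ`, each of these steps increases the potential
`log h(S) - (1 - θ) log |S|` by a constant fraction of `log n` (`Sparse.walk_step`).  As
the potential never exceeds `log n`, constantly many steps lead to a contradiction
(`Sparse.false_of_walk`).  The weight exists because of the inequality between the harmonic and the
arithmetic mean (`exists_weight`): the requirement on `log R` is a quarter of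
`log (ρ n / |H|) - log ρ + log (|H| / m) = log (n / m)`, and this is where the exponent
`(1 - ε) / 4` comes from.

*Why greedy steps suffice* (`exists_good_gain`, `Greedy.isApproxDensest`).  While `W` fills at most
half of the space and has less than a quarter of the edges of an optimal `H`, many edges of `H`
either meet `W`, so that a single vertex has a large gain, or avoid `W`, so that `exists_dense`
applies to a small dense part of `H \ W`.

*The machine.*  A straight-line program is a tape of numbers that are bounded by a polynomial in
`n`; the tapes are enumerated by counting in base `B + 1`.  The correctness of the random access
program is proved in a Hoare style calculus with time bounds (`Run`), in which the registers and
banks that a program leaves unchanged are read off from its text (`Exec.frame`).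
-/

namespace DkS

/-! ### Degrees into a set -/

open Classical in
/-- The number of neighbours of `v` in `S`. -/
noncomputable def nbrCount {n : ℕ} (G : SimpleGraph (Fin n)) (S : Finset (Fin n)) (v : Fin n) : ℕ :=
  (S.filter fun u => G.Adj v u).card

/-- The sum of the degrees in the subgraph induced on `A`: twice the number of its edges. -/
noncomputable def degSum {n : ℕ} (G : SimpleGraph (Fin n)) (A : Finset (Fin n)) : ℕ :=
  ∑ v ∈ A, nbrCount G A v

/-- The increase of the degree sum of `W` when a set `A` disjoint from `W` is added to it. -/
noncomputable def gain {n : ℕ} (G : SimpleGraph (Fin n)) (W A : Finset (Fin n)) : ℕ :=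
  2 * ∑ v ∈ A, nbrCount G W v + degSum G A

section Degrees

variable {n : ℕ} (G : SimpleGraph (Fin n))

theorem avgDegree_eq (S : Finset (Fin n)) : avgDegree G S = (degSum G S : ℝ) / S.card := by
  simp [avgDegree, degSum, nbrCount]

theorem nbrCount_mono {S T : Finset (Fin n)} (h : S ⊆ T) (v : Fin n) :
    nbrCount G S v ≤ nbrCount G T v := by
  classical
  exact Finset.card_le_card (Finset.filter_subset_filter _ h)

theorem nbrCount_le_card (S : Finset (Fin n)) (v : Fin n) : nbrCount G S v ≤ S.card := by
  classical
  exact Finset.card_filter_le _ _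

theorem nbrCount_le (S : Finset (Fin n)) (v : Fin n) : nbrCount G S v ≤ n :=
  (nbrCount_le_card G S v).trans ((Finset.card_le_univ S).trans (by simp))

theorem nbrCount_lt (S : Finset (Fin n)) (v : Fin n) : nbrCount G S v < n := by
  classical
  have h : S.filter (fun u => G.Adj v u) ⊆ Finset.univ.erase v := by
    intro u hu
    have : G.Adj v u := (Finset.mem_filter.1 hu).2
    simp [this.ne']
  have h2 := Finset.card_le_card h
  rw [Finset.card_erase_of_mem (Finset.mem_univ v), Finset.card_univ, Fintype.card_fin] at h2
  have := v.pos
  unfold nbrCount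
  omega

theorem nbrCount_union_of_disjoint {S T : Finset (Fin n)} (h : Disjoint S T) (v : Fin n) :
    nbrCount G (S ∪ T) v = nbrCount G S v + nbrCount G T v := by
  classical
  unfold nbrCount
  rw [Finset.filter_union, Finset.card_union_of_disjoint]
  exact Finset.disjoint_filter_filter h

theorem sum_nbrCount_comm (A B : Finset (Fin n)) :
    ∑ v ∈ A, nbrCount G B v = ∑ v ∈ B, nbrCount G A v := by
  classical
  simp only [nbrCount, Finset.card_filter]
  rw [Finset.sum_comm]
  simp only [G.adj_comm]

theorem degSum_mono {S T : Finset (Fin n)} (h : S ⊆ T) : degSum G S ≤ degSum G T :=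
  (Finset.sum_le_sum fun v _ => nbrCount_mono G h v).trans
    (Finset.sum_le_sum_of_subset h)

theorem degSum_union_of_disjoint {W A : Finset (Fin n)} (h : Disjoint W A) :
    degSum G (W ∪ A) = degSum G W + gain G W A := by
  unfold degSum gain
  rw [Finset.sum_union h]
  simp only [nbrCount_union_of_disjoint G h, Finset.sum_add_distrib]
  rw [sum_nbrCount_comm G W A, degSum]
  ring

theorem nbrCount_singleton_self (v : Fin n) : nbrCount G {v} v = 0 := by
  classical
  simp [nbrCount]

theorem degSum_singleton (v : Fin n) : degSum G {v} = 0 := by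
  simp [degSum, nbrCount_singleton_self]

theorem degSum_erase {X : Finset (Fin n)} {v : Fin n} (hv : v ∈ X) :
    degSum G X = degSum G (X.erase v) + 2 * nbrCount G X v := by
  have hd : Disjoint (X.erase v) {v} := by simp
  have hX : X.erase v ∪ {v} = X := by
    rw [Finset.union_comm, ← Finset.insert_eq, Finset.insert_erase hv]
  have h1 := degSum_union_of_disjoint G hd
  have h2 := nbrCount_union_of_disjoint G hd v
  rw [hX] at h1 h2
  rw [nbrCount_singleton_self] at h2
  rw [h1, h2, gain, degSum_singleton]
  simp

end Degrees

/-! ### Sets defined by short straight-line programs -/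

/-- The first `t` elements of `X`, or all of `X` if it has fewer. -/
def lead {n : ℕ} (t : ℕ) (X : Finset (Fin n)) : Finset (Fin n) :=
  X.filter fun v => (X.filter (· < v)).card < t

theorem lead_subset {n : ℕ} (t : ℕ) (X : Finset (Fin n)) : lead t X ⊆ X :=
  Finset.filter_subset _ _

theorem lead_zero {n : ℕ} (X : Finset (Fin n)) : lead 0 X = ∅ := by
  simp [lead]

theorem lead_of_card_le {n t : ℕ} {X : Finset (Fin n)} (h : X.card ≤ t) : lead t X = X := by
  refine Finset.filter_true_of_mem fun v hv => lt_of_lt_of_le ?_ h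
  exact Finset.card_lt_card (Finset.filter_ssubset.2 ⟨v, hv, lt_irrefl v⟩)

theorem card_lead {n : ℕ} (t : ℕ) (X : Finset (Fin n)) : (lead t X).card = min t X.card := by
  have key : (lead t X).card = ((Finset.range X.card).filter (· < t)).card := by
    refine Finset.card_bij (fun v _ => (X.filter (· < v)).card) ?_ ?_ ?_
    · intro v hv
      obtain ⟨hvX, hvt⟩ := Finset.mem_filter.1 hv
      simp only [Finset.mem_filter, Finset.mem_range]
      exact ⟨Finset.card_lt_card (Finset.filter_ssubset.2 ⟨v, hvX, lt_irrefl v⟩), hvt⟩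
    · have aux : ∀ v ∈ X, ∀ w, v < w → (X.filter (· < v)).card < (X.filter (· < w)).card := by
        intro v hv w hvw
        refine Finset.card_lt_card (Finset.ssubset_iff_subset_ne.2 ⟨?_, ?_⟩)
        · intro x hx
          simp only [Finset.mem_filter] at hx ⊢
          exact ⟨hx.1, hx.2.trans hvw⟩
        · intro h
          have : v ∈ X.filter (· < v) := by rw [h]; simp [hv, hvw]
          simp at this
      intro v hv w hw h
      rcases lt_trichotomy v w with h1 | h1 | h1
      · exact absurd h (aux v (lead_subset t X hv) w h1).ne
      · exact h1
      · exact absurd h (aux w (lead_subset t X hw) v h1).ne'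
    · intro i hi
      simp only [Finset.mem_filter, Finset.mem_range] at hi
      let e := X.orderIsoOfFin rfl
      refine ⟨e ⟨i, hi.1⟩, ?_⟩
      have hc : (X.filter (· < (e ⟨i, hi.1⟩ : Fin n))).card = i := by
        have : X.filter (· < (e ⟨i, hi.1⟩ : Fin n))
            = (Finset.Iio (⟨i, hi.1⟩ : Fin X.card)).map
              (e.toEquiv.toEmbedding.trans (Function.Embedding.subtype _)) := by
          ext x
          simp only [Finset.mem_filter, Finset.mem_map, Finset.mem_Iio]
          constructor
          · rintro ⟨hx, hlt⟩
            refine ⟨e.symm ⟨x, hx⟩, ?_, ?_⟩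
            · rw [OrderIso.symm_apply_lt]
              exact hlt
            · simp
          · rintro ⟨j, hj, rfl⟩
            refine ⟨(e j).2, ?_⟩
            have : e j < e ⟨i, hi.1⟩ := e.lt_iff_lt.2 hj
            exact this
        rw [this, Finset.card_map, Fin.card_Iio]
      refine ⟨Finset.mem_filter.2 ⟨(e ⟨i, hi.1⟩).2, ?_⟩, hc⟩
      rw [hc]; exact hi.2
  rw [key]
  have : (Finset.range X.card).filter (· < t) = Finset.range (min t X.card) := by
    ext i; simp [and_comm]
  rw [this, Finset.card_range]

/-- The result of one instruction: among the vertices of `A` whose number of neighbours in `B`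
lies between `lo` and `hi`, the first `t` are taken; `C` is added, and so is the vertex number `u`
(no vertex if `u = n`). -/
noncomputable def select {n : ℕ} (G : SimpleGraph (Fin n)) (A B C : Finset (Fin n))
    (lo hi t u : ℕ) : Finset (Fin n) :=
  lead t (A.filter fun v => lo ≤ nbrCount G B v ∧ nbrCount G B v ≤ hi) ∪ C
    ∪ Finset.univ.filter fun v => v.val = u

/-- `Derivable G W l`: `l` lists, the last one first, the sets computed by a straight-line program
of `select` instructions that starts from `W`, its complement and the empty set. -/
inductive Derivable {n : ℕ} (G : SimpleGraph (Fin n)) (W : Finset (Fin n)) :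
    List (Finset (Fin n)) → Prop
  | start : Derivable G W [∅, Wᶜ, W]
  | step {l : List (Finset (Fin n))} {A B C : Finset (Fin n)} {lo hi t u : ℕ} :
      Derivable G W l → A ∈ l → B ∈ l → C ∈ l → lo ≤ n → hi ≤ n → t ≤ n → u ≤ n →
      Derivable G W (select G A B C lo hi t u :: l)

namespace Derivable

variable {n : ℕ} {G : SimpleGraph (Fin n)} {W : Finset (Fin n)} {l : List (Finset (Fin n))}

theorem empty_mem (h : Derivable G W l) : ∅ ∈ l := by
  induction h with
  | start => simp
  | step _ _ _ _ _ _ _ _ ih => exact List.mem_cons_of_mem _ ih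

theorem compl_mem (h : Derivable G W l) : Wᶜ ∈ l := by
  induction h with
  | start => simp
  | step _ _ _ _ _ _ _ _ ih => exact List.mem_cons_of_mem _ ih

theorem filter_val_eq : (Finset.univ.filter fun v : Fin n => v.val = n) = ∅ := by
  ext v; simp [v.isLt.ne]

theorem threshold (h : Derivable G W l) {A B C : Finset (Fin n)} (hA : A ∈ l) (hB : B ∈ l)
    (hC : C ∈ l) {τ t : ℕ} (hτ : τ ≤ n) (ht : t ≤ n) :
    Derivable G W ((lead t (A.filter fun v => τ ≤ nbrCount G B v) ∪ C) :: l) := by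
  have := h.step hA hB hC hτ le_rfl ht (le_refl n)
  simpa [select, filter_val_eq, nbrCount_le] using this

theorem filter_ge (h : Derivable G W l) {A B : Finset (Fin n)} (hA : A ∈ l) (hB : B ∈ l)
    {τ : ℕ} (hτ : τ ≤ n) :
    Derivable G W ((A.filter fun v => τ ≤ nbrCount G B v) :: l) := by
  have := h.threshold hA hB h.empty_mem hτ (le_refl n)
  rwa [lead_of_card_le ((Finset.card_le_univ _).trans (by simp)), Finset.union_empty] at this

theorem filter_le (h : Derivable G W l) {A B : Finset (Fin n)} (hA : A ∈ l) (hB : B ∈ l)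
    {τ : ℕ} (hτ : τ ≤ n) :
    Derivable G W ((A.filter fun v => nbrCount G B v ≤ τ) :: l) := by
  have := h.step hA hB h.empty_mem (Nat.zero_le n) hτ (le_refl n) (le_refl n)
  unfold select at this
  rw [lead_of_card_le ((Finset.card_le_univ _).trans (by simp)), filter_val_eq] at this
  simpa using this

theorem insert (h : Derivable G W l) {C : Finset (Fin n)} (hC : C ∈ l) (u : Fin n) :
    Derivable G W ((Insert.insert u C) :: l) := by
  have := h.step h.empty_mem h.empty_mem hC (Nat.zero_le n) (Nat.zero_le n) (Nat.zero_le n)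
    u.isLt.le
  have hu : (Finset.univ.filter fun v : Fin n => v.val = u.val) = {u} := by
    ext v; simp [Fin.ext_iff]
  unfold select at this
  rwa [lead_zero, hu, Finset.empty_union, Finset.union_comm, ← Finset.insert_eq] at this

/-- A set `U` of vertices is obtained within `|U|` further instructions. -/
theorem cluster (h : Derivable G W l) (U : Finset (Fin n)) :
    ∃ l', Derivable G W l' ∧ l ⊆ l' ∧ U ∈ l' ∧ l'.length ≤ l.length + U.card := by
  induction U using Finset.induction_on with
  | empty => exact ⟨l, h, List.Subset.refl l, h.empty_mem, by simp⟩
  | insert a s ha ih =>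
    obtain ⟨l', h', hsub, hs, hlen⟩ := ih
    refine ⟨_, h'.insert hs a, List.Subset.trans hsub (List.subset_cons_self _ _), by simp, ?_⟩
    rw [Finset.card_insert_of_notMem ha]
    simp only [List.length_cons]; omega

/-- A straight-line program can be padded to any greater length without changing its result. -/
theorem pad (h : Derivable G W l) {A : Finset (Fin n)} (hA : A ∈ l) {N : ℕ} (hN : l.length < N) :
    ∃ l', Derivable G W (A :: l') ∧ l'.length + 1 = N := by
  induction N, hN using Nat.le_induction with
  | base =>
    refine ⟨l, ?_, rfl⟩
    have := h.threshold h.empty_mem h.empty_mem hA (Nat.zero_le n) (Nat.zero_le n)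
    rwa [lead_zero, Finset.empty_union] at this
  | succ N _ ih =>
    obtain ⟨l', h', hl⟩ := ih
    refine ⟨A :: l', ?_, by simp [hl]⟩
    have := h'.threshold h'.empty_mem h'.empty_mem (by simp : A ∈ A :: l') (Nat.zero_le n)
      (Nat.zero_le n)
    rwa [lead_zero, Finset.empty_union] at this

end Derivable

/-! ### Threshold sets -/

/-- The bound `1 + log n` on the `n`-th harmonic number. -/
noncomputable def logBound (n : ℕ) : ℝ := 1 + Real.log n

theorem one_le_logBound (n : ℕ) : 1 ≤ logBound n := by
  have := Real.log_natCast_nonneg n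
  unfold logBound; linarith

/-- If every threshold set `{f ≥ τ}` has at most `x / τ` elements, the sum of `f` is at most `x`
times a harmonic number. -/
theorem sum_le_of_threshold {α : Type*} (Q : Finset α) (f : α → ℕ) {n : ℕ}
    (hf : ∀ v ∈ Q, f v ≤ n) {x : ℝ} (hx : 0 ≤ x)
    (h : ∀ τ, 1 ≤ τ → τ ≤ n → (τ : ℝ) * (Q.filter fun v => τ ≤ f v).card ≤ x) :
    ((∑ v ∈ Q, f v : ℕ) : ℝ) ≤ x * logBound n := by
  have h1 : ∑ v ∈ Q, f v = ∑ i ∈ Finset.range n, (Q.filter fun v => i + 1 ≤ f v).card := by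
    simp only [Finset.card_filter]
    rw [Finset.sum_comm]
    refine Finset.sum_congr rfl fun v hv => ?_
    rw [← Finset.card_filter]
    have : (Finset.range n).filter (fun i => i + 1 ≤ f v) = Finset.range (f v) := by
      ext i
      have := hf v hv
      simp only [Finset.mem_filter, Finset.mem_range]
      omega
    rw [this, Finset.card_range]
  have h2 : ((∑ v ∈ Q, f v : ℕ) : ℝ) ≤ ∑ i ∈ Finset.range n, x * ((i + 1 : ℕ) : ℝ)⁻¹ := by
    rw [h1, Nat.cast_sum]
    refine Finset.sum_le_sum fun i hi => ?_
    have hpos : (0 : ℝ) < ((i + 1 : ℕ) : ℝ) := by positivity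
    rw [← div_eq_mul_inv, le_div_iff₀ hpos, mul_comm]
    exact h (i + 1) (by omega) (by have := Finset.mem_range.1 hi; omega)
  refine h2.trans ?_
  rw [← Finset.mul_sum]
  refine mul_le_mul_of_nonneg_left ?_ hx
  have h3 := harmonic_le_one_add_log n
  simp only [harmonic, Rat.cast_sum, Rat.cast_inv, Rat.cast_natCast] at h3
  exact h3

/-- A sum of natural numbers is captured, up to a logarithm, by one threshold set. -/
theorem exists_threshold {α : Type*} (Q : Finset α) (f : α → ℕ) {n : ℕ}
    (hf : ∀ v ∈ Q, f v ≤ n) {x : ℝ} (hx : 0 < x) (h : x ≤ ((∑ v ∈ Q, f v : ℕ) : ℝ)) :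
    ∃ τ, 1 ≤ τ ∧ τ ≤ n ∧ x ≤ 2 * logBound n * (τ * (Q.filter fun v => τ ≤ f v).card) := by
  by_contra! hcon
  have hL := one_le_logBound n
  have h1 := sum_le_of_threshold Q f hf (x := x / (2 * logBound n)) (by positivity) (by
    intro τ h1 h2
    rw [le_div_iff₀ (by positivity)]
    have := hcon τ h1 h2
    linarith)
  have h2 : x / (2 * logBound n) * logBound n = x / 2 := by
    field_simp
  linarith

/-- A set of positive density contains a nonempty set of large minimum degree. -/
theorem exists_minDegree {n : ℕ} (G : SimpleGraph (Fin n)) {δ : ℝ} (hδ : 0 < δ)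
    (X : Finset (Fin n)) (hX : X.Nonempty) (h : 2 * δ * X.card ≤ degSum G X) :
    ∃ Y ⊆ X, Y.Nonempty ∧ ∀ v ∈ Y, δ ≤ nbrCount G Y v := by
  induction X using Finset.strongInduction with
  | H X ih =>
    by_cases hmin : ∀ v ∈ X, δ ≤ nbrCount G X v
    · exact ⟨X, Finset.Subset.refl X, hX, hmin⟩
    · push Not at hmin
      obtain ⟨v, hv, hlt⟩ := hmin
      have he := degSum_erase G hv
      have hc : ((X.erase v).card : ℝ) = X.card - 1 := by
        rw [Finset.card_erase_of_mem hv, Nat.cast_sub (Finset.card_pos.2 hX), Nat.cast_one]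
      have heR : (degSum G X : ℝ) = degSum G (X.erase v) + 2 * nbrCount G X v := by
        exact_mod_cast he
      have hbig : 2 * δ * (X.erase v).card ≤ degSum G (X.erase v) := by
        rw [hc]; linarith
      have hne : (X.erase v).Nonempty := by
        rw [Finset.nonempty_iff_ne_empty]
        intro h0
        have hX1 : X = {v} := by
          rw [← Finset.insert_erase hv, h0]
          rfl
        rw [hX1, degSum_singleton] at h
        simp only [Finset.card_singleton, Nat.cast_one, Nat.cast_zero] at h
        linarith
      obtain ⟨Y, hY, h1, h2⟩ := ih _ (Finset.erase_ssubset hv) hne hbig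
      exact ⟨Y, hY.trans (Finset.erase_subset _ _), h1, h2⟩

/-! ### What follows if no program finds a dense set -/

/-- No straight-line program of length `M` computes a nonempty set disjoint from `W` of at most
`2 k` vertices and average degree at least `ρ`. -/
def Sparse {n : ℕ} (G : SimpleGraph (Fin n)) (W : Finset (Fin n)) (M : ℕ) (ρ : ℝ) (k : ℕ) : Prop :=
  ∀ l, Derivable G W l → l.length ≤ M → ∀ A ∈ l, A ⊆ Wᶜ → A.Nonempty → A.card ≤ 2 * k →
    (degSum G A : ℝ) < ρ * A.card

section Sparse

variable {n : ℕ} {G : SimpleGraph (Fin n)} {W : Finset (Fin n)} {M : ℕ} {ρ : ℝ} {k : ℕ}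
  {l : List (Finset (Fin n))}

/-- If all of the `t ≤ k` vertices of `Q` have `τ` neighbours in a computed set `S`, let a program
choose `t` vertices `B` with that property, and up to `t` vertices `C` of `S` that have many
neighbours in `B`.  As `B ∪ C` is sparse, `τ` is small. -/
theorem Sparse.card_mul_le (hs : Sparse G W M ρ k) (hρ : 0 ≤ ρ) (hl : Derivable G W l)
    (hM : l.length + 2 ≤ M) {S Q : Finset (Fin n)} (hS : S ∈ l) (hSW : S ⊆ Wᶜ) (hQW : Q ⊆ Wᶜ)
    (hQk : Q.card ≤ k) {τ : ℕ} (hQ : ∀ v ∈ Q, τ ≤ nbrCount G S v) :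
    (Q.card : ℝ) * τ ≤ 4 * logBound n * ρ * max (Q.card : ℝ) S.card := by
  have hL := one_le_logBound n
  have hmax : (0 : ℝ) ≤ max (Q.card : ℝ) S.card := le_max_of_le_left (by positivity)
  by_cases h0 : Q.card * τ = 0
  · have : (Q.card : ℝ) * τ = 0 := by exact_mod_cast h0
    rw [this]; positivity
  have hQ0 : 0 < Q.card := Nat.pos_of_ne_zero fun h => h0 (by simp [h])
  have hτ0 : 0 < τ := Nat.pos_of_ne_zero fun h => h0 (by simp [h])
  obtain ⟨q, hq⟩ := Finset.card_pos.1 hQ0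
  have hτn : τ ≤ n := (hQ q hq).trans (nbrCount_le G S q)
  set t := Q.card with ht
  have htn : t ≤ n := (Finset.card_le_univ Q).trans (by simp)
  set B := lead t (Wᶜ.filter fun v => τ ≤ nbrCount G S v) with hB
  have hBd : Derivable G W (B :: l) := by
    have := hl.threshold hl.compl_mem hS hl.empty_mem hτn htn
    rwa [Finset.union_empty] at this
  have hBprop : ∀ v ∈ B, v ∈ Wᶜ ∧ τ ≤ nbrCount G S v := fun v hv =>
    Finset.mem_filter.1 (lead_subset _ _ hv)
  have hBcard : B.card = t := by
    rw [hB, card_lead, min_eq_left]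
    exact Finset.card_le_card fun v hv => Finset.mem_filter.2 ⟨hQW hv, hQ v hv⟩
  have hsum : ((t : ℝ) * τ) ≤ ((∑ v ∈ S, nbrCount G B v : ℕ) : ℝ) := by
    rw [sum_nbrCount_comm]
    have : t * τ ≤ ∑ v ∈ B, nbrCount G S v := by
      rw [← hBcard, ← smul_eq_mul]
      exact Finset.card_nsmul_le_sum _ _ _ fun v hv => (hBprop v hv).2
    exact_mod_cast this
  obtain ⟨σ, hσ1, hσn, hσ⟩ := exists_threshold S (nbrCount G B) (n := n)
    (fun v _ => nbrCount_le G B v) (by positivity) hsum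
  set Z := S.filter fun v => σ ≤ nbrCount G B v with hZ
  set C := lead t Z with hC
  have hAd := hBd.threshold (A := S) (B := B) (C := B) (List.mem_cons_of_mem _ hS) (by simp)
    (by simp) hσn htn
  have hAW : C ∪ B ⊆ Wᶜ := by
    refine Finset.union_subset (fun v hv => hSW ?_) fun v hv => (hBprop v hv).1
    exact (Finset.mem_filter.1 (lead_subset _ _ hv)).1
  have hCcard : C.card = min t Z.card := card_lead _ _
  have hAcard : (C ∪ B).card ≤ 2 * t := by
    have := Finset.card_union_le C B
    have := min_le_left t Z.card
    omega
  have hne : (C ∪ B).Nonempty := by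
    have : B.Nonempty := Finset.card_pos.1 (by omega)
    exact this.mono Finset.subset_union_right
  have hlt := hs _ hAd (by simp only [List.length_cons]; omega) (C ∪ B) (by simp [hC, hZ]) hAW hne
    (by omega)
  have hdeg : (σ : ℝ) * C.card ≤ degSum G (C ∪ B) := by
    have : C.card * σ ≤ degSum G (C ∪ B) := by
      rw [← smul_eq_mul]
      refine (Finset.card_nsmul_le_sum C (nbrCount G B) σ fun v hv => ?_).trans ?_
      · exact (Finset.mem_filter.1 (lead_subset _ _ hv)).2
      · exact (Finset.sum_le_sum fun v _ => nbrCount_mono G Finset.subset_union_right v).trans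
          (Finset.sum_le_sum_of_subset Finset.subset_union_left)
    rw [mul_comm]; exact_mod_cast this
  have hAcard' : ((C ∪ B).card : ℝ) ≤ 2 * t := by exact_mod_cast hAcard
  have hub : (σ : ℝ) * C.card ≤ ρ * (2 * t) :=
    hdeg.trans (hlt.le.trans (mul_le_mul_of_nonneg_left hAcard' hρ))
  have ht0 : (0 : ℝ) < t := by exact_mod_cast hQ0
  have hZS : (Z.card : ℝ) ≤ S.card := by exact_mod_cast Finset.card_filter_le _ _
  have hmax1 : (t : ℝ) ≤ max (t : ℝ) S.card := le_max_left _ _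
  have hmax2 : (S.card : ℝ) ≤ max (t : ℝ) S.card := le_max_right _ _
  refine hσ.trans ?_
  have key : (σ : ℝ) * Z.card ≤ 2 * ρ * max (t : ℝ) S.card := by
    rcases le_total Z.card t with hZt | hZt
    · rw [min_eq_right hZt] at hCcard
      rw [hCcard] at hub
      calc (σ : ℝ) * Z.card ≤ ρ * (2 * t) := hub
        _ = 2 * ρ * t := by ring
        _ ≤ _ := by gcongr
    · rw [min_eq_left hZt] at hCcard
      rw [hCcard] at hub
      have hσρ : (σ : ℝ) ≤ 2 * ρ := by
        refine le_of_mul_le_mul_right ?_ ht0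
        linarith
      calc (σ : ℝ) * Z.card ≤ 2 * ρ * S.card := by gcongr
        _ ≤ _ := by gcongr
  calc 2 * logBound n * (σ * Z.card) ≤ 2 * logBound n * (2 * ρ * max (t : ℝ) S.card) := by gcongr
    _ = _ := by ring

/-- The number of edges between a computed set `S` and a small set `Q`. -/
theorem Sparse.sum_nbrCount_le (hs : Sparse G W M ρ k) (hρ : 0 ≤ ρ) (hl : Derivable G W l)
    (hM : l.length + 2 ≤ M) {S Q : Finset (Fin n)} (hS : S ∈ l) (hSW : S ⊆ Wᶜ) (hQW : Q ⊆ Wᶜ)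
    (hQk : Q.card ≤ k) :
    ((∑ v ∈ Q, nbrCount G S v : ℕ) : ℝ)
      ≤ 4 * logBound n ^ 2 * ρ * max (Q.card : ℝ) S.card := by
  have hL := one_le_logBound n
  have hmax : (0 : ℝ) ≤ max (Q.card : ℝ) S.card := le_max_of_le_left (by positivity)
  have := sum_le_of_threshold Q (nbrCount G S) (n := n) (fun v _ => nbrCount_le G S v)
    (x := 4 * logBound n * ρ * max (Q.card : ℝ) S.card) (by positivity) (by
      intro τ _ _
      have hc := Finset.card_filter_le Q (fun v => τ ≤ nbrCount G S v)
      have h1 := hs.card_mul_le hρ hl hM hS hSW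
        (Q := Q.filter fun v => τ ≤ nbrCount G S v) ((Finset.filter_subset _ _).trans hQW)
        (hc.trans hQk) (τ := τ) (fun v hv => (Finset.mem_filter.1 hv).2)
      have hcR : ((Q.filter fun v => τ ≤ nbrCount G S v).card : ℝ) ≤ Q.card := by exact_mod_cast hc
      rw [mul_comm]
      refine h1.trans ?_
      gcongr)
  refine this.trans (le_of_eq ?_)
  ring

end Sparse

/-! ### Removing the vertices of large degree -/

theorem degSum_le_sdiff {n : ℕ} (G : SimpleGraph (Fin n)) (H T : Finset (Fin n)) :
    degSum G H ≤ degSum G (H \ T) + 2 * ∑ v ∈ H, nbrCount G T v := by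
  have hd : Disjoint (H \ T) (H ∩ T) := Finset.disjoint_sdiff_inter H T
  have hU : H \ T ∪ H ∩ T = H := Finset.sdiff_union_inter H T
  have h1 := degSum_union_of_disjoint G hd
  have h3 : ∑ v ∈ H ∩ T, nbrCount G H v
      = ∑ v ∈ H ∩ T, nbrCount G (H \ T) v + degSum G (H ∩ T) := by
    unfold degSum
    rw [← Finset.sum_add_distrib]
    refine Finset.sum_congr rfl fun v _ => ?_
    rw [← nbrCount_union_of_disjoint G hd v, hU]
  have h4 : ∑ v ∈ H ∩ T, nbrCount G H v ≤ ∑ v ∈ T, nbrCount G H v :=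
    Finset.sum_le_sum_of_subset Finset.inter_subset_right
  rw [sum_nbrCount_comm G T H] at h4
  rw [hU, gain] at h1
  omega

/-- If no computed set is dense, the ambient set can be cut down to a set `P` of bounded degree,
computed by one instruction, in such a way that a subset of `H` of large minimum degree
survives. -/
theorem Sparse.exists_bounded_degree {n : ℕ} {G : SimpleGraph (Fin n)} {W H : Finset (Fin n)}
    {M : ℕ} {ρ d : ℝ} (hs : Sparse G W M ρ H.card) (hM : 6 ≤ M) (hρ : 1 ≤ ρ)
    (hHW : H ⊆ Wᶜ) (hH : H.Nonempty) (hd : d * H.card ≤ degSum G H)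
    (hdρ : 16 * logBound n ^ 2 * ρ ≤ d) :
    ∃ (D : ℕ) (P H' : Finset (Fin n)), 1 ≤ D ∧ D ≤ n ∧
      (D : ℝ) * H.card ≤ 8 * logBound n * ρ * n ∧ Derivable G W [P, ∅, Wᶜ, W] ∧ P ⊆ Wᶜ ∧
      (∀ v ∈ P, nbrCount G P v ≤ D) ∧ H' ⊆ H ∧ H' ⊆ P ∧ H'.Nonempty ∧
      ∀ v ∈ H', d / 4 ≤ nbrCount G H' v := by
  have hL := one_le_logBound n
  have hk : 0 < H.card := Finset.card_pos.2 hH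
  have hkR : (0 : ℝ) < H.card := by exact_mod_cast hk
  have hkn : H.card ≤ n := (Finset.card_le_univ H).trans (by simp)
  have hknR : (H.card : ℝ) ≤ n := by exact_mod_cast hkn
  have hn : 1 ≤ n := hk.trans_le hkn
  set X : ℝ := 4 * logBound n * ρ * n / H.card with hX
  have hXk : X * H.card = 4 * logBound n * ρ * n := by rw [hX]; field_simp
  have hX1 : 1 ≤ X := by
    rw [hX, le_div_iff₀ hkR]
    have : (1 : ℝ) * 1 * H.card ≤ (4 * logBound n) * ρ * n := by
      gcongr; linarith
    linarith
  obtain ⟨D, hD1, hDn, hDX, hDT⟩ : ∃ D : ℕ, 1 ≤ D ∧ D ≤ n ∧ (D : ℝ) ≤ 2 * X ∧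
      (D = n ∨ X < D) := by
    rcases le_total (⌊X⌋₊ + 1) n with h | h
    · refine ⟨⌊X⌋₊ + 1, by omega, h, ?_, Or.inr ?_⟩
      · push_cast
        have := Nat.floor_le (by linarith : 0 ≤ X)
        linarith
      · exact_mod_cast Nat.lt_floor_add_one X
    · refine ⟨n, hn, le_rfl, ?_, Or.inl rfl⟩
      have := Nat.floor_le (by linarith : 0 ≤ X)
      have h' : (n : ℝ) ≤ ⌊X⌋₊ + 1 := by exact_mod_cast h
      linarith
  have h0 : Derivable G W [∅, Wᶜ, W] := Derivable.start
  set T := (Wᶜ : Finset (Fin n)).filter fun v => D ≤ nbrCount G Wᶜ v with hT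
  have hTd : Derivable G W [T, ∅, Wᶜ, W] := h0.filter_ge (by simp) (by simp) hDn
  have hTW : T ⊆ Wᶜ := Finset.filter_subset _ _
  have hTk : T.card ≤ H.card := by
    by_contra! hlt
    obtain ⟨Q, hQT, hQk⟩ := Finset.exists_subset_card_eq hlt.le
    rcases hDT with hDT | hDT
    · obtain ⟨v, hv⟩ := Finset.card_pos.1 (hk.trans hlt)
      have h1 := (Finset.mem_filter.1 hv).2
      have h2 := nbrCount_lt G (Wᶜ) v
      omega
    · have h1 := hs.card_mul_le (by linarith) h0
        (by simp only [List.length_cons, List.length_nil]; omega)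
        (S := Wᶜ) (Q := Q) (by simp) (Finset.Subset.refl _) (hQT.trans hTW) hQk.le (τ := D)
        (fun v hv => (Finset.mem_filter.1 (hQT hv)).2)
      have h2 : max (Q.card : ℝ) (Wᶜ : Finset (Fin n)).card ≤ n := by
        refine max_le (by rw [hQk]; exact hknR) ?_
        exact_mod_cast (Finset.card_le_univ _).trans (by simp)
      rw [hQk] at h1 h2
      have h3 : 4 * logBound n * ρ * max (H.card : ℝ) (Wᶜ : Finset (Fin n)).card
          ≤ 4 * logBound n * ρ * n := by gcongr
      have h4 : X * H.card < D * H.card := by gcongr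
      linarith
  have hcut : (degSum G H : ℝ) ≤ degSum G (H \ T) + 8 * logBound n ^ 2 * ρ * H.card := by
    have h1 := hs.sum_nbrCount_le (by linarith) hTd
      (by simp only [List.length_cons, List.length_nil]; omega) (S := T) (Q := H) (by simp) hTW hHW
      le_rfl
    rw [max_eq_left (by exact_mod_cast hTk)] at h1
    have h2 : (degSum G H : ℝ) ≤ degSum G (H \ T) + 2 * ((∑ v ∈ H, nbrCount G T v : ℕ) : ℝ) := by
      exact_mod_cast degSum_le_sdiff G H T
    linarith
  have hd0 : 0 < d := lt_of_lt_of_le (by positivity) hdρ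
  have hhalf : d / 2 * H.card ≤ degSum G (H \ T) := by
    have : 16 * logBound n ^ 2 * ρ * H.card ≤ d * H.card := by gcongr
    linarith
  have hne : (H \ T).Nonempty := by
    rw [Finset.nonempty_iff_ne_empty]
    intro he
    rw [he] at hhalf
    have : 0 < d / 2 * H.card := by positivity
    simp [degSum] at hhalf
    linarith
  obtain ⟨Y, hY, hYne, hYd⟩ := exists_minDegree G (δ := d / 4) (by linarith) (H \ T) hne (by
    have h1 : ((H \ T).card : ℝ) ≤ H.card := by
      exact_mod_cast Finset.card_le_card Finset.sdiff_subset
    have h2 : d / 2 * (H \ T).card ≤ d / 2 * H.card := by gcongr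
    linarith)
  set P := (Wᶜ : Finset (Fin n)).filter fun v => nbrCount G Wᶜ v ≤ D - 1 with hP
  refine ⟨D, P, Y, hD1, hDn, ?_, h0.filter_le (by simp) (by simp) (by omega),
    Finset.filter_subset _ _, fun v hv => ?_, hY.trans Finset.sdiff_subset, ?_, hYne, hYd⟩
  · calc (D : ℝ) * H.card ≤ 2 * X * H.card := by gcongr
      _ = _ := by rw [mul_assoc, hXk]; ring
  · have hPW : P ⊆ Wᶜ := Finset.filter_subset _ _
    have h1 := nbrCount_mono G hPW v
    have h2 := (Finset.mem_filter.1 hv).2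
    omega
  · intro v hv
    obtain ⟨hvH, hvT⟩ := Finset.mem_sdiff.1 (hY hv)
    refine Finset.mem_filter.2 ⟨hHW hvH, ?_⟩
    by_contra hcon
    exact hvT (Finset.mem_filter.2 ⟨hHW hvH, by omega⟩)

/-! ### The two kinds of steps -/

section Steps

variable {n : ℕ} {G : SimpleGraph (Fin n)} {W P H : Finset (Fin n)} {M k D m : ℕ} {ρ δ : ℝ}
  {l : List (Finset (Fin n))}

theorem mul_le_sum_nbrCount (hδ : ∀ v ∈ H, δ ≤ nbrCount G H v) {X : Finset (Fin n)} (hX : X ⊆ H) :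
    X.card * δ ≤ ((∑ v ∈ H, nbrCount G X v : ℕ) : ℝ) := by
  rw [sum_nbrCount_comm, Nat.cast_sum, ← nsmul_eq_mul]
  exact Finset.card_nsmul_le_sum _ _ _ fun v hv => hδ v (hX hv)

/-- A backbone step replaces a set `S` by the set of vertices with many neighbours in `S`. -/
theorem Sparse.backbone (hs : Sparse G W M ρ k) (hρ : 0 < ρ) (hl : Derivable G W l)
    (hM : l.length + 2 ≤ M) (hPl : P ∈ l) (hPW : P ⊆ Wᶜ) (hPD : ∀ v ∈ P, nbrCount G P v ≤ D)
    (hHP : H ⊆ P) (hHk : H.card ≤ k) (hδ0 : 0 < δ) (hδ : ∀ v ∈ H, δ ≤ nbrCount G H v)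
    {S : Finset (Fin n)} (hS : S ∈ l) (hSP : S ⊆ P) (hSH : (S ∩ H).Nonempty)
    (hbig : 8 * logBound n ^ 2 * ρ * S.card < (S ∩ H).card * δ) :
    ∃ S', Derivable G W (S' :: l) ∧ S' ⊆ P ∧ (S' ∩ H).Nonempty ∧
      ((S ∩ H).card * δ) * S'.card ≤ 2 * logBound n * (S' ∩ H).card * (S.card * D) ∧
      (S ∩ H).card * δ ≤ 8 * logBound n ^ 2 * ρ * (S' ∩ H).card := by
  have hL := one_le_logBound n
  have hh : (0 : ℝ) < (S ∩ H).card := by exact_mod_cast Finset.card_pos.2 hSH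
  have hsum : (S ∩ H).card * δ ≤ ((∑ v ∈ H, nbrCount G S v : ℕ) : ℝ) := by
    refine (mul_le_sum_nbrCount hδ Finset.inter_subset_right).trans ?_
    exact_mod_cast Finset.sum_le_sum fun v _ => nbrCount_mono G Finset.inter_subset_left v
  obtain ⟨τ, hτ1, hτn, hτ⟩ := exists_threshold H (nbrCount G S) (n := n)
    (fun v _ => nbrCount_le G S v) (by positivity) hsum
  set Q := H.filter fun v => τ ≤ nbrCount G S v with hQ
  set S' := P.filter fun v => τ ≤ nbrCount G S v with hS'
  have hQS : S' ∩ H = Q := by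
    ext v
    simp only [hS', hQ, Finset.mem_inter, Finset.mem_filter]
    exact ⟨fun h => ⟨h.2, h.1.2⟩, fun h => ⟨⟨hHP h.1, h.2⟩, h.1⟩⟩
  have hloc := hs.card_mul_le hρ.le hl hM hS (hSP.trans hPW) (Q := Q)
    ((Finset.filter_subset _ _).trans (hHP.trans hPW)) ((Finset.card_filter_le _ _).trans hHk)
    (fun v hv => (Finset.mem_filter.1 hv).2)
  have hQpos : (0 : ℝ) < Q.card := by
    rcases Nat.eq_zero_or_pos Q.card with h | h
    · rw [h] at hτ
      have : 0 < (S ∩ H).card * δ := by positivity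
      simp at hτ
      linarith
    · exact_mod_cast h
  refine ⟨S', hl.filter_ge hPl hS hτn, Finset.filter_subset _ _, ?_, ?_, ?_⟩
  · rw [hQS]; exact Finset.card_pos.1 (by exact_mod_cast hQpos)
  · rw [hQS]
    -- double counting of the edges between `S` and `S'`
    have h1 : (τ : ℝ) * S'.card ≤ S.card * D := by
      have : S'.card * τ ≤ S.card * D := by
        calc S'.card * τ ≤ ∑ v ∈ S', nbrCount G S v := by
              rw [← smul_eq_mul]
              exact Finset.card_nsmul_le_sum _ _ _ fun v hv => (Finset.mem_filter.1 hv).2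
          _ = ∑ v ∈ S, nbrCount G S' v := sum_nbrCount_comm G _ _
          _ ≤ S.card • D := Finset.sum_le_card_nsmul _ _ _ fun v hv =>
              (nbrCount_mono G (Finset.filter_subset _ _) v).trans (hPD v (hSP hv))
          _ = S.card * D := smul_eq_mul _ _
      rw [mul_comm]; exact_mod_cast this
    calc ((S ∩ H).card * δ) * S'.card ≤ 2 * logBound n * (τ * Q.card) * S'.card := by gcongr
      _ = 2 * logBound n * Q.card * (τ * S'.card) := by ring
      _ ≤ _ := by gcongr
  · rw [hQS]
    rcases le_total (S.card : ℝ) Q.card with hc | hc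
    · rw [max_eq_left hc] at hloc
      calc (S ∩ H).card * δ ≤ 2 * logBound n * (τ * Q.card) := hτ
        _ = 2 * logBound n * (Q.card * τ) := by ring
        _ ≤ 2 * logBound n * (4 * logBound n * ρ * Q.card) := by gcongr
        _ = _ := by ring
    · exfalso
      rw [max_eq_right hc] at hloc
      have : (S ∩ H).card * δ ≤ 8 * logBound n ^ 2 * ρ * S.card := by
        calc (S ∩ H).card * δ ≤ 2 * logBound n * (τ * Q.card) := hτ
          _ = 2 * logBound n * (Q.card * τ) := by ring
          _ ≤ 2 * logBound n * (4 * logBound n * ρ * S.card) := by gcongr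
          _ = _ := by ring
      linarith

/-- Greedy choice of a cluster `U`: as long as less than half of `S ∩ H` has a neighbour in `U`,
a vertex is added that is good in proportion to the number of its neighbours in `S`. -/
theorem exists_cluster {S : Finset (Fin n)} {c γ : ℝ} (hγ : 0 ≤ γ)
    (hstep : ∀ X ⊆ S ∩ H, ((S ∩ H).card : ℝ) ≤ 2 * X.card →
      ∃ u, c ≤ nbrCount G X u ∧ γ * nbrCount G S u ≤ nbrCount G X u) (i : ℕ) :
    ∃ U : Finset (Fin n), U.card ≤ i ∧
      γ * (S.filter fun v => 1 ≤ nbrCount G U v).card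
        ≤ ((S.filter fun v => 1 ≤ nbrCount G U v) ∩ H).card ∧
      (((S ∩ H).card : ℝ) ≤ 2 * ((S.filter fun v => 1 ≤ nbrCount G U v) ∩ H).card ∨
        i * c ≤ ((S.filter fun v => 1 ≤ nbrCount G U v) ∩ H).card) := by
  classical
  induction i with
  | zero =>
    refine ⟨∅, by simp, ?_, Or.inr ?_⟩ <;> simp [nbrCount]
  | succ i ih =>
    obtain ⟨U, hU, h1, h2⟩ := ih
    set SU := S.filter fun v => 1 ≤ nbrCount G U v with hSU
    by_cases hdone : ((S ∩ H).card : ℝ) ≤ 2 * (SU ∩ H).card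
    · exact ⟨U, by omega, h1, Or.inl hdone⟩
    have h2 := h2.resolve_left hdone
    set X := (S ∩ H) \ (SU ∩ H) with hX
    have hsub : SU ∩ H ⊆ S ∩ H := Finset.inter_subset_inter_right (Finset.filter_subset _ _)
    have hXc : (X.card : ℝ) = (S ∩ H).card - (SU ∩ H).card := by
      rw [hX, Finset.card_sdiff_of_subset hsub, Nat.cast_sub (Finset.card_le_card hsub)]
    obtain ⟨u, hu1, hu2⟩ := hstep X Finset.sdiff_subset (by push Not at hdone; linarith)
    set SU' := S.filter fun v => 1 ≤ nbrCount G (insert u U) v with hSU'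
    have hmem : ∀ v, v ∈ SU' ↔ v ∈ SU ∨ (v ∈ S ∧ G.Adj u v) := by
      intro v
      have : ∀ A : Finset (Fin n), 1 ≤ nbrCount G A v ↔ ∃ a ∈ A, G.Adj v a := by
        intro A
        rw [nbrCount, Nat.one_le_iff_ne_zero, ← Nat.pos_iff_ne_zero, Finset.card_pos]
        simp [Finset.Nonempty]
      simp only [hSU', hSU, Finset.mem_filter, this, Finset.exists_mem_insert, G.adj_comm v u]
      rw [and_or_left, or_comm]
    have hle : SU' ⊆ SU ∪ S.filter (fun v => G.Adj u v) := by
      intro v hv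
      rcases (hmem v).1 hv with h | h
      · exact Finset.mem_union_left _ h
      · exact Finset.mem_union_right _ (Finset.mem_filter.2 h)
    have hge : (SU ∩ H) ∪ X.filter (fun v => G.Adj u v) ⊆ SU' ∩ H := by
      intro v hv
      rw [Finset.mem_inter, hmem]
      rcases Finset.mem_union.1 hv with h | h
      · exact ⟨Or.inl (Finset.mem_inter.1 h).1, (Finset.mem_inter.1 h).2⟩
      · obtain ⟨h3, h4⟩ := Finset.mem_filter.1 h
        have h5 := Finset.mem_inter.1 (Finset.mem_sdiff.1 h3).1
        exact ⟨Or.inr ⟨h5.1, h4⟩, h5.2⟩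
    have hcle : (SU'.card : ℝ) ≤ SU.card + nbrCount G S u := by
      exact_mod_cast (Finset.card_le_card hle).trans (Finset.card_union_le _ _)
    have hcge : ((SU ∩ H).card : ℝ) + nbrCount G X u ≤ (SU' ∩ H).card := by
      have hdisj : Disjoint (SU ∩ H) (X.filter fun v => G.Adj u v) :=
        Finset.disjoint_left.2 fun v hv hv' =>
          (Finset.mem_sdiff.1 (Finset.mem_filter.1 hv').1).2 hv
      have := Finset.card_le_card hge
      rw [Finset.card_union_of_disjoint hdisj] at this
      exact_mod_cast this
    refine ⟨insert u U, (Finset.card_insert_le _ _).trans (by omega), ?_, Or.inr ?_⟩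
    · calc γ * SU'.card ≤ γ * (SU.card + nbrCount G S u) := by gcongr
        _ = γ * SU.card + γ * nbrCount G S u := by ring
        _ ≤ (SU ∩ H).card + nbrCount G X u := by gcongr
        _ ≤ _ := hcge
    · push_cast
      linarith

/-- A hair step replaces `S` by the set of its vertices that have a neighbour in a cluster of `m`
vertices. -/
theorem Sparse.hair (hs : Sparse G W M ρ k) (hρ : 0 < ρ) (hl : Derivable G W l)
    (hM : l.length + 2 ≤ M) (hPW : P ⊆ Wᶜ)
    (hHP : H ⊆ P) (hHk : H.card ≤ k) (hδ0 : 0 < δ) (hδ : ∀ v ∈ H, δ ≤ nbrCount G H v)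
    {S : Finset (Fin n)} (hS : S ∈ l) (hSP : S ⊆ P) (hSH : (S ∩ H).Nonempty)
    (hSk : H.card ≤ S.card) (hm : 1 ≤ m) (hn : 1 ≤ n) :
    ∃ S' l', Derivable G W l' ∧ l'.length ≤ l.length + m + 1 ∧ l ⊆ l' ∧ S' ∈ l' ∧ S' ⊆ P ∧
      (S' ∩ H).Nonempty ∧
      ((S ∩ H).card * δ) * S'.card ≤ 16 * logBound n ^ 2 * ρ * S.card * (S' ∩ H).card ∧
      (((S ∩ H).card : ℝ) ≤ 2 * (S' ∩ H).card ∨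
        m * ((S ∩ H).card * δ) ≤ 8 * H.card * (S' ∩ H).card) := by
  have hL := one_le_logBound n
  have hh : (0 : ℝ) < (S ∩ H).card := by exact_mod_cast Finset.card_pos.2 hSH
  have hHc : (0 : ℝ) < H.card := by
    exact_mod_cast Finset.card_pos.2 (hSH.mono Finset.inter_subset_right)
  have hSc : (0 : ℝ) < S.card := by
    exact_mod_cast Finset.card_pos.2 (hSH.mono Finset.inter_subset_left)
  have hedge := hs.sum_nbrCount_le hρ.le hl hM hS (hSP.trans hPW) (hHP.trans hPW) hHk
  rw [max_eq_right (by exact_mod_cast hSk)] at hedge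
  set x : ℝ := (S ∩ H).card * δ with hx
  have hx0 : 0 < x := by positivity
  set γ : ℝ := x / (16 * logBound n ^ 2 * ρ * S.card) with hγdef
  set c : ℝ := x / (8 * H.card) with hcdef
  have hγ : 0 < γ := by positivity
  have hc : 0 < c := by positivity
  obtain ⟨U, hU, h1, h2⟩ := exists_cluster (G := G) (S := S) (H := H) (c := c) hγ.le (by
    intro X hX hXc
    by_contra! hcon
    have hlow := mul_le_sum_nbrCount hδ (hX.trans Finset.inter_subset_right)
    have hup : ((∑ u ∈ H, nbrCount G X u : ℕ) : ℝ) ≤ ∑ u ∈ H, (c + γ * nbrCount G S u) := by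
      rw [Nat.cast_sum]
      refine Finset.sum_le_sum fun u _ => ?_
      have : (0 : ℝ) ≤ γ * nbrCount G S u := by positivity
      rcases lt_or_ge (nbrCount G X u : ℝ) c with h | h
      · linarith
      · have := hcon u h
        linarith
    rw [Finset.sum_add_distrib, ← Finset.mul_sum, Finset.sum_const, nsmul_eq_mul] at hup
    have e1 : (H.card : ℝ) * c = x / 8 := by rw [hcdef]; field_simp
    have e2 : γ * ∑ u ∈ H, (nbrCount G S u : ℝ) ≤ x / 4 := by
      calc γ * ∑ u ∈ H, (nbrCount G S u : ℝ) ≤ γ * (4 * logBound n ^ 2 * ρ * S.card) := by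
            gcongr
            exact_mod_cast hedge
        _ = x / 4 := by rw [hγdef]; field_simp; norm_num
    have e3 : x ≤ 2 * (X.card * δ) := by
      rw [hx]
      have := mul_le_mul_of_nonneg_right hXc hδ0.le
      linarith
    linarith) m
  set S' := S.filter fun v => 1 ≤ nbrCount G U v with hS'
  have hpos : (0 : ℝ) < (S' ∩ H).card := by
    rcases h2 with h2 | h2
    · linarith
    · have : (0 : ℝ) < m * c := by
        have : (0 : ℝ) < m := by exact_mod_cast hm
        positivity
      linarith
  obtain ⟨l', hl', hsub, hUl, hlen⟩ := hl.cluster U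
  refine ⟨S', S' :: l', hl'.filter_ge (hsub hS) hUl hn, ?_,
    List.Subset.trans hsub (List.subset_cons_self _ _), by simp,
    (Finset.filter_subset _ _).trans hSP, Finset.card_pos.1 (by exact_mod_cast hpos), ?_, ?_⟩
  · simp only [List.length_cons]; omega
  · have hden : (0 : ℝ) < 16 * logBound n ^ 2 * ρ * S.card := by positivity
    have : x * S'.card = (16 * logBound n ^ 2 * ρ * S.card) * (γ * S'.card) := by
      rw [hγdef]; field_simp
    rw [this]
    gcongr
  · refine h2.imp id fun h => ?_
    have : m * x = 8 * H.card * (m * c) := by rw [hcdef]; field_simp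
    rw [this]
    gcongr

end Steps

/-! ### The potential argument -/

/-- The potential of a computed set `S` with respect to `H`: the logarithm of
`|S ∩ H| / |S| ^ (1 - θ)`.  The weight `θ` balances the two kinds of steps. -/
noncomputable def potential {n : ℕ} (θ : ℝ) (H S : Finset (Fin n)) : ℝ :=
  Real.log (S ∩ H).card - (1 - θ) * Real.log S.card

theorem log_eight_le {n : ℕ} : Real.log 8 ≤ Real.log (16 * logBound n ^ 2) := by
  have hL := one_le_logBound n
  refine Real.log_le_log (by norm_num) ?_
  nlinarith

section Walk

variable {n : ℕ} {G : SimpleGraph (Fin n)} {W P H : Finset (Fin n)} {M k D m : ℕ} {ρ δ θ η : ℝ}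
  {l : List (Finset (Fin n))}

/-- From a set that is not worse than a cluster of `m` vertices of `H`, one further step gains `η`
in potential: a hair step if the set is at least as large as `H`, a backbone step otherwise.  The
hypotheses `hr1` and `hr3` make up for the losses of these steps, and `hr2` says that the set has so
many neighbours in `H` that a backbone step is possible. -/
theorem Sparse.walk_step (hs : Sparse G W M ρ k) (hρ : 1 ≤ ρ) (hl : Derivable G W l)
    (hM : l.length + 2 ≤ M) (hPl : P ∈ l) (hPW : P ⊆ Wᶜ) (hPD : ∀ v ∈ P, nbrCount G P v ≤ D)
    (hD : 1 ≤ D) (hHP : H ⊆ P) (hHk : H.card ≤ k) (hδ0 : 0 < δ)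
    (hδ : ∀ v ∈ H, δ ≤ nbrCount G H v) (hm : 1 ≤ m) (hθ0 : 0 ≤ θ) (hθ1 : θ ≤ 1) (hη : 0 < η)
    (hr1 : (1 - θ) * (Real.log D - Real.log ρ)
      ≤ Real.log δ - Real.log ρ - η - Real.log (16 * logBound n ^ 2))
    (hr2 : η + Real.log (16 * logBound n ^ 2) ≤ (1 - θ) * (Real.log δ - Real.log ρ))
    (hr3 : θ * (Real.log H.card - Real.log m)
      ≤ Real.log δ - Real.log ρ - η - Real.log (16 * logBound n ^ 2))
    {S : Finset (Fin n)} (hS : S ∈ l) (hSP : S ⊆ P) (hSH : (S ∩ H).Nonempty)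
    (hpot : θ * Real.log m ≤ potential θ H S) :
    ∃ S' l', Derivable G W l' ∧ l'.length ≤ l.length + (m + 1) ∧ l ⊆ l' ∧ S' ∈ l' ∧ S' ⊆ P ∧
      (S' ∩ H).Nonempty ∧ potential θ H S + η ≤ potential θ H S' := by
  have hL := one_le_logBound n
  have hL0 : logBound n ≠ 0 := by positivity
  have hρ0 : 0 < ρ := by linarith
  have hlogρ : 0 ≤ Real.log ρ := Real.log_nonneg hρ
  set lam := Real.log (16 * logBound n ^ 2) with hlam
  have hlam8 : Real.log 8 ≤ lam := log_eight_le
  have hlog2 : Real.log 2 ≤ Real.log 8 := Real.log_le_log (by norm_num) (by norm_num)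
  have pos : ∀ {X : Finset (Fin n)}, X.Nonempty → (0 : ℝ) < X.card := fun h => by
    exact_mod_cast Finset.card_pos.2 h
  have hh := pos hSH
  have hSc := pos (hSH.mono Finset.inter_subset_left)
  have hHc := pos (hSH.mono Finset.inter_subset_right)
  have hm0 : (0 : ℝ) < m := by exact_mod_cast hm
  have hD0 : (0 : ℝ) < D := by exact_mod_cast hD
  have hn : 1 ≤ n := by
    obtain ⟨v, _⟩ := hSH
    have := v.pos
    omega
  unfold potential at hpot ⊢
  rcases lt_or_ge S.card H.card with hc | hc
  · have hcR : Real.log S.card ≤ Real.log H.card :=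
      Real.log_le_log hSc (by exact_mod_cast hc.le)
    have hbig : 8 * logBound n ^ 2 * ρ * S.card < (S ∩ H).card * δ := by
      rw [← Real.log_lt_log_iff (by positivity) (by positivity),
        Real.log_mul (by positivity) hSc.ne', Real.log_mul (by positivity) hρ0.ne',
        Real.log_mul hh.ne' hδ0.ne']
      have h8 : Real.log (8 * logBound n ^ 2) ≤ lam :=
        Real.log_le_log (by positivity) (by gcongr; norm_num)
      have : θ * Real.log S.card ≤ θ * Real.log H.card := by gcongr
      linarith
    obtain ⟨S', hS'd, hS'P, hS'H, h1, h2⟩ :=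
      hs.backbone hρ0 hl hM hPl hPW hPD hHP hHk hδ0 hδ hS hSP hSH hbig
    refine ⟨S', S' :: l, hS'd, ?_, List.subset_cons_self _ _, by simp, hS'P, hS'H, ?_⟩
    · simp only [List.length_cons]; omega
    have hh' := pos hS'H
    have hSc' := pos (hS'H.mono Finset.inter_subset_left)
    have e1 := Real.log_le_log (by positivity) h1
    have e2 := Real.log_le_log (by positivity) h2
    rw [Real.log_mul (by positivity) hSc'.ne', Real.log_mul hh.ne' hδ0.ne',
      Real.log_mul (by positivity) (by positivity), Real.log_mul (by positivity) hh'.ne',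
      Real.log_mul hSc.ne' hD0.ne'] at e1
    rw [Real.log_mul hh.ne' hδ0.ne', Real.log_mul (by positivity) hh'.ne',
      Real.log_mul (by positivity) hρ0.ne'] at e2
    have h8 : Real.log (8 * logBound n ^ 2) ≤ lam :=
      Real.log_le_log (by positivity) (by gcongr; norm_num)
    have h2L : Real.log (2 * logBound n) ≤ lam :=
      Real.log_le_log (by positivity) (by nlinarith)
    have f1 : (1 - θ) * (Real.log S'.card - Real.log S.card) ≤
        (1 - θ) * (lam + Real.log D - Real.log δ + Real.log (S' ∩ H).card
          - Real.log (S ∩ H).card) := by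
      refine mul_le_mul_of_nonneg_left ?_ (by linarith)
      linarith
    have f2 : θ * (Real.log δ - Real.log ρ - lam)
        ≤ θ * (Real.log (S' ∩ H).card - Real.log (S ∩ H).card) := by
      refine mul_le_mul_of_nonneg_left ?_ hθ0
      linarith
    linarith
  · obtain ⟨S', l', hl', hlen, hsub, hS', hS'P, hS'H, h1, h2⟩ :=
      hs.hair hρ0 hl hM hPW hHP hHk hδ0 hδ hS hSP hSH hc hm hn
    refine ⟨S', l', hl', by omega, hsub, hS', hS'P, hS'H, ?_⟩
    have hh' := pos hS'H
    have hSc' := pos (hS'H.mono Finset.inter_subset_left)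
    have e1 := Real.log_le_log (by positivity) h1
    rw [Real.log_mul (by positivity) hSc'.ne', Real.log_mul hh.ne' hδ0.ne',
      Real.log_mul (by positivity) hh'.ne', Real.log_mul (by positivity) hSc.ne',
      Real.log_mul (by positivity) hρ0.ne'] at e1
    have f1 : (1 - θ) * (Real.log S'.card - Real.log S.card) ≤
        (1 - θ) * (lam + Real.log ρ - Real.log δ + Real.log (S' ∩ H).card
          - Real.log (S ∩ H).card) := by
      refine mul_le_mul_of_nonneg_left ?_ (by linarith)
      linarith
    have hθlam : θ * Real.log 8 ≤ θ * lam := by gcongr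
    have hθρ : 0 ≤ θ * Real.log ρ := by positivity
    rcases h2 with h2 | h2
    · have e2 := Real.log_le_log hh h2
      rw [Real.log_mul (by norm_num) hh'.ne'] at e2
      have f2 : θ * (-lam) ≤ θ * (Real.log (S' ∩ H).card - Real.log (S ∩ H).card) := by
        refine mul_le_mul_of_nonneg_left ?_ hθ0
        linarith
      linarith
    · have e2 := Real.log_le_log (by positivity) h2
      rw [Real.log_mul hm0.ne' (by positivity), Real.log_mul hh.ne' hδ0.ne',
        Real.log_mul (by positivity) hh'.ne', Real.log_mul (by norm_num) hHc.ne'] at e2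
      have f2 : θ * (Real.log m + Real.log δ - lam - Real.log H.card)
          ≤ θ * (Real.log (S' ∩ H).card - Real.log (S ∩ H).card) := by
        refine mul_le_mul_of_nonneg_left ?_ hθ0
        linarith
      linarith

theorem potential_le (hθ1 : θ ≤ 1) {S : Finset (Fin n)} (hSH : (S ∩ H).Nonempty) :
    potential θ H S ≤ Real.log n := by
  have h1 : (0 : ℝ) < (S ∩ H).card := by exact_mod_cast Finset.card_pos.2 hSH
  have h2 : ((S ∩ H).card : ℝ) ≤ S.card := by
    exact_mod_cast Finset.card_le_card Finset.inter_subset_left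
  have h3 : (S.card : ℝ) ≤ n := by exact_mod_cast (Finset.card_le_univ S).trans (by simp)
  have h4 : (1 : ℝ) ≤ S.card := by
    exact_mod_cast Finset.card_pos.2 (hSH.mono Finset.inter_subset_left)
  have e1 := Real.log_le_log h1 h2
  have e2 := Real.log_le_log (by linarith) h3
  have e3 := Real.log_nonneg h4
  unfold potential
  nlinarith

/-- The walk cannot go on for ever, as the potential is at most `log n`. -/
theorem Sparse.false_of_walk (hs : Sparse G W M ρ k) (hρ : 1 ≤ ρ) {J : ℕ}
    (hM : J * (m + 1) + m + 6 ≤ M) (hP : Derivable G W [P, ∅, Wᶜ, W]) (hPW : P ⊆ Wᶜ)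
    (hPD : ∀ v ∈ P, nbrCount G P v ≤ D) (hD : 1 ≤ D) (hHP : H ⊆ P) (hHk : H.card ≤ k)
    (hδ0 : 0 < δ) (hδ : ∀ v ∈ H, δ ≤ nbrCount G H v) (hm : 1 ≤ m) (hmH : m ≤ H.card)
    (hθ0 : 0 ≤ θ) (hθ1 : θ ≤ 1) (hη : 0 < η)
    (hr1 : (1 - θ) * (Real.log D - Real.log ρ)
      ≤ Real.log δ - Real.log ρ - η - Real.log (16 * logBound n ^ 2))
    (hr2 : η + Real.log (16 * logBound n ^ 2) ≤ (1 - θ) * (Real.log δ - Real.log ρ))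
    (hr3 : θ * (Real.log H.card - Real.log m)
      ≤ Real.log δ - Real.log ρ - η - Real.log (16 * logBound n ^ 2))
    (hJ : Real.log n < J * η) : False := by
  obtain ⟨U, hUH, hUm⟩ := Finset.exists_subset_card_eq hmH
  have hUne : U.Nonempty := Finset.card_pos.1 (by omega)
  obtain ⟨l0, hl0, hsub0, hU0, hlen0⟩ := hP.cluster U
  have hm1 : (1 : ℝ) ≤ m := by exact_mod_cast hm
  have hlogm := Real.log_nonneg hm1
  have key : ∀ i ≤ J, ∃ S l, Derivable G W l ∧ l.length ≤ i * (m + 1) + m + 4 ∧ P ∈ l ∧ S ∈ l ∧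
      S ⊆ P ∧ (S ∩ H).Nonempty ∧ θ * Real.log m + i * η ≤ potential θ H S := by
    intro i
    induction i with
    | zero =>
      intro _
      have hUi : U ∩ H = U := Finset.inter_eq_left.2 hUH
      refine ⟨U, l0, hl0, ?_, hsub0 (by simp), hU0, hUH.trans hHP, by rwa [hUi], ?_⟩
      · simp only [List.length_cons, List.length_nil] at hlen0; omega
      · rw [potential, hUi, hUm]
        simp only [Nat.cast_zero]
        linarith
    | succ i ih =>
      intro hi
      obtain ⟨S, l, hl, hlen, hPl, hS, hSP, hSH, hpot⟩ := ih (by omega)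
      have hii : i * (m + 1) + (m + 1) ≤ J * (m + 1) := by
        rw [← Nat.succ_mul]; exact Nat.mul_le_mul_right _ hi
      have hiη : 0 ≤ (i : ℝ) * η := by positivity
      obtain ⟨S', l', hl', hlen', hsub', hS', hS'P, hS'H, hpot'⟩ :=
        hs.walk_step hρ hl (by omega) hPl hPW hPD hD hHP hHk hδ0 hδ hm hθ0 hθ1 hη hr1 hr2 hr3
          hS hSP hSH (by linarith)
      refine ⟨S', l', hl', ?_, hsub' hPl, hS', hS'P, hS'H, ?_⟩
      · rw [Nat.succ_mul]; omega
      · push_cast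
        linarith
  obtain ⟨S, _, _, _, _, _, _, hSH, hpot⟩ := key J le_rfl
  have h1 := potential_le hθ1 hSH
  have : 0 ≤ θ * Real.log m := by positivity
  linarith

end Walk

/-- The choice of the weight `θ` in the potential: if `(α + κ) / 4 ≤ r`, then the harmonic mean of
`α` and `κ` is at most `2 r`. -/
theorem exists_weight {α κ r N : ℝ} (hr : 0 < r) (hrN : r ≤ N) (hαN : α ≤ N)
    (hsum : α + κ ≤ 4 * r) :
    ∃ θ, 0 ≤ θ ∧ θ ≤ 1 ∧ (1 - θ) * α ≤ r ∧ θ * κ ≤ r ∧ r / N ≤ 1 - θ := by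
  have hN : 0 < N := by linarith
  rcases le_total α r with h | h
  · refine ⟨0, le_rfl, zero_le_one, by linarith, by linarith, ?_⟩
    rw [sub_zero, div_le_one hN]; exact hrN
  · have hα : 0 < α := by linarith
    refine ⟨1 - r / α, ?_, ?_, ?_, ?_, ?_⟩
    · rw [sub_nonneg, div_le_one hα]; exact h
    · have : 0 ≤ r / α := by positivity
      linarith
    · rw [sub_sub_cancel, div_mul_cancel₀ _ hα.ne']
    · have h2 : 0 ≤ 1 - r / α := by rw [sub_nonneg, div_le_one hα]; exact h
      have h3 : (1 - r / α) * κ ≤ (1 - r / α) * (4 * r - α) := by gcongr; linarith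
      refine h3.trans ?_
      -- this is `(α - 2 r) ^ 2 ≥ 0`
      have h4 : (1 - r / α) * (4 * r - α) - r = - ((α - 2 * r) ^ 2 / α) := by
        field_simp; ring
      have : 0 ≤ (α - 2 * r) ^ 2 / α := by positivity
      linarith
    · rw [sub_sub_cancel]
      gcongr

/-- Numerical conditions on the size `m` of the clusters and the approximation ratio `R` under
which the guessing procedure succeeds on graphs with `n` vertices: either clusters of size `m` can
hold every set of vertices, or the potential argument goes through with `J` steps.  Here `η` is the
increase of the potential in each step, and `r` is what is left of `log R` for the weight `θ`, after
the logarithmic losses of a step. -/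
def Suitable (n m J : ℕ) (R : ℝ) : Prop :=
  1 ≤ m ∧ 16 * logBound n ^ 2 ≤ R ∧ (n ≤ m ∨ ∃ η r : ℝ, 0 < η ∧ 0 < r ∧ r ≤ Real.log n ∧
    Real.log n < J * η ∧
    r + η + Real.log (16 * logBound n ^ 2) ≤ Real.log R - Real.log 4 ∧
    Real.log (8 * logBound n) + Real.log n - Real.log m ≤ 4 * r ∧
    (η + Real.log (16 * logBound n ^ 2)) * Real.log n ≤ r * (Real.log R - Real.log 4))

/-- If `H` has average degree `d`, then some short program computes a set of at most `2 |H|`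
vertices and average degree at least `d / R`. -/
theorem exists_dense {n : ℕ} (G : SimpleGraph (Fin n)) (W H : Finset (Fin n)) {m J M : ℕ}
    {R d : ℝ} (hsuit : Suitable n m J R) (hM : J * (m + 1) + m + 6 ≤ M) (hHW : H ⊆ Wᶜ)
    (hH : H.Nonempty) (hd0 : 0 < d) (hd : d * H.card ≤ degSum G H) :
    ∃ l A, Derivable G W l ∧ l.length ≤ M ∧ A ∈ l ∧ A ⊆ Wᶜ ∧ A.Nonempty ∧ A.card ≤ 2 * H.card ∧
      d / R * A.card ≤ degSum G A := by
  by_contra! hcon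
  obtain ⟨hm, hR, halt⟩ := hsuit
  have hL := one_le_logBound n
  have hR16 : 16 ≤ R := by nlinarith
  obtain ⟨ρ, hρdef⟩ : ∃ ρ, ρ = d / R := ⟨_, rfl⟩
  rw [← hρdef] at hcon
  have hs : Sparse G W M ρ H.card := fun l hl hlM A hA hAW hAne hAc =>
    hcon l A hl hlM hA hAW hAne hAc
  have hHc : (0 : ℝ) < H.card := by exact_mod_cast Finset.card_pos.2 hH
  -- an edge has average degree `1`
  have hρ : 1 ≤ ρ := by
    by_contra! hρ1
    obtain ⟨v, hvH, hv⟩ : ∃ v ∈ H, 0 < nbrCount G H v := by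
      by_contra! h0
      have : degSum G H = 0 := Finset.sum_eq_zero fun v hv => Nat.le_zero.1 (h0 v hv)
      rw [this] at hd
      have : 0 < d * H.card := by positivity
      simp only [Nat.cast_zero] at hd
      linarith
    classical
    obtain ⟨u, hu⟩ := Finset.card_pos.1 hv
    obtain ⟨huH, hadj⟩ := Finset.mem_filter.1 hu
    obtain ⟨l', hl', -, hA, hlen⟩ := (Derivable.start (G := G) (W := W)).cluster {v, u}
    have hc2 : ({v, u} : Finset (Fin n)).card = 2 := Finset.card_pair hadj.ne
    have h1 := hs l' hl' (by simp only [List.length_cons, List.length_nil] at hlen; omega) _ hA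
      (by
        intro x hx
        rcases Finset.mem_insert.1 hx with rfl | hx
        · exact hHW hvH
        · rw [Finset.mem_singleton.1 hx]; exact hHW huH)
      ⟨v, by simp⟩ (by have := Finset.card_pos.2 hH; omega)
    have h2 : 2 ≤ degSum G {v, u} := by
      have hvu : nbrCount G {v, u} v = 1 := by
        rw [nbrCount, Finset.card_eq_one]
        refine ⟨u, ?_⟩
        ext x
        simp only [Finset.mem_filter, Finset.mem_insert, Finset.mem_singleton]
        constructor
        · rintro ⟨rfl | h, h'⟩
          · exact absurd h' (G.loopless.irrefl _)
          · exact h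
        · rintro rfl
          exact ⟨Or.inr rfl, hadj⟩
      have := degSum_erase G (X := {v, u}) (v := v) (by simp)
      omega
    rw [hc2] at h1
    have h2' : (2 : ℝ) ≤ degSum G {v, u} := by exact_mod_cast h2
    push_cast at h1
    linarith
  have hρ0 : 0 < ρ := by linarith
  have hdR : d = ρ * R := by rw [hρdef]; field_simp
  obtain ⟨D, P, H', hD1, hDn, hDk, hPd, hPW, hPD, hH'H, hH'P, hH'ne, hδ⟩ :=
    hs.exists_bounded_degree (by omega) hρ hHW hH hd (by rw [hdR]; nlinarith)
  have hδ0 : 0 < d / 4 := by positivity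
  have hH'k : H'.card ≤ H.card := Finset.card_le_card hH'H
  have hH'c : (0 : ℝ) < H'.card := by exact_mod_cast Finset.card_pos.2 hH'ne
  have hmH : m < H'.card := by
    by_contra! hle
    obtain ⟨l', hl', -, hA, hlen⟩ := (Derivable.start (G := G) (W := W)).cluster H'
    have h1 := hs l' hl' (by simp only [List.length_cons, List.length_nil] at hlen; omega) _ hA
      (hH'P.trans hPW) hH'ne (by omega)
    have h2 := mul_le_sum_nbrCount hδ (Finset.Subset.refl H')
    have h3 : ρ * H'.card ≤ H'.card * (d / 4) := by
      rw [mul_comm]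
      have : ρ ≤ d / 4 := by rw [hdR]; nlinarith
      exact mul_le_mul_of_nonneg_left this hH'c.le
    have h4 : (degSum G H' : ℝ) = ((∑ v ∈ H', nbrCount G H' v : ℕ) : ℝ) := rfl
    linarith
  have hH'n : H'.card ≤ n := (Finset.card_le_univ H').trans (by simp)
  obtain hle | ⟨η, r, hη, hr, hrN, hJ, hrR, hsum, hprod⟩ := halt
  · omega
  have hn0 : (0 : ℝ) < n := by exact_mod_cast (by omega : 0 < n)
  have hm0 : (0 : ℝ) < m := by exact_mod_cast hm
  have hD0 : (0 : ℝ) < D := by exact_mod_cast hD1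
  have hlogR : Real.log (d / 4) - Real.log ρ = Real.log R - Real.log 4 := by
    rw [Real.log_div hd0.ne' (by norm_num), hdR, Real.log_mul hρ0.ne' (by positivity)]
    ring
  have hlogD : Real.log D - Real.log ρ ≤ Real.log n := by
    have := Real.log_le_log hD0 (by exact_mod_cast hDn : (D : ℝ) ≤ n)
    have := Real.log_nonneg hρ
    linarith
  have hDH : Real.log D - Real.log ρ + (Real.log H'.card - Real.log m) ≤ 4 * r := by
    have h1 : (D : ℝ) * H'.card ≤ 8 * logBound n * ρ * n := by
      refine le_trans (mul_le_mul_of_nonneg_left ?_ hD0.le) hDk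
      exact_mod_cast hH'k
    have h2 := Real.log_le_log (mul_pos hD0 hH'c) h1
    rw [Real.log_mul hD0.ne' hH'c.ne', Real.log_mul (by positivity) hn0.ne',
      Real.log_mul (by positivity) hρ0.ne'] at h2
    linarith
  obtain ⟨θ, hθ0, hθ1, h1, h2, h3⟩ := exists_weight hr hrN hlogD hDH
  have hN0 : 0 < Real.log n := by linarith
  refine hs.false_of_walk hρ hM hPd hPW hPD hD1 hH'P hH'k hδ0 hδ hm hmH.le hθ0 hθ1 hη ?_ ?_ ?_ hJ
  · rw [hlogR]; linarith
  · rw [hlogR]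
    have hpos : 0 ≤ Real.log R - Real.log 4 := by
      have := log_eight_le (n := n)
      have : 0 ≤ Real.log 8 := Real.log_nonneg (by norm_num)
      linarith
    calc η + Real.log (16 * logBound n ^ 2) ≤ r * (Real.log R - Real.log 4) / Real.log n := by
          rwa [le_div_iff₀ hN0]
      _ = r / Real.log n * (Real.log R - Real.log 4) := by ring
      _ ≤ _ := by gcongr
  · rw [hlogR]; linarith

/-! ### The greedy union of dense sets -/

/-- A set contains a subset of any smaller size that inherits its share of the edges. -/
theorem exists_subset_degSum {n : ℕ} (G : SimpleGraph (Fin n)) {s : ℕ} (X : Finset (Fin n))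
    (hs : s ≤ X.card) :
    ∃ Y ⊆ X, Y.card = s ∧
      (degSum G X : ℝ) * (s * (s - 1)) ≤ degSum G Y * (X.card * (X.card - 1)) := by
  induction X using Finset.strongInduction with
  | H X ih =>
    rcases hs.eq_or_lt with h | h
    · exact ⟨X, Finset.Subset.refl X, h.symm, by rw [h]⟩
    obtain ⟨v, hv, hmin⟩ := Finset.exists_min_image X (nbrCount G X) (Finset.card_pos.1 (by omega))
    have hle : (X.card : ℝ) * nbrCount G X v ≤ degSum G X := by
      have : X.card * nbrCount G X v ≤ degSum G X := by
        rw [← smul_eq_mul]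
        exact Finset.card_nsmul_le_sum _ _ _ hmin
      exact_mod_cast this
    have he : (degSum G X : ℝ) = degSum G (X.erase v) + 2 * nbrCount G X v := by
      exact_mod_cast degSum_erase G hv
    have hcard : (X.erase v).card = X.card - 1 := Finset.card_erase_of_mem hv
    have hc : ((X.erase v).card : ℝ) = X.card - 1 := by
      rw [hcard, Nat.cast_sub (by omega), Nat.cast_one]
    obtain ⟨Y, hYX, hYs, hY⟩ := ih _ (Finset.erase_ssubset hv) (by omega)
    refine ⟨Y, hYX.trans (Finset.erase_subset _ _), hYs, ?_⟩
    rw [hc] at hY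
    rcases Nat.lt_or_ge 2 X.card with h2 | h2
    · have hx : (2 : ℝ) < X.card := by exact_mod_cast h2
      have hss : (0 : ℝ) ≤ s * (s - 1) := by
        rcases Nat.eq_zero_or_pos s with h0 | h0
        · simp [h0]
        · have : (1 : ℝ) ≤ s := by exact_mod_cast h0
          have : (0 : ℝ) ≤ s - 1 := by linarith
          positivity
      have h3 : (degSum G X : ℝ) * (X.card - 2) ≤ degSum G (X.erase v) * X.card := by nlinarith
      refine le_of_mul_le_mul_left ?_ (by linarith : (0 : ℝ) < X.card - 2)
      calc ((X.card : ℝ) - 2) * (degSum G X * (s * (s - 1)))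
          = degSum G X * (X.card - 2) * (s * (s - 1)) := by ring
        _ ≤ degSum G (X.erase v) * X.card * (s * (s - 1)) := by gcongr
        _ = X.card * (degSum G (X.erase v) * (s * (s - 1))) := by ring
        _ ≤ X.card * (degSum G Y * ((X.card - 1) * (X.card - 1 - 1))) := by gcongr
        _ = _ := by ring
    · have hs1 : (s : ℝ) * (s - 1) = 0 := by
        have : s = 0 ∨ s = 1 := by omega
        rcases this with rfl | rfl <;> simp
      rw [hs1, mul_zero]
      have : (1 : ℝ) ≤ X.card := by exact_mod_cast (by omega : 1 ≤ X.card)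
      have : (0 : ℝ) ≤ X.card - 1 := by linarith
      positivity

theorem gain_empty {n : ℕ} (G : SimpleGraph (Fin n)) (A : Finset (Fin n)) :
    gain G ∅ A = degSum G A := by
  simp [gain, nbrCount]

/-- A set `A` that can be added to `W` in a greedy step: it fits into the remaining space, and no
set computed by a program of length `M` has a better gain per vertex. -/
structure IsBestStep {n : ℕ} (G : SimpleGraph (Fin n)) (k M : ℕ) (W A : Finset (Fin n)) :
    Prop where
  subset_compl : A ⊆ Wᶜ
  nonempty : A.Nonempty
  card_le : A.card ≤ k - W.card
  best : ∀ l A', Derivable G W l → l.length ≤ M → A' ∈ l → A' ⊆ Wᶜ → A'.Nonempty →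
    A'.card ≤ k - W.card → gain G W A' * A.card ≤ gain G W A * A'.card

/-- The sets that greedy steps lead to, starting from the empty set. -/
inductive Greedy {n : ℕ} (G : SimpleGraph (Fin n)) (k M : ℕ) : Finset (Fin n) → Prop
  | empty : Greedy G k M ∅
  | step {W A : Finset (Fin n)} : Greedy G k M W → IsBestStep G k M W A → Greedy G k M (W ∪ A)

section Greedy

variable {n : ℕ} {G : SimpleGraph (Fin n)} {k M : ℕ} {W H : Finset (Fin n)}

theorem IsBestStep.disjoint {A : Finset (Fin n)} (h : IsBestStep G k M W A) : Disjoint W A :=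
  Finset.disjoint_left.2 fun _ hv hA => Finset.mem_compl.1 (h.subset_compl hA) hv

/-- The first set that is added is at least as dense as any other small set. -/
theorem Greedy.degSum_mul_le (hW : Greedy G k M W) (hH : H.Nonempty) (hHk : H.card ≤ k)
    (hM : H.card + 3 ≤ M) (hne : W.Nonempty) : degSum G H ≤ degSum G W * H.card := by
  induction hW with
  | empty => simp at hne
  | @step W A hW hA ih =>
    rw [degSum_union_of_disjoint G hA.disjoint]
    rcases W.eq_empty_or_nonempty with rfl | hWne
    · obtain ⟨l, hl, -, hHl, hlen⟩ := (Derivable.start (G := G) (W := ∅)).cluster H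
      have h1 := hA.best l H hl (by simp only [List.length_cons, List.length_nil] at hlen; omega)
        hHl (by simp) hH (by simpa using hHk)
      have h2 := Finset.card_pos.2 hA.nonempty
      rw [gain_empty] at h1
      calc degSum G H ≤ degSum G H * A.card := Nat.le_mul_of_pos_right _ h2
        _ ≤ _ := h1
        _ ≤ _ := Nat.mul_le_mul_right _ (Nat.le_add_left _ _)
    · exact (ih hWne).trans (Nat.mul_le_mul_right _ (Nat.le_add_right _ _))

/-- While `W` fills at most half of the space and holds less than a quarter of the edges of `H`,
some computed set has a good gain: a single vertex, if many edges of `H` meet `W`, and a dense set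
disjoint from `W` otherwise. -/
theorem exists_good_gain {m J : ℕ} {R : ℝ} (hsuit : Suitable n m J R)
    (hM : J * (m + 1) + m + 6 ≤ M) (hk8 : 8 ≤ k) (hHk : H.card = k) (hWk : 2 * W.card ≤ k)
    (hWH : 4 * degSum G W < degSum G H) :
    ∃ l A, Derivable G W l ∧ l.length ≤ M ∧ A ∈ l ∧ A ⊆ Wᶜ ∧ A.Nonempty ∧ A.card ≤ k - W.card ∧
      (degSum G H : ℝ) / (64 * k * R) * A.card ≤ gain G W A := by
  have hL := one_le_logBound n
  have hR16 : 16 ≤ R := by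
    have := hsuit.2.1
    nlinarith
  have hk0 : (0 : ℝ) < k := by exact_mod_cast (by omega : 0 < k)
  set E : ℝ := ((degSum G H : ℕ) : ℝ) with hE
  have hE0 : 0 < E := by
    rw [hE]; exact_mod_cast (by omega : 0 < degSum G H)
  set Y := H \ W with hY
  have hYW : Y ⊆ Wᶜ := fun v hv => Finset.mem_compl.2 (Finset.mem_sdiff.1 hv).2
  have hYk : Y.card ≤ k := hHk ▸ Finset.card_le_card Finset.sdiff_subset
  have hsplit : degSum G H ≤ degSum G Y + 2 * ∑ v ∈ Y, nbrCount G W v + degSum G W := by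
    have hd : Disjoint (H ∩ W) Y := (Finset.disjoint_sdiff_inter H W).symm
    have hU : H ∩ W ∪ Y = H := by
      rw [Finset.union_comm]; exact Finset.sdiff_union_inter H W
    have h1 := degSum_union_of_disjoint G hd
    rw [hU, gain] at h1
    have h2 : ∑ v ∈ Y, nbrCount G (H ∩ W) v ≤ ∑ v ∈ Y, nbrCount G W v :=
      Finset.sum_le_sum fun v _ => nbrCount_mono G Finset.inter_subset_right v
    have h3 : degSum G (H ∩ W) ≤ degSum G W := degSum_mono G Finset.inter_subset_right
    omega
  rcases le_or_gt (degSum G H) (4 * degSum G Y) with hcase | hcase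
  · have hYne : Y.Nonempty := by
      rw [Finset.nonempty_iff_ne_empty]
      intro h
      rw [h] at hcase
      simp only [degSum, Finset.sum_empty] at hcase
      have : 0 < degSum G H := by omega
      rw [degSum] at this
      omega
    have hEY : E ≤ 4 * degSum G Y := by rw [hE]; exact_mod_cast hcase
    obtain ⟨H0, hH0Y, hH0ne, hH0c, hH0d⟩ : ∃ H0 ⊆ Y, H0.Nonempty ∧ H0.card ≤ k / 4 ∧
        E / (64 * k) * H0.card ≤ degSum G H0 := by
      rcases le_or_gt Y.card (k / 4) with hc | hc
      · refine ⟨Y, Finset.Subset.refl Y, hYne, hc, ?_⟩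
        have h1 : (Y.card : ℝ) ≤ k := by exact_mod_cast hYk
        calc E / (64 * k) * Y.card ≤ E / (64 * k) * k := by gcongr
          _ = E / 64 := by field_simp
          _ ≤ _ := by linarith
      · obtain ⟨H0, hsub, hcard, hdeg⟩ := exists_subset_degSum G Y hc.le
        have hs0 : 2 ≤ k / 4 := by omega
        refine ⟨H0, hsub, Finset.card_pos.1 (by omega), hcard.le, ?_⟩
        rw [hcard]
        set s := k / 4 with hs
        have hs1 : (k : ℝ) - 1 ≤ 16 * (s - 1) := by
          have : k + 15 ≤ 16 * s := by omega
          have : (k : ℝ) + 15 ≤ 16 * s := by exact_mod_cast this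
          linarith
        have hsR : (2 : ℝ) ≤ s := by exact_mod_cast hs0
        have hkR : (8 : ℝ) ≤ k := by exact_mod_cast hk8
        have hYk' : (Y.card : ℝ) ≤ k := by exact_mod_cast hYk
        have hY1 : (1 : ℝ) ≤ Y.card := by exact_mod_cast Finset.card_pos.2 hYne
        have h1 : E / 4 * (s * (s - 1)) ≤ degSum G H0 * (k * (16 * (s - 1))) := by
          calc E / 4 * (s * (s - 1)) ≤ degSum G Y * (s * (s - 1)) := by
                have : (0 : ℝ) ≤ s * (s - 1) := mul_nonneg (by linarith) (by linarith)
                gcongr; linarith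
            _ ≤ degSum G H0 * (Y.card * (Y.card - 1)) := hdeg
            _ ≤ degSum G H0 * (k * (16 * (s - 1))) := by
                have : (0 : ℝ) ≤ Y.card - 1 := by linarith
                gcongr
                linarith
        have h2 : (0 : ℝ) < s - 1 := by linarith
        have h3 : E / (64 * k) * s = E / 4 * (s * (s - 1)) / (k * (16 * (s - 1))) := by
          field_simp; ring
        rw [h3, div_le_iff₀ (by positivity)]
        exact h1
    obtain ⟨l, A, hl, hlM, hAl, hAW, hAne, hAc, hAd⟩ := exists_dense G W H0 hsuit hM
      (hH0Y.trans hYW) hH0ne (by positivity) hH0d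
    refine ⟨l, A, hl, hlM, hAl, hAW, hAne, by omega, ?_⟩
    rw [div_div] at hAd
    refine hAd.trans ?_
    exact_mod_cast Nat.le_add_left _ _
  · have hbig : degSum G H < 4 * ∑ v ∈ Y, nbrCount G W v := by omega
    obtain ⟨v, hvY, hv⟩ : ∃ v ∈ Y, degSum G H < 4 * k * nbrCount G W v := by
      by_contra! hcon
      have h1 : ∑ v ∈ Y, 4 * k * nbrCount G W v ≤ Y.card • degSum G H :=
        Finset.sum_le_card_nsmul _ _ _ hcon
      rw [← Finset.mul_sum, smul_eq_mul] at h1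
      have h2 : Y.card * degSum G H ≤ k * degSum G H := Nat.mul_le_mul_right _ hYk
      have h3 : k * degSum G H < k * (4 * ∑ v ∈ Y, nbrCount G W v) :=
        Nat.mul_lt_mul_of_pos_left hbig (by omega)
      nlinarith
    obtain ⟨l, hl, -, hvl, hlen⟩ := (Derivable.start (G := G) (W := W)).cluster {v}
    simp only [List.length_cons, List.length_nil, Finset.card_singleton] at hlen
    refine ⟨l, {v}, hl, by omega, hvl, by simpa using hYW hvY, by simp, ?_, ?_⟩
    · rw [Finset.card_singleton]; omega
    · rw [Finset.card_singleton, gain, Finset.sum_singleton]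
      have hvR : E < 4 * k * nbrCount G W v := by rw [hE]; exact_mod_cast hv
      push_cast
      have h1 : E / (64 * k * R) ≤ E / (64 * k * 1) := by gcongr; linarith
      have h2 : E / (64 * k * 1) ≤ nbrCount G W v := by
        rw [div_le_iff₀ (by positivity)]
        nlinarith
      have h3 : (0 : ℝ) ≤ degSum G {v} := by positivity
      have h4 : (0 : ℝ) ≤ nbrCount G W v := by positivity
      linarith

/-- The greedy sets are dense. -/
theorem Greedy.le_degSum {m J : ℕ} {R : ℝ} (hW : Greedy G k M W) (hsuit : Suitable n m J R)
    (hM : J * (m + 1) + m + 6 ≤ M) (hk8 : 8 ≤ k) (hHk : H.card = k) :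
    (degSum G H : ℝ) / (64 * k * R) * min (W.card : ℝ) (k / 2) ≤ degSum G W := by
  have hL := one_le_logBound n
  have hR16 : 16 ≤ R := by
    have := hsuit.2.1
    nlinarith
  have hk0 : (0 : ℝ) < k := by exact_mod_cast (by omega : 0 < k)
  set q : ℝ := (degSum G H : ℝ) / (64 * k * R) with hq
  have hq0 : 0 ≤ q := by positivity
  induction hW with
  | empty =>
    have : min (0 : ℝ) (k / 2) = 0 := min_eq_left (by positivity)
    simp [degSum, this]
  | @step W A hW hA ih =>
    rw [degSum_union_of_disjoint G hA.disjoint, Finset.card_union_of_disjoint hA.disjoint]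
    push_cast
    have hg0 : (0 : ℝ) ≤ gain G W A := by positivity
    rcases le_or_gt (k : ℝ) (2 * W.card) with hbig | hsmall
    · rw [min_eq_right (by linarith)] at ih
      have : q * min ((W.card : ℝ) + A.card) (k / 2) ≤ q * (k / 2) := by
        gcongr
        exact min_le_right _ _
      linarith
    rcases le_or_gt (degSum G H) (4 * degSum G W) with hmany | hfew
    · have h1 : (degSum G H : ℝ) ≤ 4 * degSum G W := by exact_mod_cast hmany
      have h2 : q * min ((W.card : ℝ) + A.card) (k / 2) ≤ q * (k / 2) := by
        gcongr
        exact min_le_right _ _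
      have h3 : q * (k / 2) = degSum G H / (128 * R) := by
        rw [hq]; field_simp; ring
      have h4 : (degSum G H : ℝ) / (128 * R) ≤ degSum G H / 4 := by
        gcongr; linarith
      linarith
    · have hWk : 2 * W.card ≤ k := by
        have : (2 * W.card : ℝ) ≤ k := hsmall.le
        exact_mod_cast this
      obtain ⟨l, A', hl, hlM, hAl, hAW, hAne, hAc, hAg⟩ :=
        exists_good_gain hsuit hM hk8 hHk hWk hfew
      have hb : (gain G W A' : ℝ) * A.card ≤ gain G W A * A'.card := by
        exact_mod_cast hA.best l A' hl hlM hAl hAW hAne hAc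
      have hA'0 : (0 : ℝ) < A'.card := by exact_mod_cast Finset.card_pos.2 hAne
      have hgain : q * A.card ≤ gain G W A := by
        refine le_of_mul_le_mul_right ?_ hA'0
        calc q * A.card * A'.card = q * A'.card * A.card := by ring
          _ ≤ gain G W A' * A.card := by gcongr
          _ ≤ _ := hb
      rw [min_eq_left (by linarith)] at ih
      calc q * min ((W.card : ℝ) + A.card) (k / 2) ≤ q * (W.card + A.card) := by
            gcongr
            exact min_le_left _ _
        _ = q * W.card + q * A.card := by ring
        _ ≤ _ := by gcongr

/-- A greedy set of `k` vertices is a good approximation. -/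
theorem Greedy.isApproxDensest {m J : ℕ} {R : ℝ} (hW : Greedy G k M W) (hWk : W.card = k)
    (hk : 1 ≤ k) (hsuit : Suitable n m J R) (hM : J * (m + 1) + m + 10 ≤ M) :
    IsApproxDensest G k (128 * R) W := by
  refine ⟨hWk, fun H hHk => ?_⟩
  have hL := one_le_logBound n
  have hR16 : 16 ≤ R := by
    have := hsuit.2.1
    nlinarith
  have hk0 : (0 : ℝ) < k := by exact_mod_cast hk
  rw [avgDegree_eq, avgDegree_eq, hWk, hHk, ← mul_div_assoc]
  refine div_le_div_of_nonneg_right ?_ hk0.le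
  rcases Nat.lt_or_ge k 8 with h8 | h8
  · have h1 := hW.degSum_mul_le (H := H) (Finset.card_pos.1 (by omega)) hHk.le (by omega)
      (Finset.card_pos.1 (by omega))
    have h2 : (degSum G H : ℝ) ≤ degSum G W * H.card := by exact_mod_cast h1
    have h3 : (H.card : ℝ) ≤ 128 * R := by
      have : (H.card : ℝ) ≤ 8 := by exact_mod_cast (by omega : H.card ≤ 8)
      linarith
    calc (degSum G H : ℝ) ≤ degSum G W * H.card := h2
      _ ≤ degSum G W * (128 * R) := by gcongr
      _ = _ := mul_comm _ _
  · have h1 := hW.le_degSum hsuit (by omega) h8 hHk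
    rw [hWk, min_eq_right (by linarith)] at h1
    have h2 : (degSum G H : ℝ) / (64 * k * R) * (k / 2) = degSum G H / (128 * R) := by
      field_simp; ring
    rw [h2, div_le_iff₀ (by positivity)] at h1
    linarith

/-- A greedy set of `k` vertices contains an edge if there is one at all. -/
theorem Greedy.isApproxDensest_sq (hW : Greedy G k M W) (hWk : W.card = k)
    (hk : 1 ≤ k) (hkn : k ≤ n) (hM : 5 ≤ M) :
    IsApproxDensest G k ((n : ℝ) ^ 2) W := by
  classical
  refine ⟨hWk, fun H hHk => ?_⟩
  have hk0 : (0 : ℝ) < k := by exact_mod_cast hk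
  have hknR : (k : ℝ) ≤ n := by exact_mod_cast hkn
  rw [avgDegree_eq, avgDegree_eq, hWk, hHk, ← mul_div_assoc]
  refine div_le_div_of_nonneg_right ?_ hk0.le
  by_cases h0 : degSum G H = 0
  · rw [h0, Nat.cast_zero]; positivity
  obtain ⟨v, hvH, hv⟩ := Finset.exists_ne_zero_of_sum_ne_zero h0
  obtain ⟨u, hu⟩ := Finset.card_pos.1 (Nat.pos_of_ne_zero hv)
  obtain ⟨huH, hadj⟩ := Finset.mem_filter.1 hu
  have hc2 : ({v, u} : Finset (Fin n)).card = 2 := Finset.card_pair hadj.ne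
  have hsub : ({v, u} : Finset (Fin n)) ⊆ H := by
    intro x hx
    rcases Finset.mem_insert.1 hx with rfl | hx
    · exact hvH
    · rw [Finset.mem_singleton.1 hx]; exact huH
  have hck := Finset.card_le_card hsub
  have h1 := hW.degSum_mul_le (H := {v, u}) ⟨v, by simp⟩ (by omega) (by omega)
    (Finset.card_pos.1 (by omega))
  have h2 : 0 < degSum G {v, u} := by
    have hmem : u ∈ ({v, u} : Finset (Fin n)).filter fun w => G.Adj v w := by simp [hadj]
    have h3 : 0 < nbrCount G {v, u} v := Finset.card_pos.2 ⟨u, hmem⟩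
    have h4 := degSum_erase G (X := {v, u}) (v := v) (by simp)
    omega
  have h3 : 1 ≤ degSum G W := by
    rcases Nat.eq_zero_or_pos (degSum G W) with h | h
    · rw [h] at h1; omega
    · exact h
  have h4 : degSum G H ≤ n * n := by
    calc degSum G H ≤ H.card • n := Finset.sum_le_card_nsmul _ _ _ fun x _ => nbrCount_le G H x
      _ ≤ n * n := by rw [smul_eq_mul]; exact Nat.mul_le_mul_right _ (by omega)
  have h5 : (degSum G H : ℝ) ≤ n * n := by exact_mod_cast h4
  have h6 : (1 : ℝ) ≤ degSum G W := by exact_mod_cast h3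
  nlinarith [sq_nonneg (n : ℝ)]

end Greedy

/-! ### The size of the clusters -/

/-- The size of the clusters: the iterated integer square root, about `n ^ (1 / 2 ^ s)`. -/
def clusterSize (s n : ℕ) : ℕ := Nat.sqrt^[s] n

theorem clusterSize_succ (s n : ℕ) : clusterSize (s + 1) n = Nat.sqrt (clusterSize s n) :=
  Function.iterate_succ_apply' Nat.sqrt s n

theorem clusterSize_pow_le (s n : ℕ) : clusterSize s n ^ 2 ^ s ≤ n := by
  induction s generalizing n with
  | zero => simp [clusterSize]
  | succ s ih =>
    have h1 : clusterSize (s + 1) n = clusterSize s (Nat.sqrt n) :=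
      Function.iterate_succ_apply Nat.sqrt s n
    rw [h1, pow_succ 2 s, pow_mul]
    calc (clusterSize s (Nat.sqrt n) ^ 2 ^ s) ^ 2 ≤ (Nat.sqrt n) ^ 2 := by gcongr; exact ih _
      _ ≤ n := Nat.sqrt_le' n

theorem lt_clusterSize_succ_pow (s n : ℕ) : n < (clusterSize s n + 1) ^ 2 ^ s := by
  induction s generalizing n with
  | zero => simp [clusterSize]
  | succ s ih =>
    have h1 : clusterSize (s + 1) n = clusterSize s (Nat.sqrt n) :=
      Function.iterate_succ_apply Nat.sqrt s n
    rw [h1, pow_succ 2 s, pow_mul]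
    calc n < (Nat.sqrt n + 1) ^ 2 := Nat.lt_succ_sqrt' n
      _ ≤ _ := by gcongr; exact ih _

theorem one_le_clusterSize (s : ℕ) {n : ℕ} (hn : 1 ≤ n) : 1 ≤ clusterSize s n := by
  by_contra! h
  have h1 := lt_clusterSize_succ_pow s n
  have h2 : clusterSize s n = 0 := by omega
  rw [h2] at h1
  simp at h1
  omega

theorem clusterSize_le_rpow (s n : ℕ) :
    (clusterSize s n : ℝ) ≤ (n : ℝ) ^ ((1 : ℝ) / 2 ^ s) := by
  have h1 : ((clusterSize s n : ℝ)) ^ (2 ^ s : ℕ) ≤ n := by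
    exact_mod_cast clusterSize_pow_le s n
  rw [one_div]
  have h2 := Real.le_rpow_inv_iff_of_pos (x := (clusterSize s n : ℝ)) (y := n) (z := 2 ^ s)
    (by positivity) (by positivity) (by positivity)
  rw [h2]
  have h3 : ((2 : ℝ) ^ s) = ((2 ^ s : ℕ) : ℝ) := by push_cast; rfl
  rw [h3, Real.rpow_natCast]
  exact h1

theorem log_clusterSize_ge (s : ℕ) {n : ℕ} (hn : 1 ≤ n) :
    1 / 2 ^ s * Real.log n - Real.log 2 ≤ Real.log (clusterSize s n) := by
  have hm := one_le_clusterSize s hn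
  have hm0 : (1 : ℝ) ≤ clusterSize s n := by exact_mod_cast hm
  have h1 : (n : ℝ) ≤ (2 * (clusterSize s n : ℝ)) ^ (2 ^ s : ℕ) := by
    have h2 : (n : ℝ) ≤ ((clusterSize s n : ℝ) + 1) ^ (2 ^ s : ℕ) := by
      exact_mod_cast (lt_clusterSize_succ_pow s n).le
    refine h2.trans ?_
    gcongr
    linarith
  have h3 := Real.log_le_log (by exact_mod_cast hn) h1
  rw [Real.log_pow, Real.log_mul (by norm_num) (by positivity)] at h3
  push_cast at h3
  have h4 : (0 : ℝ) < 2 ^ s := by positivity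
  rw [div_mul_eq_mul_div, one_mul, sub_le_iff_le_add, div_le_iff₀ h4]
  linarith

/-- A power `2 ^ (-s)` is a suitable exponent for the size of the clusters. -/
theorem exists_exponent {ε : ℝ} (hε : 0 < ε) :
    ∃ s : ℕ, (1 : ℝ) / 2 ^ s ≤ 4 * ε ∧ (s = 0 ∨ (ε < 1 / 4 ∧ 2 * ε < 1 / 2 ^ s)) := by
  have hex : ∃ s : ℕ, (1 : ℝ) / 2 ^ s ≤ 4 * ε := by
    obtain ⟨s, hs⟩ := exists_pow_lt_of_lt_one (by linarith : 0 < 4 * ε)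
      (by norm_num : (1 / 2 : ℝ) < 1)
    refine ⟨s, ?_⟩
    rw [one_div_pow] at hs
    exact hs.le
  classical
  refine ⟨Nat.find hex, Nat.find_spec hex, ?_⟩
  rcases h : Nat.find hex with _ | s
  · exact Or.inl rfl
  · right
    have h1 := Nat.find_min hex (m := s) (by omega)
    have h0 := Nat.find_min hex (m := 0) (by omega)
    rw [not_le] at h1 h0
    refine ⟨by norm_num at h0; linarith, ?_⟩
    have h2 : (1 : ℝ) / 2 ^ (s + 1) = (1 / 2 ^ s) / 2 := by
      rw [pow_succ]; field_simp
    rw [h2]; linarith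

/-! ### The approximation ratio -/

/-- The approximation ratio for large `n`, up to a constant. -/
noncomputable def ratio (ε : ℝ) (n : ℕ) : ℝ :=
  64 * logBound n ^ 2 * max 1 ((n : ℝ) ^ ((1 - ε) / 4))

theorem eventually_log_le (C : ℝ) {a : ℝ} (ha : 0 < a) :
    ∀ᶠ n : ℕ in atTop, C + 2 * Real.log (logBound n) ≤ a * Real.log n := by
  have h1 : ∀ᶠ x : ℝ in atTop, C + 2 * Real.log (1 + x) ≤ a * x := by
    have hlog := (Real.isLittleO_log_id_atTop.bound (by positivity : 0 < a / 4))
    have ht : Tendsto (fun x : ℝ => 1 + x) atTop atTop :=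
      tendsto_atTop_add_const_left _ _ tendsto_id
    have hlog' := ht.eventually hlog
    filter_upwards [hlog', eventually_ge_atTop (0 : ℝ),
      eventually_ge_atTop ((C + a) / (a / 2))] with x hx hx0 hxC
    rw [div_le_iff₀ (by positivity)] at hxC
    have h2 : Real.log (1 + x) ≤ a / 4 * (1 + x) := by
      have := (le_abs_self _).trans hx
      rwa [id, Real.norm_of_nonneg (by linarith)] at this
    linarith
  have ht : Tendsto (fun n : ℕ => Real.log (n : ℝ)) atTop atTop :=
    Real.tendsto_log_atTop.comp tendsto_natCast_atTop_atTop
  exact ht.eventually h1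

/-- For large `n` the guessing procedure works with clusters of size about `n ^ (2 ^ (-s))`. -/
theorem eventually_suitable {ε : ℝ} (hε : 0 < ε) {s : ℕ}
    (hs : s = 0 ∨ (ε < 1 / 4 ∧ 2 * ε < 1 / 2 ^ s)) :
    ∃ J : ℕ, ∀ᶠ n : ℕ in atTop, Suitable n (clusterSize s n) J (ratio ε n) := by
  obtain ⟨J, hJ⟩ := exists_nat_gt (32 / ε)
  refine ⟨J, ?_⟩
  have hR : ∀ n, 16 * logBound n ^ 2 ≤ ratio ε n := by
    intro n
    have := one_le_logBound n
    have h1 : (1 : ℝ) ≤ max 1 ((n : ℝ) ^ ((1 - ε) / 4)) := le_max_left _ _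
    unfold ratio
    nlinarith [sq_nonneg (logBound n)]
  rcases hs with rfl | ⟨hε4, hεs⟩
  · filter_upwards [eventually_ge_atTop 1] with n hn
    exact ⟨one_le_clusterSize 0 hn, hR n, Or.inl le_rfl⟩
  have hlogt : Tendsto (fun n : ℕ => Real.log (n : ℝ)) atTop atTop :=
    Real.tendsto_log_atTop.comp tendsto_natCast_atTop_atTop
  filter_upwards [eventually_ge_atTop 1, hlogt.eventually_gt_atTop 0,
    eventually_log_le (Real.log 16) (by norm_num : (0 : ℝ) < 1 / 100),
    eventually_log_le (Real.log 16) (by linarith : 0 < ε * (7 / 8))] with n hn hN hlam hsmall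
  have hL := one_le_logBound n
  have hlogL := Real.log_nonneg hL
  have hlamEq : Real.log (16 * logBound n ^ 2) = Real.log 16 + 2 * Real.log (logBound n) := by
    rw [Real.log_mul (by norm_num) (by positivity), Real.log_pow]; norm_num
  have hlam0 : 0 ≤ Real.log 16 := Real.log_nonneg (by norm_num)
  have hn0 : (0 : ℝ) < n := by exact_mod_cast hn
  have hlogR : Real.log (16 * logBound n ^ 2) + (1 - ε) / 4 * Real.log n
      ≤ Real.log (ratio ε n) - Real.log 4 := by
    have h1 : 4 * ((16 * logBound n ^ 2) * (n : ℝ) ^ ((1 - ε) / 4)) ≤ ratio ε n := by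
      have : (n : ℝ) ^ ((1 - ε) / 4) ≤ max 1 ((n : ℝ) ^ ((1 - ε) / 4)) := le_max_right _ _
      unfold ratio
      calc 4 * ((16 * logBound n ^ 2) * (n : ℝ) ^ ((1 - ε) / 4))
          = 64 * logBound n ^ 2 * (n : ℝ) ^ ((1 - ε) / 4) := by ring
        _ ≤ _ := by gcongr
    have hp : 0 < (n : ℝ) ^ ((1 - ε) / 4) := Real.rpow_pos_of_pos hn0 _
    have h2 := Real.log_le_log (by positivity) h1
    rw [Real.log_mul (by norm_num) (by positivity), Real.log_mul (by positivity) hp.ne',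
      Real.log_rpow hn0] at h2
    linarith
  refine ⟨one_le_clusterSize s hn, hR n, Or.inr
    ⟨ε * Real.log n / 32, (1 - ε) / 4 * Real.log n - ε * Real.log n / 32, ?_, ?_, ?_, ?_, ?_, ?_,
      ?_⟩⟩
  · positivity
  · nlinarith
  · nlinarith
  · rw [div_lt_iff₀ hε] at hJ
    nlinarith
  · linarith
  · have h1 := log_clusterSize_ge s hn
    have h2 : 2 * ε * Real.log n ≤ 1 / 2 ^ s * Real.log n := by gcongr
    have h3 : Real.log (8 * logBound n) + Real.log 2 = Real.log 16 + Real.log (logBound n) := by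
      rw [Real.log_mul (by norm_num) (by positivity)]
      have : Real.log 16 = Real.log 8 + Real.log 2 := by
        rw [← Real.log_mul (by norm_num) (by norm_num)]; norm_num
      linarith
    linarith
  · set N := Real.log n with hNdef
    have h1 : 1 / 8 * N ≤ (1 - ε) / 4 * N - ε * N / 32 := by nlinarith
    have h2 : 3 / 16 * N ≤ Real.log (ratio ε n) - Real.log 4 := by
      have : 0 ≤ Real.log (16 * logBound n ^ 2) := by rw [hlamEq]; positivity
      nlinarith
    have h3 : ε * N / 32 + Real.log (16 * logBound n ^ 2) ≤ 3 / 128 * N := by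
      rw [hlamEq]
      nlinarith
    calc (ε * N / 32 + Real.log (16 * logBound n ^ 2)) * N ≤ 3 / 128 * N * N := by gcongr
      _ = (1 / 8 * N) * (3 / 16 * N) := by ring
      _ ≤ _ := mul_le_mul h1 h2 (by positivity) (le_trans (by positivity) h1)

theorem isSoftO_ratio (ε : ℝ) {ρ : ℕ → ℝ} {C : ℝ} (h : ∀ᶠ n in atTop, ρ n = C * ratio ε n) :
    IsSoftO ρ (fun n : ℕ => max 1 ((n : ℝ) ^ ((1 - ε) / 4))) := by
  refine ⟨2, ?_⟩
  have hlogt : Tendsto (fun n : ℕ => Real.log (n : ℝ)) atTop atTop :=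
    Real.tendsto_log_atTop.comp tendsto_natCast_atTop_atTop
  refine IsBigO.of_bound (|C| * 256) ?_
  filter_upwards [h, hlogt.eventually_ge_atTop 1] with n hn hlog
  have h1 : (0 : ℝ) < max 1 ((n : ℝ) ^ ((1 - ε) / 4)) := lt_max_of_lt_left one_pos
  have h2 : logBound n ^ 2 ≤ (2 * Real.log n) ^ 2 := by
    have := one_le_logBound n
    gcongr
    unfold logBound; linarith
  rw [hn, ratio, norm_mul, norm_mul, norm_mul, norm_mul, norm_pow, norm_pow, Real.norm_eq_abs C,
    Real.norm_of_nonneg h1.le, Real.norm_of_nonneg (by linarith : (0 : ℝ) ≤ Real.log n),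
    Real.norm_of_nonneg (by linarith [one_le_logBound n] : (0 : ℝ) ≤ logBound n),
    Real.norm_of_nonneg (by norm_num : (0 : ℝ) ≤ 64)]
  calc |C| * (64 * logBound n ^ 2 * max 1 ((n : ℝ) ^ ((1 - ε) / 4)))
      ≤ |C| * (64 * (2 * Real.log n) ^ 2 * max 1 ((n : ℝ) ^ ((1 - ε) / 4))) := by gcongr
    _ = _ := by ring

/-! ### Reasoning about programs -/

namespace State

@[simp] theorem setReg_reg (s : State) (x v y : ℕ) :
    (s.setReg x v).reg y = if y = x then v else s.reg y := by
  simp [setReg, Function.update_apply]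

@[simp] theorem setReg_arr (s : State) (x v : ℕ) : (s.setReg x v).arr = s.arr := rfl

@[simp] theorem setArr_reg (s : State) (a i v : ℕ) : (s.setArr a i v).reg = s.reg := rfl

@[simp] theorem setArr_arr (s : State) (a i v b j : ℕ) :
    (s.setArr a i v).arr b j = if b = a ∧ j = i then v else s.arr b j := by
  by_cases h : b = a
  · subst h
    simp [setArr, Function.update_apply]
  · simp [setArr, h]

end State

namespace Prog

/-- Whether a program contains an instruction that writes into the register `r`. -/
def wr : Prog → ℕ → Bool
  | const x _, r => Nat.beq x r
  | copy x _, r => Nat.beq x r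
  | add x _ _, r => Nat.beq x r
  | sub x _ _, r => Nat.beq x r
  | load x _ _, r => Nat.beq x r
  | store _ _ _, _ => false
  | coin x, r => Nat.beq x r
  | seq p q, r => p.wr r || q.wr r
  | ite _ p q, r => p.wr r || q.wr r
  | loop _ p, r => p.wr r

/-- Whether a program contains an instruction that writes into the bank `a`. -/
def wrArr : Prog → ℕ → Bool
  | store b _ _, a => Nat.beq b a
  | seq p q, a => p.wrArr a || q.wrArr a
  | ite _ p q, a => p.wrArr a || q.wrArr a
  | loop _ p, a => p.wrArr a
  | _, _ => false

end Prog

/-- The registers and banks that `p` does not write into agree in `s` and `s'`. -/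
structure Frame (p : Prog) (s s' : State) : Prop where
  reg : ∀ r, p.wr r = false → s'.reg r = s.reg r
  arr : ∀ a, p.wrArr a = false → s'.arr a = s.arr a

theorem Frame.refl (p : Prog) (s : State) : Frame p s s := ⟨fun _ _ => rfl, fun _ _ => rfl⟩

theorem Frame.trans {p : Prog} {s s' s'' : State} (h : Frame p s s') (h' : Frame p s' s'') :
    Frame p s s'' :=
  ⟨fun r hr => (h'.reg r hr).trans (h.reg r hr), fun a ha => (h'.arr a ha).trans (h.arr a ha)⟩

theorem Exec.frame {p : Prog} {s s' : State} {t : ℕ} (h : Exec p s s' t) : Frame p s s' := by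
  have beq_ne : ∀ x r : ℕ, Nat.beq x r = false → r ≠ x := by
    rintro x r h rfl
    simp at h
  induction h with
  | const s x c => exact ⟨fun r hr => by simp [beq_ne x r hr], fun _ _ => rfl⟩
  | copy s x y => exact ⟨fun r hr => by simp [beq_ne x r hr], fun _ _ => rfl⟩
  | add s x y z => exact ⟨fun r hr => by simp [beq_ne x r hr], fun _ _ => rfl⟩
  | sub s x y z => exact ⟨fun r hr => by simp [beq_ne x r hr], fun _ _ => rfl⟩
  | load s x a y => exact ⟨fun r hr => by simp [beq_ne x r hr], fun _ _ => rfl⟩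
  | store s a y x =>
    refine ⟨fun _ _ => rfl, fun b hb => ?_⟩
    funext j
    simp [beq_ne a b hb]
  | coin s x =>
    exact ⟨fun r hr => by simp [beq_ne x r hr, State.advance], fun _ _ => rfl⟩
  | seq _ _ ih1 ih2 =>
    refine ⟨fun r hr => ?_, fun a ha => ?_⟩
    · simp only [Prog.wr, Bool.or_eq_false_iff] at hr
      rw [ih2.reg r hr.2, ih1.reg r hr.1]
    · simp only [Prog.wrArr, Bool.or_eq_false_iff] at ha
      rw [ih2.arr a ha.2, ih1.arr a ha.1]
  | iteTrue _ _ ih =>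
    refine ⟨fun r hr => ?_, fun a ha => ?_⟩
    · simp only [Prog.wr, Bool.or_eq_false_iff] at hr
      exact ih.reg r hr.1
    · simp only [Prog.wrArr, Bool.or_eq_false_iff] at ha
      exact ih.arr a ha.1
  | iteFalse _ _ ih =>
    refine ⟨fun r hr => ?_, fun a ha => ?_⟩
    · simp only [Prog.wr, Bool.or_eq_false_iff] at hr
      exact ih.reg r hr.2
    · simp only [Prog.wrArr, Bool.or_eq_false_iff] at ha
      exact ih.arr a ha.2
  | loopDone _ => exact Frame.refl _ _
  | loopStep _ _ _ ih1 ih2 =>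
    exact ⟨fun r hr => (ih2.reg r hr).trans (ih1.reg r hr),
      fun a ha => (ih2.arr a ha).trans (ih1.arr a ha)⟩

/-- Started in the state `s`, the program `p` halts within `T` steps in a state that
satisfies `Q`. -/
def Run (p : Prog) (s : State) (T : ℕ) (Q : State → Prop) : Prop :=
  ∃ s' t, Exec p s s' t ∧ t ≤ T ∧ Q s'

namespace Run

variable {p q : Prog} {s : State} {T T' T₁ T₂ : ℕ} {Q Q' : State → Prop}

theorem mono (h : Run p s T Q) (hT : T ≤ T') (hQ : ∀ s', Q s' → Q' s') : Run p s T' Q' := by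
  obtain ⟨s', t, he, ht, hq⟩ := h
  exact ⟨s', t, he, ht.trans hT, hQ s' hq⟩

theorem mono_post (h : Run p s T Q) (hQ : ∀ s', Q s' → Frame p s s' → Q' s') : Run p s T Q' := by
  obtain ⟨s', t, he, ht, hq⟩ := h
  exact ⟨s', t, he, ht, hQ s' hq he.frame⟩

theorem mono_time (h : Run p s T Q) (hT : T ≤ T') : Run p s T' Q := h.mono hT fun _ h => h

theorem seq (h : Run p s T₁ Q) (h' : ∀ s', Q s' → Frame p s s' → Run q s' (T - T₁) Q')
    (hT : T₁ ≤ T := by omega) : Run (.seq p q) s T Q' := by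
  obtain ⟨s', t, he, ht, hq⟩ := h
  obtain ⟨s'', t', he', ht', hq'⟩ := h' s' hq he.frame
  exact ⟨s'', t + t', he.seq he', by omega, hq'⟩

theorem const {x c : ℕ} (h : Q (s.setReg x c)) (hT : 1 ≤ T := by omega) :
    Run (.const x c) s T Q :=
  ⟨_, _, .const s x c, hT, h⟩

theorem const_seq {x c : ℕ} (h : Run p (s.setReg x c) (T - 1) Q)
    (hT : 1 ≤ T := by omega) : Run (.seq (.const x c) p) s T Q :=
  (const (T := 1) (Q := fun s' => s' = (s.setReg x c)) rfl).seq
    (fun _ hs _ => hs ▸ h) hT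

theorem copy {x y : ℕ} (h : Q (s.setReg x (s.reg y))) (hT : 1 ≤ T := by omega) :
    Run (.copy x y) s T Q :=
  ⟨_, _, .copy s x y, hT, h⟩

theorem copy_seq {x y : ℕ} (h : Run p (s.setReg x (s.reg y)) (T - 1) Q)
    (hT : 1 ≤ T := by omega) : Run (.seq (.copy x y) p) s T Q :=
  (copy (T := 1) (Q := fun s' => s' = (s.setReg x (s.reg y))) rfl).seq
    (fun _ hs _ => hs ▸ h) hT

theorem add {x y z : ℕ} (h : Q (s.setReg x (s.reg y + s.reg z))) (hT : 1 ≤ T := by omega) :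
    Run (.add x y z) s T Q :=
  ⟨_, _, .add s x y z, hT, h⟩

theorem add_seq {x y z : ℕ} (h : Run p (s.setReg x (s.reg y + s.reg z)) (T - 1) Q)
    (hT : 1 ≤ T := by omega) : Run (.seq (.add x y z) p) s T Q :=
  (add (T := 1) (Q := fun s' => s' = (s.setReg x (s.reg y + s.reg z))) rfl).seq
    (fun _ hs _ => hs ▸ h) hT

theorem sub {x y z : ℕ} (h : Q (s.setReg x (s.reg y - s.reg z))) (hT : 1 ≤ T := by omega) :
    Run (.sub x y z) s T Q :=
  ⟨_, _, .sub s x y z, hT, h⟩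

theorem sub_seq {x y z : ℕ} (h : Run p (s.setReg x (s.reg y - s.reg z)) (T - 1) Q)
    (hT : 1 ≤ T := by omega) : Run (.seq (.sub x y z) p) s T Q :=
  (sub (T := 1) (Q := fun s' => s' = (s.setReg x (s.reg y - s.reg z))) rfl).seq
    (fun _ hs _ => hs ▸ h) hT

theorem load {x a y : ℕ} (h : Q (s.setReg x (s.arr a (s.reg y)))) (hT : 1 ≤ T := by omega) :
    Run (.load x a y) s T Q :=
  ⟨_, _, .load s x a y, hT, h⟩

theorem load_seq {x a y : ℕ} (h : Run p (s.setReg x (s.arr a (s.reg y))) (T - 1) Q)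
    (hT : 1 ≤ T := by omega) : Run (.seq (.load x a y) p) s T Q :=
  (load (T := 1) (Q := fun s' => s' = (s.setReg x (s.arr a (s.reg y)))) rfl).seq
    (fun _ hs _ => hs ▸ h) hT

theorem store {a y x : ℕ} (h : Q (s.setArr a (s.reg y) (s.reg x))) (hT : 1 ≤ T := by omega) :
    Run (.store a y x) s T Q :=
  ⟨_, _, .store s a y x, hT, h⟩

theorem store_seq {a y x : ℕ} (h : Run p (s.setArr a (s.reg y) (s.reg x)) (T - 1) Q)
    (hT : 1 ≤ T := by omega) : Run (.seq (.store a y x) p) s T Q :=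
  (store (T := 1) (Q := fun s' => s' = (s.setArr a (s.reg y) (s.reg x))) rfl).seq
    (fun _ hs _ => hs ▸ h) hT

theorem ite {x : ℕ} (h : s.reg x ≠ 0 → Run p s (T - 1) Q) (h' : s.reg x = 0 → Run q s (T - 1) Q)
    (hT : 1 ≤ T := by omega) : Run (.ite x p q) s T Q := by
  by_cases hx : s.reg x = 0
  · obtain ⟨s', t, he, ht, hq⟩ := h' hx
    exact ⟨s', t + 1, .iteFalse hx he, by omega, hq⟩
  · obtain ⟨s', t, he, ht, hq⟩ := h hx
    exact ⟨s', t + 1, .iteTrue hx he, by omega, hq⟩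

/-- A loop whose guard stays nonzero for exactly `N` rounds. -/
theorem loop {x N : ℕ} (I : ℕ → State → Prop) (h0 : I 0 s) (hN : ∀ s', I N s' → s'.reg x = 0)
    (hstep : ∀ j s', j < N → Frame (.loop x p) s s' → I j s' →
      s'.reg x ≠ 0 ∧ Run p s' T (I (j + 1))) :
    Run (.loop x p) s (N * (T + 1) + 1) (I N) := by
  have key : ∀ m j s', j + m = N → Frame (.loop x p) s s' → I j s' →
      Run (.loop x p) s' (m * (T + 1) + 1) (I N) := by
    intro m
    induction m with
    | zero =>
      intro j s' hj _ hI
      obtain rfl : j = N := by omega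
      exact ⟨s', 1, .loopDone (hN s' hI), by omega, hI⟩
    | succ m ih =>
      intro j s' hj hf hI
      obtain ⟨hx, s'', t, he, ht, hI'⟩ := hstep j s' (by omega) hf hI
      have hf' : Frame (.loop x p) s' s'' := ⟨he.frame.reg, he.frame.arr⟩
      obtain ⟨s3, t', he', ht', hq⟩ := ih (j + 1) s'' (by omega) (hf.trans hf') hI'
      refine ⟨s3, t + t' + 1, .loopStep hx he he', ?_, hq⟩
      rw [Nat.succ_mul]; omega
  exact key N 0 s (by omega) (Frame.refl _ _) h0

end Run

/-- `for i = 0, …, N - 1 do body`, where `N` is the content of the register that is given as `N`,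
and the register `c` counts down; the register `2` has to hold `1`. -/
def Prog.forLoop (i c N : ℕ) (body : Prog) : Prog :=
  .seq (.copy c N) (.seq (.const i 0) (.loop c (.seq body (.seq (.add i i 2) (.sub c c 2)))))

theorem Run.forLoop {i c r : ℕ} {body : Prog} {s : State} {N T : ℕ} (I : ℕ → State → Prop)
    (hr : s.reg r = N) (h2 : s.reg 2 = 1) (hic : Nat.beq i c = false) (hi2 : Nat.beq i 2 = false)
    (hc2 : Nat.beq c 2 = false) (hbi : body.wr i = false) (hbc : body.wr c = false)
    (hb2 : body.wr 2 = false) (h0 : I 0 ((s.setReg c N).setReg i 0))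
    (hstep : ∀ j s', j < N → Frame (.forLoop i c r body) s s' → s'.reg i = j → I j s' →
      Run body s' T fun s'' => I (j + 1) ((s''.setReg i (j + 1)).setReg c (N - (j + 1))))
    {T' : ℕ} (hT : N * (T + 3) + 3 ≤ T' := by first | omega | (ring_nf; omega)) :
    Run (.forLoop i c r body) s T' (I N) := by
  have ne : ∀ {x r : ℕ}, Nat.beq x r = false → r ≠ x := by
    rintro x r h rfl
    simp at h
  have hic := ne hic
  have hi2 := ne hi2
  have hc2 := ne hc2
  refine Run.mono_time ?_ hT
  refine Run.copy_seq (Run.const_seq ?_)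
  rw [hr, show N * (T + 3) + 3 - 1 - 1 = N * (T + 2 + 1) + 1 by ring_nf; omega]
  refine (Run.loop (T := T + 2) (N := N)
    (fun j s' => I j s' ∧ s'.reg i = j ∧ s'.reg c = N - j ∧ s'.reg 2 = 1) ?_ ?_ ?_).mono
    le_rfl fun s' h => h.1
  · refine ⟨h0, ?_, ?_, ?_⟩ <;> simp [hi2, hc2, h2, hic]
  · rintro s' ⟨-, -, h, -⟩
    rw [h, Nat.sub_self]
  · rintro j s' hj hf ⟨hI, hi, hc, h2'⟩
    refine ⟨by omega, ?_⟩
    have hf' : Frame (.forLoop i c r body) s s' := by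
      refine ⟨fun x hx => ?_, fun a ha => ?_⟩
      · simp only [Prog.forLoop, Prog.wr, Bool.or_eq_false_iff] at hx
        rw [hf.reg x (by simp [Prog.wr, hx])]
        simp [ne hx.1, ne hx.2.1]
      · simp only [Prog.forLoop, Prog.wrArr, Bool.or_eq_false_iff] at ha
        rw [hf.arr a (by simp [Prog.wrArr, ha])]
        rfl
    refine (hstep j s' hj hf' hi hI).seq (fun s'' hI' hfb => ?_) (Nat.le_add_right T 2)
    have e1 := hfb.reg i hbi
    have e2 := hfb.reg c hbc
    have e3 := hfb.reg 2 hb2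
    refine Run.add_seq (Run.sub ?_)
    have e4 : s''.reg i + s''.reg 2 = j + 1 := by rw [e1, e3, hi, h2']
    have e5 : (s''.setReg i (j + 1)).reg c - (s''.setReg i (j + 1)).reg 2 = N - (j + 1) := by
      simp only [State.setReg_reg, hic, hi2, if_false, e2, e3, hc, h2']
      omega
    rw [e4, e5]
    refine ⟨hI', ?_, ?_, ?_⟩
    · simp [hic.symm]
    · simp
    · simp [hi2, hc2, e3, h2']

/-- A program without effect: it copies a scratch register to itself. -/
def Prog.skip : Prog := .copy 13 13

theorem Run.skip {s : State} {T : ℕ} {Q : State → Prop} (h : Q (s.setReg 13 (s.reg 13)))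
    (hT : 1 ≤ T := by omega) : Run .skip s T Q := Run.copy h hT

infixr:60 " ;; " => Prog.seq

/-! ### Counting neighbours

The register `0` holds `n` and the register `2` holds `1`.  The bank `0` contains the adjacency
matrix.  The bank `1` is divided into blocks of `n` cells, each of which is the indicator of a set:
the current set `W`, which is the output in the end, its complement, the empty set, and the results
of the instructions of the straight-line program.  This program is on the bank `2`, seven numbers
for each instruction, and the bank `3` contains the best candidate so far.  Sets are addressed by
the positions of their blocks.  The register `3` holds the number of vertices that are missing
in `W`, `4` the number of instructions, `5` the largest digit on the tape, `6` the length of the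
tape, `7` the number `0`, and `45` the position of the first result. -/

/-- The bank `0` holds the adjacency matrix of `G`. -/
def HoldsGraph {n : ℕ} (G : SimpleGraph (Fin n)) (s : State) : Prop :=
  ∀ u v : Fin n, s.arr 0 (u.val * n + v.val) ≠ 0 ↔ G.Adj u v

theorem HoldsGraph.congr {n : ℕ} {G : SimpleGraph (Fin n)} {s s' : State} (h : HoldsGraph G s)
    (hs : s'.arr 0 = s.arr 0) : HoldsGraph G s' := by
  intro u v
  rw [hs]
  exact h u v

/-- The set whose indicator is stored in the `n` cells that start at `a`. -/
def window (n : ℕ) (mem : ℕ → ℕ) (a : ℕ) : Finset (Fin n) :=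
  Finset.univ.filter fun v => mem (a + v.val) ≠ 0

theorem mem_window {n : ℕ} {mem : ℕ → ℕ} {a : ℕ} {v : Fin n} :
    v ∈ window n mem a ↔ mem (a + v.val) ≠ 0 := by
  simp [window]

theorem window_congr {n : ℕ} {mem mem' : ℕ → ℕ} {a : ℕ}
    (h : ∀ i, a ≤ i → i < a + n → mem i = mem' i) : window n mem a = window n mem' a := by
  ext v
  rw [mem_window, mem_window, h _ (Nat.le_add_right _ _) (Nat.add_lt_add_left v.isLt _)]

/-- The number of neighbours, in the set stored at register `15`, of the vertex whose row of the
adjacency matrix starts at register `14`. -/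
def degP : Prog :=
  .const 10 0 ;; .forLoop 11 12 0 (.add 13 14 11 ;; .load 13 0 13 ;;
    .ite 13 (.add 13 15 11 ;; .load 13 1 13 ;; .ite 13 (.add 10 10 2) .skip) .skip)

theorem run_degP {n : ℕ} {G : SimpleGraph (Fin n)} {s : State} (hn : s.reg 0 = n)
    (h2 : s.reg 2 = 1) (hG : HoldsGraph G s) (v : Fin n) (hrow : s.reg 14 = v.val * n) :
    Run degP s (n * 10 + 4) fun s' =>
      s'.reg 10 = nbrCount G (window n (s.arr 1) (s.reg 15)) v := by
  classical
  let f : ℕ → ℕ := fun w =>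
    if s.arr 0 (v.val * n + w) ≠ 0 ∧ s.arr 1 (s.reg 15 + w) ≠ 0 then 1 else 0
  have hfin : ∑ w ∈ Finset.range n, f w = nbrCount G (window n (s.arr 1) (s.reg 15)) v := by
    rw [Finset.sum_range, nbrCount, window, Finset.filter_filter, Finset.card_filter]
    refine Finset.sum_congr rfl fun w _ => ?_
    simp only [f, hG v w]
    congr 1
    exact propext and_comm
  refine Run.const_seq ?_
  refine (Run.forLoop (N := n) (T := 7) (fun j s' => s'.reg 10 = ∑ w ∈ Finset.range j, f w)
    (by simpa using hn) (by simpa using h2) rfl rfl rfl rfl rfl rfl (by simp) ?_).mono le_rfl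
    fun s' h => h.trans hfin
  intro j s' hj hf hi hI
  have e14 : s'.reg 14 = v.val * n := by rw [hf.reg 14 rfl]; simpa using hrow
  have e15 : s'.reg 15 = s.reg 15 := by rw [hf.reg 15 rfl]; simp
  have e2 : s'.reg 2 = 1 := by rw [hf.reg 2 rfl]; simpa using h2
  have a0 : s'.arr 0 = s.arr 0 := by rw [hf.arr 0 rfl]; simp
  have a1 : s'.arr 1 = s.arr 1 := by rw [hf.arr 1 rfl]; simp
  refine Run.add_seq (Run.load_seq (Run.ite (fun h => ?_) (fun h => ?_)))
  · refine Run.add_seq (Run.load_seq (Run.ite (fun h' => ?_) (fun h' => ?_)))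
    · refine Run.add ?_
      simp [hi, e14, e15, a0, a1] at h h'
      have hfj : f j = 1 := by simp [f, h, h']
      simp [Finset.sum_range_succ, hI, hfj, e2]
    · refine Run.skip ?_
      simp [hi, e14, e15, a0, a1] at h h'
      have hfj : f j = 0 := by simp [f, h']
      simp [Finset.sum_range_succ, hI, hfj]
  · refine Run.skip ?_
    simp [hi, e14, a0] at h
    have hfj : f j = 0 := by simp [f, h]
    simp [Finset.sum_range_succ, hI, hfj]

/-! ### One instruction -/

/-- The test of the vertex at register `16` in an instruction: the counter `18` is increased if
the vertex qualifies, and the register `19` is set to `1` if it is also among the first ones. -/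
def testP : Prog :=
  .add 13 22 16 ;; .load 13 1 13 ;;
    .ite 13 (degP ;; .sub 20 23 10 ;; .sub 21 10 24 ;; .add 20 20 21 ;;
      .ite 20 .skip (.sub 20 25 18 ;;
        .ite 20 (.const 19 1 ;; .add 18 18 2) (.add 18 18 2))) .skip

theorem run_testP {n : ℕ} {G : SimpleGraph (Fin n)} {s : State} (hn : s.reg 0 = n)
    (h2 : s.reg 2 = 1) (hG : HoldsGraph G s) (v : Fin n) (hrow : s.reg 14 = v.val * n)
    (hv : s.reg 16 = v.val) (h19 : s.reg 19 = 0) {Y : Prop} [Decidable Y]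
    (hY : Y ↔ v ∈ window n (s.arr 1) (s.reg 22) ∧
      s.reg 23 ≤ nbrCount G (window n (s.arr 1) (s.reg 15)) v ∧
      nbrCount G (window n (s.arr 1) (s.reg 15)) v ≤ s.reg 24) :
    Run testP s (n * 10 + 15) fun s' =>
      s'.reg 18 = s.reg 18 + (if Y then 1 else 0) ∧
      s'.reg 19 = if Y ∧ s.reg 18 < s.reg 25 then 1 else 0 := by
  refine Run.add_seq (Run.load_seq (Run.ite (fun h => ?_) (fun h => ?_)))
  · simp [hv] at h
    refine Run.seq (run_degP (v := v) (by simpa using hn) (by simpa using h2) (hG.congr (by simp))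
      (by simpa using hrow)) fun s' hs hf => ?_
    have e2 : s'.reg 2 = 1 := by rw [hf.reg 2 rfl]; simpa using h2
    have e18 : s'.reg 18 = s.reg 18 := by rw [hf.reg 18 rfl]; simp
    have e19 : s'.reg 19 = 0 := by rw [hf.reg 19 rfl]; simpa using h19
    have e23 : s'.reg 23 = s.reg 23 := by rw [hf.reg 23 rfl]; simp
    have e24 : s'.reg 24 = s.reg 24 := by rw [hf.reg 24 rfl]; simp
    have e25 : s'.reg 25 = s.reg 25 := by rw [hf.reg 25 rfl]; simp
    simp at hs
    refine Run.sub_seq (Run.sub_seq (Run.add_seq (Run.ite (fun h' => ?_) (fun h' => ?_))))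
    · refine Run.skip ?_
      simp only [State.setReg_reg, e23, e24, hs] at h'
      have hnY : ¬ Y := by
        rw [hY]
        rintro ⟨-, h3, h4⟩
        simp at h'
        omega
      simp [hnY, e18, e19]
    · simp [e23, e24, hs] at h'
      have hYes : Y := hY.2 ⟨mem_window.2 h, by omega, by omega⟩
      refine Run.sub_seq (Run.ite (fun h3 => ?_) (fun h3 => ?_))
      · refine Run.const_seq (Run.add ?_)
        simp [e25, e18] at h3
        have : s.reg 18 < s.reg 25 := by omega
        simp [hYes, this, e18, e2]
      · refine Run.add ?_
        simp [e25, e18] at h3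
        have : ¬ s.reg 18 < s.reg 25 := by omega
        simp [hYes, this, e18, e2, e19]
  · refine Run.skip ?_
    simp [hv] at h
    have hnY : ¬ Y := by
      rw [hY]
      rintro ⟨h3, -⟩
      exact mem_window.1 h3 h
    simp [hnY, h19]

/-- One instruction.  Its parameters are in the registers `22` and `15` (the positions of `A` and
`B`), `23`, `24`, `25` (the two thresholds and the number of vertices), `26` (the position of `C`)
and `27` (the single vertex); the register `28` holds the position of the result. -/
def instrP : Prog :=
  .const 18 0 ;; .const 14 0 ;; .forLoop 16 17 0 (.const 19 0 ;; testP ;;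
    .add 13 26 16 ;; .load 13 1 13 ;; .add 19 19 13 ;;
    .sub 20 16 27 ;; .sub 21 27 16 ;; .add 20 20 21 ;; .sub 20 2 20 ;; .add 19 19 20 ;;
    .add 13 28 16 ;; .store 1 13 19 ;; .add 14 14 0)

theorem run_instrP {n : ℕ} {G : SimpleGraph (Fin n)} {s : State} (hn : s.reg 0 = n)
    (h2 : s.reg 2 = 1) (hG : HoldsGraph G s) :
    Run instrP s (n * (n * 10 + 30) + 5) fun s' =>
      (∀ i, i < s.reg 28 ∨ s.reg 28 + n ≤ i → s'.arr 1 i = s.arr 1 i) ∧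
      (s.reg 22 + n ≤ s.reg 28 → s.reg 15 + n ≤ s.reg 28 → s.reg 26 + n ≤ s.reg 28 →
        window n (s'.arr 1) (s.reg 28) =
          select G (window n (s.arr 1) (s.reg 22)) (window n (s.arr 1) (s.reg 15))
            (window n (s.arr 1) (s.reg 26)) (s.reg 23) (s.reg 24) (s.reg 25) (s.reg 27)) := by
  classical
  set A := window n (s.arr 1) (s.reg 22) with hA
  set B := window n (s.arr 1) (s.reg 15) with hB
  set C := window n (s.arr 1) (s.reg 26) with hC
  set base := s.reg 28 with hbase
  set X := A.filter fun v => s.reg 23 ≤ nbrCount G B v ∧ nbrCount G B v ≤ s.reg 24 with hX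
  refine Run.const_seq (Run.const_seq ?_)
  refine (Run.forLoop (N := n) (T := n * 10 + 27) (fun j s' => s'.reg 14 = j * n ∧
    (∀ i, i < base ∨ base + n ≤ i → s'.arr 1 i = s.arr 1 i) ∧
    (s.reg 22 + n ≤ base → s.reg 15 + n ≤ base → s.reg 26 + n ≤ base →
      s'.reg 18 = (X.filter fun v => v.val < j).card ∧
      ∀ w : Fin n, w.val < j → (s'.arr 1 (base + w.val) ≠ 0 ↔
        w ∈ select G A B C (s.reg 23) (s.reg 24) (s.reg 25) (s.reg 27))))
    (by simpa using hn) (by simpa using h2) rfl rfl rfl rfl rfl rfl (by simp) ?_).mono le_rfl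
    ?_
  swap
  · rintro s' ⟨-, h3, h4⟩
    refine ⟨h3, fun ha hb hc => ?_⟩
    ext w
    rw [mem_window]
    exact (h4 ha hb hc).2 w w.isLt
  rintro j s' hj hf hi ⟨h14, hmem, hinv⟩
  have e0 : s'.reg 0 = n := by rw [hf.reg 0 rfl]; simpa using hn
  have e2 : s'.reg 2 = 1 := by rw [hf.reg 2 rfl]; simpa using h2
  have e15 : s'.reg 15 = s.reg 15 := by rw [hf.reg 15 rfl]; simp
  have e22 : s'.reg 22 = s.reg 22 := by rw [hf.reg 22 rfl]; simp
  have e23 : s'.reg 23 = s.reg 23 := by rw [hf.reg 23 rfl]; simp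
  have e24 : s'.reg 24 = s.reg 24 := by rw [hf.reg 24 rfl]; simp
  have e25 : s'.reg 25 = s.reg 25 := by rw [hf.reg 25 rfl]; simp
  have e26 : s'.reg 26 = s.reg 26 := by rw [hf.reg 26 rfl]; simp
  have e27 : s'.reg 27 = s.reg 27 := by rw [hf.reg 27 rfl]; simp
  have e28 : s'.reg 28 = base := by rw [hf.reg 28 rfl]; simp [hbase]
  have a0 : s'.arr 0 = s.arr 0 := by rw [hf.arr 0 rfl]; simp
  let v : Fin n := ⟨j, hj⟩
  let Y : Prop := v ∈ window n (s'.arr 1) (s.reg 22) ∧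
      s.reg 23 ≤ nbrCount G (window n (s'.arr 1) (s.reg 15)) v ∧
      nbrCount G (window n (s'.arr 1) (s.reg 15)) v ≤ s.reg 24
  refine Run.const_seq ?_
  refine Run.seq (run_testP (n := n) (G := G) (v := v) (Y := Y) (by simpa using e0)
    (by simpa using e2)
    (hG.congr (by simpa using a0)) (by simpa using h14) (by simpa using hi) (by simp)
    (by simp [Y, e22, e15, e23, e24])) fun s2 ⟨h18, h19⟩ hf2 => ?_
  have d0 : s2.reg 0 = n := by rw [hf2.reg 0 rfl]; simpa using e0
  have d2 : s2.reg 2 = 1 := by rw [hf2.reg 2 rfl]; simpa using e2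
  have d14 : s2.reg 14 = j * n := by rw [hf2.reg 14 rfl]; simpa using h14
  have d16 : s2.reg 16 = j := by rw [hf2.reg 16 rfl]; simpa using hi
  have d26 : s2.reg 26 = s.reg 26 := by rw [hf2.reg 26 rfl]; simpa using e26
  have d27 : s2.reg 27 = s.reg 27 := by rw [hf2.reg 27 rfl]; simpa using e27
  have d28 : s2.reg 28 = base := by rw [hf2.reg 28 rfl]; simpa using e28
  have b1 : s2.arr 1 = s'.arr 1 := by rw [hf2.arr 1 rfl]; simp
  simp only [State.setReg_reg, e25] at h18 h19
  norm_num at h18 h19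
  refine Run.add_seq (Run.load_seq (Run.add_seq (Run.sub_seq (Run.sub_seq (Run.add_seq
    (Run.sub_seq (Run.add_seq (Run.add_seq (Run.store_seq (Run.add ?_))))))))))
  simp only [State.setReg_reg, State.setArr_reg, State.setReg_arr, State.setArr_arr, d0, d2, d14,
    d16, d26, d27, d28, b1]
  norm_num
  refine ⟨by ring, ?_, ?_⟩
  · intro i hib
    have : i ≠ base + j := by omega
    simp [this, hmem i hib]
  · intro ha hb hc
    obtain ⟨hcnt, hsel⟩ := hinv ha hb hc
    have wA : window n (s'.arr 1) (s.reg 22) = A :=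
      window_congr fun i _ hi2 => hmem i (Or.inl (by omega))
    have wB : window n (s'.arr 1) (s.reg 15) = B :=
      window_congr fun i _ hi2 => hmem i (Or.inl (by omega))
    have wC : s'.arr 1 (s.reg 26 + j) ≠ 0 ↔ v ∈ C := by
      rw [hC, mem_window, hmem _ (Or.inl (by omega))]
    have hYX : Y ↔ v ∈ X := by
      simp only [Y, wA, wB, hX, Finset.mem_filter]
    have hlead : v ∈ lead (s.reg 25) X ↔ Y ∧ s'.reg 18 < s.reg 25 := by
      rw [lead, Finset.mem_filter, hYX, hcnt]
      rfl
    constructor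
    · rw [h18, hcnt]
      by_cases hy : Y
      · have : X.filter (fun w => w.val ≤ j) = insert v (X.filter fun w => w.val < j) := by
          ext w
          simp only [Finset.mem_filter, Finset.mem_insert]
          constructor
          · rintro ⟨h5, h6⟩
            rcases Nat.lt_or_eq_of_le h6 with h7 | h7
            · exact Or.inr ⟨h5, h7⟩
            · exact Or.inl (Fin.ext h7)
          · rintro (rfl | ⟨h5, h6⟩)
            · exact ⟨hYX.1 hy, le_rfl⟩
            · exact ⟨h5, by omega⟩
        rw [this, Finset.card_insert_of_notMem (by simp [v]), if_pos hy]
      · have : X.filter (fun w => w.val ≤ j) = X.filter fun w => w.val < j := by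
          ext w
          simp only [Finset.mem_filter]
          refine and_congr_right fun h5 => ⟨fun h6 => ?_, fun h6 => by omega⟩
          rcases Nat.lt_or_eq_of_le h6 with h7 | h7
          · exact h7
          · exact absurd (hYX.2 ((Fin.ext h7 : w = v) ▸ h5)) hy
        rw [this, if_neg hy, add_zero]
    · intro w hw
      rcases Nat.lt_or_eq_of_le hw with h7 | h7
      · have : w.val ≠ j := by omega
        simp only [this, if_false]
        exact hsel w h7
      · have hwv : w = v := Fin.ext h7
        have hu : v ∈ (Finset.univ.filter fun x : Fin n => x.val = s.reg 27) ↔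
            j = s.reg 27 := by simp [v]
        rw [select, Finset.mem_union, Finset.mem_union, hwv, hu, ← wC, ← hX, hlead]
        have hjv : v.val = j := rfl
        simp only [hjv, if_true, h19]
        by_cases hlt : Y ∧ s'.reg 18 < s.reg 25
        · simp [hlt]
        · rw [if_neg hlt]
          simp only [hlt, false_or]
          omega

/-! ### Straight-line programs on the guess tape -/

/-- `Traces G W h X N`: the first `N` instructions on the tape `h`, seven numbers each, are in order
and compute the sets `X 3, X 4, …` from `X 0 = W`, `X 1 = Wᶜ` and `X 2 = ∅`. -/
structure Traces {n : ℕ} (G : SimpleGraph (Fin n)) (W : Finset (Fin n)) (h : ℕ → ℕ)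
    (X : ℕ → Finset (Fin n)) (N : ℕ) : Prop where
  zero : X 0 = W
  one : X 1 = Wᶜ
  two : X 2 = ∅
  instr : ∀ j < N, ∃ a b c, a < j + 3 ∧ b < j + 3 ∧ c < j + 3 ∧ h (7 * j) = a * n ∧
    h (7 * j + 1) = b * n ∧ h (7 * j + 5) = c * n ∧
    X (j + 3) = select G (X a) (X b) (X c) (h (7 * j + 2)) (h (7 * j + 3)) (h (7 * j + 4))
      (h (7 * j + 6))

theorem Derivable.exists_traces {n : ℕ} {G : SimpleGraph (Fin n)} {W : Finset (Fin n)}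
    {l : List (Finset (Fin n))} (hl : Derivable G W l) :
    3 ≤ l.length ∧ ∃ h X, (∀ i, h i ≤ l.length * n) ∧ Traces G W h X (l.length - 3) ∧
      l.reverse = (List.range l.length).map X := by
  induction hl with
  | start =>
    refine ⟨le_rfl, fun _ => 0, fun i => if i = 0 then W else if i = 1 then Wᶜ else ∅,
      fun _ => Nat.zero_le _, ⟨rfl, rfl, rfl, ?_⟩, rfl⟩
    intro j hj
    simp at hj
  | @step l A B C lo hi t u hl hA hB hC hlo hhi ht hu ih =>
    obtain ⟨h3, h, X, hbd, htr, hrev⟩ := ih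
    set L := l.length with hL
    set j := L - 3 with hj
    have hidx : ∀ S ∈ l, ∃ i < L, X i = S := by
      intro S hS
      have : S ∈ l.reverse := List.mem_reverse.2 hS
      rw [hrev, List.mem_map] at this
      obtain ⟨i, hi, hiS⟩ := this
      exact ⟨i, List.mem_range.1 hi, hiS⟩
    obtain ⟨a, ha, hXa⟩ := hidx A hA
    obtain ⟨b, hb, hXb⟩ := hidx B hB
    obtain ⟨c, hc, hXc⟩ := hidx C hC
    set S := select G A B C lo hi t u with hS
    let h' : ℕ → ℕ := fun i =>
      if i = 7 * j then a * n else if i = 7 * j + 1 then b * n else if i = 7 * j + 2 then lo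
      else if i = 7 * j + 3 then hi else if i = 7 * j + 4 then t
      else if i = 7 * j + 5 then c * n else if i = 7 * j + 6 then u else h i
    let X' : ℕ → Finset (Fin n) := fun i => if i = L then S else X i
    have hX' : ∀ i < L, X' i = X i := fun i hi => if_neg hi.ne
    refine ⟨by simp only [List.length_cons]; omega, h', X', ?_, ⟨?_, ?_, ?_, ?_⟩, ?_⟩
    · intro i
      have h1 : ∀ x, x < L → x * n ≤ (L + 1) * n := fun x hx => Nat.mul_le_mul_right _ (by omega)
      have h2 : ∀ x, x ≤ n → x ≤ (L + 1) * n := fun x hx =>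
        hx.trans (Nat.le_mul_of_pos_left _ (by omega))
      have h4 : h i ≤ (L + 1) * n := (hbd i).trans (Nat.mul_le_mul_right _ (by omega))
      have ha' := h1 a ha
      have hb' := h1 b hb
      have hc' := h1 c hc
      have hlo' := h2 lo hlo
      have hhi' := h2 hi hhi
      have ht' := h2 t ht
      have hu' := h2 u hu
      simp only [List.length_cons, h']
      split_ifs <;> assumption
    · rw [hX' 0 (by omega)]; exact htr.zero
    · rw [hX' 1 (by omega)]; exact htr.one
    · rw [hX' 2 (by omega)]; exact htr.two
    · intro i hi
      simp only [List.length_cons] at hi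
      rcases Nat.lt_or_ge i j with hij | hij
      · obtain ⟨a', b', c', h1, h2, h3', h4, h5, h6, h7⟩ := htr.instr i hij
        have e : ∀ r < 7, h' (7 * i + r) = h (7 * i + r) := by
          intro r hr
          simp only [h']
          rw [if_neg (by omega), if_neg (by omega), if_neg (by omega), if_neg (by omega),
            if_neg (by omega), if_neg (by omega), if_neg (by omega)]
        have e0 := e 0 (by omega)
        rw [add_zero] at e0
        refine ⟨a', b', c', h1, h2, h3', ?_, ?_, ?_, ?_⟩
        · rw [e0, h4]
        · rw [e 1 (by omega), h5]
        · rw [e 5 (by omega), h6]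
        · rw [e 2 (by omega), e 3 (by omega), e 4 (by omega), e 6 (by omega), hX' _ (by omega),
            hX' _ (by omega), hX' _ (by omega), hX' _ (by omega), h7]
      · obtain rfl : i = j := by omega
        refine ⟨a, b, c, by omega, by omega, by omega, by simp [h'], by simp [h'], by simp [h'], ?_⟩
        rw [hX' a ha, hX' b hb, hX' c hc, hXa, hXb, hXc]
        have : X' (j + 3) = S := if_pos (by omega)
        rw [this, hS]
        simp [h']
    · rw [List.reverse_cons, hrev, List.length_cons, List.range_succ, List.map_append]
      congr 1
      · refine List.map_congr_left fun i hi => ?_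
        rw [hX' i (List.mem_range.1 hi)]
      · simp [X', hL]

/-- A program of `M + 3` sets whose last set is `A` can be written on the tape. -/
theorem Derivable.exists_tape {n : ℕ} {G : SimpleGraph (Fin n)} {W A : Finset (Fin n)}
    {l : List (Finset (Fin n))} (hl : Derivable G W l) (hA : A ∈ l) {M : ℕ}
    (hM : l.length < M + 3) :
    ∃ h X, (∀ i, h i ≤ (M + 3) * n) ∧ Traces G W h X M ∧ X (M + 2) = A := by
  obtain ⟨l', hl', hlen⟩ := hl.pad hA hM
  obtain ⟨-, h, X, hbd, htr, hrev⟩ := hl'.exists_traces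
  rw [List.length_cons, hlen] at hbd htr hrev
  refine ⟨h, X, hbd, by simpa using htr, ?_⟩
  rw [List.reverse_cons, show M + 3 = (M + 2) + 1 from rfl, List.range_succ, List.map_append] at hrev
  have := (List.append_inj' hrev (by simp)).2
  simpa using this.symm

/-- Executes the instructions on the guess tape. -/
def runTapeP : Prog :=
  .const 31 0 ;; .copy 28 45 ;; .forLoop 29 30 4 (
    .load 22 2 31 ;; .add 31 31 2 ;; .load 15 2 31 ;; .add 31 31 2 ;; .load 23 2 31 ;;
    .add 31 31 2 ;; .load 24 2 31 ;; .add 31 31 2 ;; .load 25 2 31 ;; .add 31 31 2 ;;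
    .load 26 2 31 ;; .add 31 31 2 ;; .load 27 2 31 ;; .add 31 31 2 ;; instrP ;; .add 28 28 0)

/-- A bound on the running time of one instruction. -/
def instrTime (n : ℕ) : ℕ := n * (n * 10 + 30) + 5

theorem run_runTapeP {n M : ℕ} {G : SimpleGraph (Fin n)} {W : Finset (Fin n)} {s : State}
    (hn : s.reg 0 = n) (h2 : s.reg 2 = 1) (hM : s.reg 4 = M) (h45 : s.reg 45 = 3 * n)
    (hG : HoldsGraph G s) (w0 : window n (s.arr 1) 0 = W) (w1 : window n (s.arr 1) n = Wᶜ)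
    (w2 : window n (s.arr 1) (2 * n) = ∅) :
    Run runTapeP s (M * (instrTime n + 18) + 5) fun s' =>
      s'.reg 28 = (M + 3) * n ∧ (∀ i < 3 * n, s'.arr 1 i = s.arr 1 i) ∧
      ∀ X, Traces G W (s.arr 2) X M → ∀ i < M + 3, window n (s'.arr 1) (i * n) = X i := by
  refine Run.const_seq (Run.copy_seq ?_)
  refine (Run.forLoop (N := M) (T := instrTime n + 15) (fun j s' => s'.reg 28 = (j + 3) * n ∧
    s'.reg 31 = 7 * j ∧ (∀ i < 3 * n, s'.arr 1 i = s.arr 1 i) ∧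
    ∀ X, Traces G W (s.arr 2) X M → ∀ i < j + 3, window n (s'.arr 1) (i * n) = X i)
    (by simpa using hM) (by simpa using h2) rfl rfl rfl rfl rfl rfl ?_ ?_).mono le_rfl
    fun s' h => ⟨h.1, h.2.2.1, h.2.2.2⟩
  · refine ⟨by simp [h45], by simp, by simp, fun X hX i hi => ?_⟩
    simp only [State.setReg_arr]
    have : i = 0 ∨ i = 1 ∨ i = 2 := by omega
    rcases this with rfl | rfl | rfl
    · rw [Nat.zero_mul, w0, hX.zero]
    · rw [Nat.one_mul, w1, hX.one]
    · rw [w2, hX.two]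
  rintro j s' hj hf hi ⟨h28, h31, hlow, hwin⟩
  have e0 : s'.reg 0 = n := by rw [hf.reg 0 rfl]; simpa using hn
  have e2 : s'.reg 2 = 1 := by rw [hf.reg 2 rfl]; simpa using h2
  have a0 : s'.arr 0 = s.arr 0 := by rw [hf.arr 0 rfl]; simp
  have a2 : s'.arr 2 = s.arr 2 := by rw [hf.arr 2 rfl]; simp
  refine Run.load_seq (Run.add_seq (Run.load_seq (Run.add_seq (Run.load_seq (Run.add_seq
    (Run.load_seq (Run.add_seq (Run.load_seq (Run.add_seq (Run.load_seq (Run.add_seq (Run.load_seq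
    (Run.add_seq ?_)))))))))))))
  generalize hs1 : State.setReg _ 31 _ = s1
  have d0 : s1.reg 0 = n := by rw [← hs1]; simpa using e0
  have d2 : s1.reg 2 = 1 := by rw [← hs1]; simpa using e2
  have d28 : s1.reg 28 = (j + 3) * n := by rw [← hs1]; simpa using h28
  have d31 : s1.reg 31 = 7 * (j + 1) := by rw [← hs1]; simp [e2, h31]; ring
  have d22 : s1.reg 22 = s.arr 2 (7 * j) := by rw [← hs1]; simp [h31, a2]
  have d15 : s1.reg 15 = s.arr 2 (7 * j + 1) := by rw [← hs1]; simp [h31, e2, a2]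
  have d23 : s1.reg 23 = s.arr 2 (7 * j + 2) := by rw [← hs1]; simp [h31, e2, a2]
  have d24 : s1.reg 24 = s.arr 2 (7 * j + 3) := by rw [← hs1]; simp [h31, e2, a2]
  have d25 : s1.reg 25 = s.arr 2 (7 * j + 4) := by rw [← hs1]; simp [h31, e2, a2]
  have d26 : s1.reg 26 = s.arr 2 (7 * j + 5) := by rw [← hs1]; simp [h31, e2, a2]
  have d27 : s1.reg 27 = s.arr 2 (7 * j + 6) := by rw [← hs1]; simp [h31, e2, a2]
  have b1 : s1.arr 1 = s'.arr 1 := by rw [← hs1]; simp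
  have b0 : s1.arr 0 = s.arr 0 := by rw [← hs1]; simpa using a0
  refine Run.seq (run_instrP d0 d2 (hG.congr b0)) (fun s2 ⟨hmem, hres⟩ hf2 => ?_)
    (by unfold instrTime; omega)
  have c0 : s2.reg 0 = n := by rw [hf2.reg 0 rfl, d0]
  have c28 : s2.reg 28 = (j + 3) * n := by rw [hf2.reg 28 rfl, d28]
  have c31 : s2.reg 31 = 7 * (j + 1) := by rw [hf2.reg 31 rfl, d31]
  rw [d28] at hmem hres
  rw [b1] at hmem
  refine Run.add ?_ (by unfold instrTime; omega)
  have hle : ∀ i, i < j + 3 → i * n + n ≤ (j + 3) * n := by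
    intro i hi
    rw [← Nat.succ_mul]
    exact Nat.mul_le_mul_right _ hi
  refine ⟨?_, ?_, ?_, ?_⟩
  · simp [c28, c0]; ring
  · simp [c31]
  · intro i hi
    have := hle 2 (by omega)
    simp only [State.setReg_arr]
    rw [hmem i (Or.inl (by omega)), hlow i hi]
  · intro X hX i hi
    simp only [State.setReg_arr]
    have hold : ∀ i < j + 3, window n (s2.arr 1) (i * n) = X i := by
      intro i hi
      rw [← hwin X hX i hi]
      refine window_congr fun x _ hx => hmem x (Or.inl ?_)
      have := hle i hi
      omega
    rcases Nat.lt_or_ge i (j + 3) with h | h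
    · exact hold i h
    · obtain rfl : i = j + 3 := by omega
      obtain ⟨a, b, c, ha, hb, hc, h4, h5, h6, h7⟩ := hX.instr j hj
      rw [d22, d15, d26, h4, h5, h6, b1] at hres
      rw [hres (hle a ha) (hle b hb) (hle c hc), h7, hwin X hX a ha, hwin X hX b hb, hwin X hX c hc,
        d23, d24, d25, d27]

/-! ### Evaluation of a candidate -/

/-- The contribution of the vertex at register `16` to the size `33` and the gain `34` of the
candidate; the register `35` is set if the vertex is already in use. -/
def evalVertexP : Prog :=
  .add 13 32 16 ;; .load 13 1 13 ;; .ite 13 (.load 20 1 16 ;;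
    .ite 20 (.const 35 1) (.add 33 33 2 ;; .const 15 0 ;; degP ;; .add 34 34 10 ;;
      .add 34 34 10 ;; .copy 15 32 ;; degP ;; .add 34 34 10)) .skip

theorem run_evalVertexP {n : ℕ} {G : SimpleGraph (Fin n)} {W A : Finset (Fin n)} {s : State}
    (hn : s.reg 0 = n) (h2 : s.reg 2 = 1) (hG : HoldsGraph G s) (v : Fin n)
    (hrow : s.reg 14 = v.val * n) (hv : s.reg 16 = v.val)
    (hW : window n (s.arr 1) 0 = W) (hA : window n (s.arr 1) (s.reg 32) = A) :
    Run evalVertexP s (n * 20 + 19) fun s' =>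
      (s'.reg 35 ≠ 0 ↔ s.reg 35 ≠ 0 ∨ (v ∈ A ∧ v ∈ W)) ∧
      ((v ∈ A → v ∉ W) → s'.reg 33 = s.reg 33 + (if v ∈ A then 1 else 0) ∧
        s'.reg 34 = s.reg 34 + (if v ∈ A then 2 * nbrCount G W v + nbrCount G A v else 0)) := by
  have mA : v ∈ A ↔ s.arr 1 (s.reg 32 + v.val) ≠ 0 := by rw [← hA, mem_window]
  have mW : v ∈ W ↔ s.arr 1 v.val ≠ 0 := by rw [← hW, mem_window, Nat.zero_add]
  refine Run.add_seq (Run.load_seq (Run.ite (fun h => ?_) (fun h => ?_)))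
  · simp only [State.setReg_reg, State.setReg_arr, hv] at h
    norm_num at h
    have hvA : v ∈ A := mA.2 h
    refine Run.load_seq (Run.ite (fun h' => ?_) (fun h' => ?_))
    · simp only [State.setReg_reg, State.setReg_arr, hv] at h'
      norm_num at h'
      have hvW : v ∈ W := mW.2 h'
      refine Run.const ?_
      simp [hvA, hvW]
    · simp only [State.setReg_reg, State.setReg_arr, hv] at h'
      norm_num at h'
      have hvW : v ∉ W := fun h3 => mW.1 h3 h'
      refine Run.add_seq (Run.const_seq ?_)
      refine Run.seq (run_degP (v := v) (by simpa using hn) (by simpa using h2)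
        (hG.congr (by simp)) (by simpa using hrow)) fun s1 hs1 hf1 => ?_
      simp [hW] at hs1
      have e0 : s1.reg 0 = n := by rw [hf1.reg 0 rfl]; simpa using hn
      have e2 : s1.reg 2 = 1 := by rw [hf1.reg 2 rfl]; simpa using h2
      have e14 : s1.reg 14 = v.val * n := by rw [hf1.reg 14 rfl]; simpa using hrow
      have e32 : s1.reg 32 = s.reg 32 := by rw [hf1.reg 32 rfl]; simp
      have e33 : s1.reg 33 = s.reg 33 + 1 := by rw [hf1.reg 33 rfl]; simp [h2]
      have e34 : s1.reg 34 = s.reg 34 := by rw [hf1.reg 34 rfl]; simp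
      have e35 : s1.reg 35 = s.reg 35 := by rw [hf1.reg 35 rfl]; simp
      have a0 : s1.arr 0 = s.arr 0 := by rw [hf1.arr 0 rfl]; simp
      have a1 : s1.arr 1 = s.arr 1 := by rw [hf1.arr 1 rfl]; simp
      refine Run.add_seq (Run.add_seq (Run.copy_seq ?_))
      refine Run.seq (run_degP (v := v) (by simpa using e0) (by simpa using e2)
        (hG.congr (by simpa using a0)) (by simpa using e14)) fun s2 hs2 hf2 => ?_
      simp [a1, e32, hA] at hs2
      have d33 : s2.reg 33 = s.reg 33 + 1 := by rw [hf2.reg 33 rfl]; simpa using e33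
      have d34 : s2.reg 34 = s.reg 34 + nbrCount G W v + nbrCount G W v := by
        rw [hf2.reg 34 rfl]; simp [e34, hs1]
      have d35 : s2.reg 35 = s.reg 35 := by rw [hf2.reg 35 rfl]; simpa using e35
      refine Run.add ?_
      simp [hvA, hvW, d33, d34, d35, hs2]
      ring
  · simp only [State.setReg_reg, State.setReg_arr, hv] at h
    norm_num at h
    have hvA : v ∉ A := fun h3 => mA.1 h3 h
    refine Run.skip ?_
    simp [hvA]

theorem sum_filter_val_lt_succ {n : ℕ} (A : Finset (Fin n)) (f : Fin n → ℕ) (v : Fin n) :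
    ∑ w ∈ A.filter (fun w => w.val < v.val + 1), f w
      = ∑ w ∈ A.filter (fun w => w.val < v.val), f w + if v ∈ A then f v else 0 := by
  have hsp : ∀ w : Fin n, w.val < v.val + 1 ↔ w.val < v.val ∨ w = v := fun w => by
    rw [Fin.ext_iff]; omega
  simp only [hsp, Finset.filter_or]
  rw [Finset.sum_union, Finset.filter_eq']
  · split_ifs <;> simp
  · refine Finset.disjoint_left.2 fun w hw hw' => ?_
    rw [(Finset.mem_filter.1 hw').2] at hw
    simp at hw

/-- Computes the size `33` and the gain `34` of the candidate, which is the result of the last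
instruction; the register `35` is nonzero if the candidate is not disjoint from `W`. -/
def evalP : Prog :=
  .sub 32 28 0 ;; .const 33 0 ;; .const 34 0 ;; .const 35 0 ;; .const 14 0 ;;
    .forLoop 16 17 0 (evalVertexP ;; .add 14 14 0)

theorem run_evalP {n : ℕ} {G : SimpleGraph (Fin n)} {W A : Finset (Fin n)} {s : State}
    (hn : s.reg 0 = n) (h2 : s.reg 2 = 1) (hG : HoldsGraph G s)
    (hW : window n (s.arr 1) 0 = W) (hA : window n (s.arr 1) (s.reg 28 - n) = A) :
    Run evalP s (n * (n * 20 + 23) + 8) fun s' =>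
      s'.reg 32 = s.reg 28 - n ∧ (s'.reg 35 = 0 ↔ A ⊆ Wᶜ) ∧
      (A ⊆ Wᶜ → s'.reg 33 = A.card ∧ s'.reg 34 = gain G W A) := by
  refine Run.sub_seq (Run.const_seq (Run.const_seq (Run.const_seq (Run.const_seq ?_))))
  refine (Run.forLoop (N := n) (T := n * 20 + 20) (fun j s' => s'.reg 14 = j * n ∧
    (s'.reg 35 ≠ 0 ↔ ∃ v ∈ A, v.val < j ∧ v ∈ W) ∧
    (A ⊆ Wᶜ → s'.reg 33 = ∑ v ∈ A.filter (fun v => v.val < j), 1 ∧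
      s'.reg 34 = ∑ v ∈ A.filter (fun v => v.val < j), (2 * nbrCount G W v + nbrCount G A v)))
    (by simpa using hn) (by simpa using h2) rfl rfl rfl rfl rfl rfl (by simp) ?_).mono_post ?_
  · rintro j s' hj hf hi ⟨h14, h35, hsum⟩
    have e0 : s'.reg 0 = n := by rw [hf.reg 0 rfl]; simpa using hn
    have e2 : s'.reg 2 = 1 := by rw [hf.reg 2 rfl]; simpa using h2
    have e32 : s'.reg 32 = s.reg 28 - n := by rw [hf.reg 32 rfl]; simp [hn]
    have a0 : s'.arr 0 = s.arr 0 := by rw [hf.arr 0 rfl]; simp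
    have a1 : s'.arr 1 = s.arr 1 := by rw [hf.arr 1 rfl]; simp
    refine Run.seq (run_evalVertexP (W := W) (A := A) e0 e2 (hG.congr a0) ⟨j, hj⟩ h14 hi
      (by rw [a1, hW]) (by rw [a1, e32, hA])) fun s1 ⟨hb, hs1⟩ hf1 => ?_
    have d0 : s1.reg 0 = n := by rw [hf1.reg 0 rfl, e0]
    have d14 : s1.reg 14 = j * n := by rw [hf1.reg 14 rfl, h14]
    refine Run.add ?_
    refine ⟨?_, ?_, fun hAW => ?_⟩
    · simp [d0, d14]; ring
    · simp only [State.setReg_reg]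
      norm_num
      rw [← ne_eq, hb, h35]
      constructor
      · rintro (⟨v, h1, h3, h4⟩ | ⟨h1, h3⟩)
        · exact ⟨v, h1, by omega, h4⟩
        · exact ⟨_, h1, le_rfl, h3⟩
      · rintro ⟨v, h1, h3, h4⟩
        rcases Nat.lt_or_eq_of_le h3 with h5 | h5
        · exact Or.inl ⟨v, h1, h5, h4⟩
        · obtain rfl : v = ⟨j, hj⟩ := Fin.ext h5
          exact Or.inr ⟨h1, h4⟩
    · obtain ⟨i1, i2⟩ := hsum hAW
      have k1 := sum_filter_val_lt_succ A (fun _ => 1) ⟨j, hj⟩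
      have k2 := sum_filter_val_lt_succ A (fun v => 2 * nbrCount G W v + nbrCount G A v) ⟨j, hj⟩
      simp only at k1 k2
      rw [k1, k2]
      simp only [State.setReg_reg]
      norm_num
      obtain ⟨m1, m2⟩ := hs1 fun hjA => Finset.mem_compl.1 (hAW hjA)
      rw [m1, m2, i1, i2]
      simp
  · rintro s' ⟨h14, h35, hsum⟩ hf
    refine ⟨?_, ?_, fun hAW => ?_⟩
    · rw [hf.reg 32 rfl]; simp [hn]
    · rw [← not_iff_not, ← ne_eq, h35]
      constructor
      · rintro ⟨v, h1, -, h3⟩ h4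
        exact Finset.mem_compl.1 (h4 h1) h3
      · intro h
        by_contra! hcon
        exact h fun v hv => Finset.mem_compl.2 (hcon v hv v.isLt)
    · obtain ⟨i1, i2⟩ := hsum hAW
      have : A.filter (fun v => v.val < n) = A := Finset.filter_true_of_mem fun v _ => v.isLt
      rw [this] at i1 i2
      refine ⟨by simpa using i1, ?_⟩
      rw [i2, gain, degSum, Finset.sum_add_distrib, Finset.mul_sum]

/-! ### The best candidate so far -/

/-- The candidates for the next step: nonempty sets of at most `r` unused vertices. -/
structure IsCandidate {n : ℕ} (W : Finset (Fin n)) (r : ℕ) (A : Finset (Fin n)) : Prop where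
  subset_compl : A ⊆ Wᶜ
  nonempty : A.Nonempty
  card_le : A.card ≤ r

/-- The bank `3` and the registers `36` and `37` hold a candidate, its gain and its size; the
size `0` means that there is no candidate yet. -/
structure HoldsBest {n : ℕ} (G : SimpleGraph (Fin n)) (W : Finset (Fin n)) (r : ℕ) (s : State) :
    Prop where
  gain_eq_zero : s.reg 37 = 0 → s.reg 36 = 0
  candidate : s.reg 37 ≠ 0 → IsCandidate W r (window n (s.arr 3) 0)
  card : s.reg 37 ≠ 0 → s.reg 37 = (window n (s.arr 3) 0).card
  gain : s.reg 37 ≠ 0 → s.reg 36 = gain G W (window n (s.arr 3) 0)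

theorem HoldsBest.size_le {n : ℕ} {G : SimpleGraph (Fin n)} {W : Finset (Fin n)} {r : ℕ}
    {s : State} (h : HoldsBest G W r s) : s.reg 37 ≤ n := by
  by_cases h0 : s.reg 37 = 0
  · omega
  · rw [h.card h0]
    simpa using Finset.card_le_univ (window n (s.arr 3) 0)

theorem HoldsBest.congr {n : ℕ} {G : SimpleGraph (Fin n)} {W : Finset (Fin n)} {r : ℕ}
    {s s' : State} (h : HoldsBest G W r s) (h36 : s'.reg 36 = s.reg 36)
    (h37 : s'.reg 37 = s.reg 37) (h3 : s'.arr 3 = s.arr 3) : HoldsBest G W r s' := by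
  obtain ⟨h1, h2, h4, h5⟩ := h
  constructor <;> rw [h37] <;> first | rw [h36] | skip
  · exact h1
  · rwa [h3]
  · rwa [h3]
  · rwa [h3]

/-- The ratio of gain and size of `A` is at most that of the stored candidate. -/
structure Dominated {n : ℕ} (G : SimpleGraph (Fin n)) (W : Finset (Fin n)) (s : State)
    (A : Finset (Fin n)) : Prop where
  ne_zero : s.reg 37 ≠ 0
  le : gain G W A * s.reg 37 ≤ s.reg 36 * A.card

theorem Dominated.congr {n : ℕ} {G : SimpleGraph (Fin n)} {W A : Finset (Fin n)}
    {s s' : State} (h : Dominated G W s A) (h36 : s'.reg 36 = s.reg 36)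
    (h37 : s'.reg 37 = s.reg 37) : Dominated G W s' A := by
  obtain ⟨h1, h2⟩ := h
  constructor <;> rw [h37]
  · exact h1
  · rwa [h36]

theorem beq_false {x y : ℕ} (h : x ≠ y) : Nat.beq x y = false := by
  rw [← Bool.not_eq_true, Nat.beq_eq]
  exact h

/-- `x := y * z`, by repeated addition. -/
def Prog.mulLoop (x y z : ℕ) : Prog := .const x 0 ;; .forLoop 40 41 z (.add x x y)

theorem Run.mulLoop {x y z a b : ℕ} {s : State} (hy : s.reg y = a) (hz : s.reg z = b)
    (h2 : s.reg 2 = 1) (hx : 42 ≤ x ∨ (3 ≤ x ∧ x < 40)) (hxy : x ≠ y) (hxz : x ≠ z)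
    (hy' : y ≠ 40 ∧ y ≠ 41) {T : ℕ} (hT : b * 4 + 4 ≤ T := by omega) :
    Run (.mulLoop x y z) s T fun s' => s'.reg x = b * a := by
  have hx40 : Nat.beq x 40 = false := beq_false (by omega)
  have hx41 : Nat.beq x 41 = false := beq_false (by omega)
  have hx2 : Nat.beq x 2 = false := beq_false (by omega)
  have hx40' : x ≠ 40 := by omega
  have hx41' : x ≠ 41 := by omega
  refine Run.const_seq ?_
  refine Run.forLoop (body := .add x x y) (N := b) (T := 1) (fun j s' => s'.reg x = j * a) (by simpa [hxz.symm] using hz)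
    (by have : 2 ≠ x := by omega
        simpa [this] using h2) rfl rfl rfl hx40 hx41 hx2 (by simp [hx40', hx41']) ?_
  intro j s' hj hf hi hI
  have e : s'.reg y = a := by
    rw [hf.reg y]
    · simpa [hxy.symm] using hy
    · have h1 : Nat.beq x y = false := beq_false (by omega)
      have h2 : Nat.beq 40 y = false := beq_false (by omega)
      have h3 : Nat.beq 41 y = false := beq_false (by omega)
      simp only [Prog.forLoop, Prog.wr, h1, h2, h3, Bool.or_false]
  refine Run.add ?_
  simp [hx40', hx41', hI, e]
  ring

/-- Stores the current candidate if its ratio of gain and size is at least that of the stored one.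
The two ratios are compared by cross-multiplication. -/
def updateP : Prog :=
  .sub 20 33 3 ;; .add 20 20 35 ;; .ite 20 .skip (.ite 33
    (.mulLoop 38 34 37 ;; .mulLoop 39 36 33 ;; .sub 20 39 38 ;; .ite 20 .skip
      (.copy 36 34 ;; .copy 37 33 ;;
        .forLoop 40 41 0 (.add 13 32 40 ;; .load 13 1 13 ;; .store 3 40 13))) .skip)

theorem run_updateP {n r : ℕ} {G : SimpleGraph (Fin n)} {W A : Finset (Fin n)} {s : State}
    (hn : s.reg 0 = n) (h2 : s.reg 2 = 1) (h3 : s.reg 3 = r) (hbest : HoldsBest G W r s)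
    (hA : window n (s.arr 1) (s.reg 32) = A) (h35 : s.reg 35 = 0 ↔ A ⊆ Wᶜ)
    (h33 : A ⊆ Wᶜ → s.reg 33 = A.card ∧ s.reg 34 = gain G W A) :
    Run updateP s (n * 14 + 20) fun s' => HoldsBest G W r s' ∧
      (IsCandidate W r A → Dominated G W s' A) ∧
      ∀ A', Dominated G W s A' → Dominated G W s' A' := by
  refine Run.sub_seq (Run.add_seq (Run.ite (fun h => ?_) (fun h => ?_)))
  · refine Run.skip ⟨hbest.congr (by simp) (by simp) (by simp), fun hc => absurd ?_ h,
      fun A' hA' => hA'.congr (by simp) (by simp)⟩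
    have := (h33 hc.subset_compl).1
    have := h35.2 hc.subset_compl
    have := hc.card_le
    simp; omega
  simp [h3] at h
  obtain ⟨hle, h0⟩ := h
  have hAW := h35.1 h0
  obtain ⟨hsz, hga⟩ := h33 hAW
  have hsn : A.card ≤ n := by simpa using Finset.card_le_univ A
  have hbn := hbest.size_le
  refine Run.ite (fun h => ?_) (fun h => ?_)
  · simp [hsz] at h
    have hne : A.Nonempty := Finset.nonempty_iff_ne_empty.2 h
    have hpos : 0 < A.card := Finset.card_pos.2 hne
    have hcand : IsCandidate W r A := ⟨hAW, hne, by omega⟩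
    refine Run.seq (Run.mulLoop (a := gain G W A) (b := s.reg 37) (T := n * 4 + 4)
      (by simpa using hga) (by simp) (by simpa using h2) (by simp) (by simp) (by simp) (by simp))
      fun s1 h38 hf1 => ?_
    have d0 : s1.reg 0 = n := by rw [hf1.reg 0 rfl]; simpa using hn
    have d2 : s1.reg 2 = 1 := by rw [hf1.reg 2 rfl]; simpa using h2
    have d32 : s1.reg 32 = s.reg 32 := by rw [hf1.reg 32 rfl]; simp
    have d33 : s1.reg 33 = A.card := by rw [hf1.reg 33 rfl]; simpa using hsz
    have d34 : s1.reg 34 = gain G W A := by rw [hf1.reg 34 rfl]; simpa using hga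
    have d36 : s1.reg 36 = s.reg 36 := by rw [hf1.reg 36 rfl]; simp
    have d37 : s1.reg 37 = s.reg 37 := by rw [hf1.reg 37 rfl]; simp
    have a1 : s1.arr 1 = s.arr 1 := by rw [hf1.arr 1 rfl]; simp
    have a3 : s1.arr 3 = s.arr 3 := by rw [hf1.arr 3 rfl]; simp
    clear hf1
    refine Run.seq (Run.mulLoop (a := s.reg 36) (b := A.card) (T := n * 4 + 4)
      d36 d33 d2 (by simp) (by simp) (by simp) (by simp)) fun s2 h39 hf2 => ?_
    have e0 : s2.reg 0 = n := by rw [hf2.reg 0 rfl, d0]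
    have e2 : s2.reg 2 = 1 := by rw [hf2.reg 2 rfl, d2]
    have e32 : s2.reg 32 = s.reg 32 := by rw [hf2.reg 32 rfl, d32]
    have e33 : s2.reg 33 = A.card := by rw [hf2.reg 33 rfl, d33]
    have e34 : s2.reg 34 = gain G W A := by rw [hf2.reg 34 rfl, d34]
    have e36 : s2.reg 36 = s.reg 36 := by rw [hf2.reg 36 rfl, d36]
    have e37 : s2.reg 37 = s.reg 37 := by rw [hf2.reg 37 rfl, d37]
    have e38 : s2.reg 38 = s.reg 37 * gain G W A := by rw [hf2.reg 38 rfl, h38]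
    have b1 : s2.arr 1 = s.arr 1 := by rw [hf2.arr 1 rfl, a1]
    have b3 : s2.arr 3 = s.arr 3 := by rw [hf2.arr 3 rfl, a3]
    clear hf2
    refine Run.sub_seq (Run.ite (fun h' => ?_) (fun h' => ?_))
    · simp [h39, e38] at h'
      have hlt : s.reg 37 * gain G W A < A.card * s.reg 36 := by omega
      refine Run.skip ⟨hbest.congr (by simpa) (by simpa) (by simpa), fun _ => ⟨?_, ?_⟩,
        fun A' hA' => hA'.congr (by simpa) (by simpa)⟩
      · simp only [State.setReg_reg]
        norm_num
        rw [e37]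
        intro h0
        rw [hbest.gain_eq_zero h0] at hlt
        omega
      · simp only [State.setReg_reg]
        norm_num
        rw [e36, e37]
        linarith
    · simp [h39, e38] at h'
      have hge : A.card * s.reg 36 ≤ s.reg 37 * gain G W A := by omega
      refine Run.copy_seq (Run.copy_seq ?_)
      refine (Run.forLoop (N := n) (T := 3) (fun j s' => ∀ v : Fin n, v.val < j →
        (s'.arr 3 v.val ≠ 0 ↔ v ∈ A)) (by simpa using e0) (by simpa using e2) rfl rfl rfl rfl rfl
        rfl (by simp) ?_).mono_post ?_
      · intro j s' hj hf hi hI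
        have c1 : s'.arr 1 = s.arr 1 := by rw [hf.arr 1 rfl]; simpa using b1
        have c32 : s'.reg 32 = s.reg 32 := by rw [hf.reg 32 rfl]; simpa using e32
        refine Run.add_seq (Run.load_seq (Run.store ?_))
        intro v hv
        rcases Nat.lt_or_eq_of_le (Nat.le_of_lt_succ hv) with h5 | h5
        · have : v.val ≠ j := by omega
          simpa [hi, this] using hI v h5
        · have : v ∈ A ↔ s.arr 1 (s.reg 32 + j) ≠ 0 := by rw [← hA, mem_window, h5]
          simp [hi, h5, c1, c32, this]
      · intro s' hI hf
        have c36 : s'.reg 36 = gain G W A := by rw [hf.reg 36 rfl]; simp [e34]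
        have c37 : s'.reg 37 = A.card := by rw [hf.reg 37 rfl]; simp [e33]
        have hwin : window n (s'.arr 3) 0 = A := by
          ext v
          rw [mem_window, Nat.zero_add, hI v v.isLt]
        refine ⟨⟨fun h => by omega, fun _ => ?_, fun _ => ?_, fun _ => ?_⟩, fun _ => ⟨?_, ?_⟩,
          fun A' hA' => ⟨?_, ?_⟩⟩
        · rwa [hwin]
        · rw [hwin, c37]
        · rw [hwin, c36]
        · omega
        · rw [c36, c37]
        · omega
        · rw [c36, c37]
          have hb := Nat.pos_of_ne_zero hA'.ne_zero
          refine Nat.le_of_mul_le_mul_right ?_ hb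
          calc gain G W A' * A.card * s.reg 37 = gain G W A' * s.reg 37 * A.card := by ring
            _ ≤ s.reg 36 * A'.card * A.card := Nat.mul_le_mul_right _ hA'.le
            _ = A.card * s.reg 36 * A'.card := by ring
            _ ≤ s.reg 37 * gain G W A * A'.card := Nat.mul_le_mul_right _ hge
            _ = gain G W A * A'.card * s.reg 37 := by ring
  · simp [hsz] at h
    refine Run.skip ⟨hbest.congr (by simp) (by simp) (by simp),
      fun hc => absurd h hc.nonempty.ne_empty, fun A' hA' => hA'.congr (by simp) (by simp)⟩

/-! ### Enumeration of all guess tapes -/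

/-- The number whose digits in base `B + 1` are `g 0, …, g (K - 1)`, least significant first. -/
def digitSum (B : ℕ) (g : ℕ → ℕ) (K : ℕ) : ℕ := ∑ i ∈ Finset.range K, g i * (B + 1) ^ i

theorem digitSum_succ (B : ℕ) (g : ℕ → ℕ) (K : ℕ) :
    digitSum B g (K + 1) = digitSum B g K + g K * (B + 1) ^ K := Finset.sum_range_succ _ _

theorem digitSum_congr {B K : ℕ} {g h : ℕ → ℕ} (e : ∀ i < K, g i = h i) :
    digitSum B g K = digitSum B h K :=
  Finset.sum_congr rfl fun i hi => by rw [e i (Finset.mem_range.1 hi)]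

theorem digitSum_lt {B K : ℕ} {g : ℕ → ℕ} (hg : ∀ i < K, g i ≤ B) :
    digitSum B g K < (B + 1) ^ K := by
  induction K with
  | zero => simp [digitSum]
  | succ K ih =>
    rw [digitSum_succ, pow_succ]
    have h1 := ih fun i hi => hg i (by omega)
    have h2 := Nat.mul_le_mul_right ((B + 1) ^ K) (hg K (by omega))
    linarith

theorem digitSum_injective {B K : ℕ} {g h : ℕ → ℕ} (hg : ∀ i < K, g i ≤ B) (hh : ∀ i < K, h i ≤ B)
    (e : digitSum B g K = digitSum B h K) : ∀ i < K, g i = h i := by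
  induction K with
  | zero => intro i hi; omega
  | succ K ih =>
    rw [digitSum_succ, digitSum_succ] at e
    have h1 := digitSum_lt (K := K) fun i hi => hg i (by omega)
    have h2 := digitSum_lt (K := K) fun i hi => hh i (by omega)
    have hP : 0 < (B + 1) ^ K := by positivity
    have e1 : g K = h K := by
      have e2 := congrArg (· / (B + 1) ^ K) e
      simpa [Nat.add_mul_div_right _ _ hP, Nat.div_eq_of_lt h1, Nat.div_eq_of_lt h2] using e2
    intro i hi
    rcases Nat.lt_or_eq_of_le (Nat.le_of_lt_succ hi) with h3 | rfl
    · exact ih (fun i hi => hg i (by omega)) (fun i hi => hh i (by omega)) (by rw [e1] at e; omega)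
        i h3
    · exact e1

/-- Adds `1` to the number on the guess tape; the register `43` is set to `0` on overflow. -/
def incrP : Prog :=
  .const 42 1 ;; .forLoop 40 41 6 (.ite 42 (.load 20 2 40 ;; .sub 21 5 20 ;;
    .ite 21 (.add 20 20 2 ;; .store 2 40 20 ;; .const 42 0) (.store 2 40 7)) .skip) ;;
  .sub 43 2 42

theorem run_incrP {B K : ℕ} {s : State} (h2 : s.reg 2 = 1) (h5 : s.reg 5 = B) (h6 : s.reg 6 = K)
    (h7 : s.reg 7 = 0) (hB : ∀ i < K, s.arr 2 i ≤ B) :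
    Run incrP s (K * 10 + 5) fun s' => (∀ i < K, s'.arr 2 i ≤ B) ∧
      (digitSum B (s.arr 2) K + 1 < (B + 1) ^ K →
        s'.reg 43 = 1 ∧ digitSum B (s'.arr 2) K = digitSum B (s.arr 2) K + 1) ∧
      (digitSum B (s.arr 2) K + 1 = (B + 1) ^ K → s'.reg 43 = 0) := by
  refine Run.const_seq ?_
  refine Run.seq (Run.forLoop (N := K) (T := 7) (fun j s' => (∀ i < K, s'.arr 2 i ≤ B) ∧
    (∀ i, j ≤ i → s'.arr 2 i = s.arr 2 i) ∧ s'.reg 42 ≤ 1 ∧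
    digitSum B (s'.arr 2) j + s'.reg 42 * (B + 1) ^ j = digitSum B (s.arr 2) j + 1)
    (by simpa using h6) (by simpa using h2) rfl rfl rfl rfl rfl rfl ?_ ?_ le_rfl) ?_
  · simpa [digitSum] using hB
  · rintro j s' hj hf hi ⟨hbd, hsame, hc, hval⟩
    have e2 : s'.reg 2 = 1 := by rw [hf.reg 2 rfl]; simpa using h2
    have e5 : s'.reg 5 = B := by rw [hf.reg 5 rfl]; simpa using h5
    have e7 : s'.reg 7 = 0 := by rw [hf.reg 7 rfl]; simpa using h7
    have hsj := hsame j le_rfl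
    have key : ∀ (s1 : State) x c, x ≤ B → c ≤ 1 →
        x * (B + 1) ^ j + c * (B + 1) ^ (j + 1)
          = s.arr 2 j * (B + 1) ^ j + s'.reg 42 * (B + 1) ^ j →
        (∀ i, s1.arr 2 i = if i = j then x else s'.arr 2 i) → s1.reg 42 = c →
        (∀ i < K, s1.arr 2 i ≤ B) ∧ (∀ i, j + 1 ≤ i → s1.arr 2 i = s.arr 2 i) ∧
        s1.reg 42 ≤ 1 ∧ digitSum B (s1.arr 2) (j + 1) + s1.reg 42 * (B + 1) ^ (j + 1)
          = digitSum B (s.arr 2) (j + 1) + 1 := by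
      intro s1 x c hx hc hxc hs1 hs2
      refine ⟨fun i hi => ?_, fun i hi => ?_, by omega, ?_⟩
      · rw [hs1]
        split_ifs
        · exact hx
        · exact hbd i hi
      · rw [hs1, if_neg (by omega), hsame i (by omega)]
      · rw [digitSum_succ, digitSum_succ, digitSum_congr (h := s'.arr 2)
          fun i hi => (hs1 i).trans (if_neg (by omega)), hs1, if_pos rfl, hs2]
        omega
    refine Run.ite (fun h => ?_) (fun h => ?_)
    · have hc1 : s'.reg 42 = 1 := by omega
      rw [hc1] at key
      refine Run.load_seq (Run.sub_seq (Run.ite (fun h' => ?_) (fun h' => ?_)))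
      · refine Run.add_seq (Run.store_seq (Run.const ?_))
        simp [hi, e5, hsj] at h'
        exact key _ (s.arr 2 j + 1) 0 (by omega) (by omega) (by ring)
          (fun i => by simp [hi, e2, hsj]) (by simp)
      · refine Run.store ?_
        simp [hi, e5, hsj] at h'
        have hB' := hbd j hj
        have : s.arr 2 j = B := by omega
        exact key _ 0 1 (by omega) (by omega) (by rw [this]; ring)
          (fun i => by simp [hi, e7]) (by simp [hc1])
    · refine Run.skip (key _ (s.arr 2 j) 0 (hsj ▸ hbd j hj) (by omega) (by rw [h]; ring)
        (fun i => ?_) (by simp [h]))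
      simp only [State.setReg_arr]
      split_ifs with hij
      · rw [hij, hsj]
      · rfl
  · rintro s' ⟨hbd, -, hc, hval⟩ hf
    have e2 : s'.reg 2 = 1 := by rw [hf.reg 2 rfl]; simpa using h2
    refine Run.sub ?_
    have hlt := digitSum_lt hbd
    have : s'.reg 42 = 0 ∨ s'.reg 42 = 1 := by omega
    refine ⟨hbd, fun h => ?_, fun h => ?_⟩ <;> rcases this with h0 | h0 <;>
      rw [h0] at hval <;> simp [e2, h0] at * <;> omega

theorem Traces.congr {n M : ℕ} {G : SimpleGraph (Fin n)} {W : Finset (Fin n)} {h h' : ℕ → ℕ}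
    {X : ℕ → Finset (Fin n)} (hX : Traces G W h X M) (e : ∀ i < 7 * M, h i = h' i) :
    Traces G W h' X M := by
  refine ⟨hX.zero, hX.one, hX.two, fun j hj => ?_⟩
  rw [← e (7 * j) (by omega), ← e (7 * j + 1) (by omega), ← e (7 * j + 2) (by omega),
    ← e (7 * j + 3) (by omega), ← e (7 * j + 4) (by omega), ← e (7 * j + 5) (by omega),
    ← e (7 * j + 6) (by omega)]
  exact hX.instr j hj

/-- Runs through all guess tapes and stores the best candidate. -/
def searchP : Prog := .loop 43 (runTapeP ;; evalP ;; updateP ;; incrP)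

/-- A bound on the running time for one guess tape with `M` instructions. -/
def tapeTime (n M : ℕ) : ℕ :=
  M * (instrTime n + 18) + 5 + (n * (n * 20 + 23) + 8) + (n * 14 + 20) + (7 * M * 10 + 5)

theorem run_searchP {n M B r : ℕ} {G : SimpleGraph (Fin n)} {W : Finset (Fin n)} {s : State}
    (hn : s.reg 0 = n) (h2 : s.reg 2 = 1) (h3 : s.reg 3 = r) (hM : s.reg 4 = M) (h5 : s.reg 5 = B)
    (h6 : s.reg 6 = 7 * M) (h7 : s.reg 7 = 0) (h45 : s.reg 45 = 3 * n) (h43 : s.reg 43 = 1)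
    (hG : HoldsGraph G s) (w0 : window n (s.arr 1) 0 = W) (w1 : window n (s.arr 1) n = Wᶜ)
    (w2 : window n (s.arr 1) (2 * n) = ∅) (hbest : HoldsBest G W r s)
    (htape : ∀ i < 7 * M, s.arr 2 i = 0) :
    Run searchP s ((B + 1) ^ (7 * M) * (tapeTime n M + 1) + 1) fun s' =>
      HoldsBest G W r s' ∧ (∀ i < 3 * n, s'.arr 1 i = s.arr 1 i) ∧
      ∀ h X, (∀ i, h i ≤ B) → Traces G W h X M → IsCandidate W r (X (M + 2)) →
        Dominated G W s' (X (M + 2)) := by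
  set N := (B + 1) ^ (7 * M) with hN
  have hNpos : 0 < N := by positivity
  refine (Run.loop (N := N) (T := tapeTime n M) (fun c s' => (∀ i < 7 * M, s'.arr 2 i ≤ B) ∧
    (c < N → s'.reg 43 = 1 ∧ digitSum B (s'.arr 2) (7 * M) = c) ∧ (c = N → s'.reg 43 = 0) ∧
    HoldsBest G W r s' ∧ (∀ i < 3 * n, s'.arr 1 i = s.arr 1 i) ∧
    ∀ h X, (∀ i, h i ≤ B) → Traces G W h X M → digitSum B h (7 * M) < c →
      IsCandidate W r (X (M + 2)) → Dominated G W s' (X (M + 2))) ?_ ?_ ?_).mono le_rfl ?_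
  · refine ⟨fun i hi => by rw [htape i hi]; omega, fun _ => ⟨h43, ?_⟩, fun h => by omega, hbest,
      fun _ _ => rfl, fun h X _ _ h0 => by omega⟩
    exact Finset.sum_eq_zero fun i hi => by rw [htape i (Finset.mem_range.1 hi), Nat.zero_mul]
  · exact fun s' h => h.2.2.1 rfl
  · rintro c s' hc hf ⟨hbd, hlt, -, hb, hlow, hdom⟩
    obtain ⟨h43', hval⟩ := hlt hc
    have e0 : s'.reg 0 = n := by rw [hf.reg 0 rfl, hn]
    have e2 : s'.reg 2 = 1 := by rw [hf.reg 2 rfl, h2]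
    have e3 : s'.reg 3 = r := by rw [hf.reg 3 rfl, h3]
    have e4 : s'.reg 4 = M := by rw [hf.reg 4 rfl, hM]
    have e5 : s'.reg 5 = B := by rw [hf.reg 5 rfl, h5]
    have e6 : s'.reg 6 = 7 * M := by rw [hf.reg 6 rfl, h6]
    have e7 : s'.reg 7 = 0 := by rw [hf.reg 7 rfl, h7]
    have e45 : s'.reg 45 = 3 * n := by rw [hf.reg 45 rfl, h45]
    have a0 : s'.arr 0 = s.arr 0 := hf.arr 0 rfl
    have v0 : window n (s'.arr 1) 0 = W := by
      rw [← w0]; exact window_congr fun i _ h => hlow i (by omega)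
    have v1 : window n (s'.arr 1) n = Wᶜ := by
      rw [← w1]; exact window_congr fun i _ h => hlow i (by omega)
    have v2 : window n (s'.arr 1) (2 * n) = ∅ := by
      rw [← w2]; exact window_congr fun i _ h => hlow i (by omega)
    clear hf
    refine ⟨by omega, ?_⟩
    refine Run.seq (run_runTapeP e0 e2 e4 e45 (hG.congr a0) v0 v1 v2)
      (fun s1 ⟨p28, plow, ptr⟩ hf1 => ?_) (by unfold tapeTime; omega)
    have d0 : s1.reg 0 = n := by rw [hf1.reg 0 rfl, e0]
    have d2 : s1.reg 2 = 1 := by rw [hf1.reg 2 rfl, e2]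
    have d3 : s1.reg 3 = r := by rw [hf1.reg 3 rfl, e3]
    have d5 : s1.reg 5 = B := by rw [hf1.reg 5 rfl, e5]
    have d6 : s1.reg 6 = 7 * M := by rw [hf1.reg 6 rfl, e6]
    have d7 : s1.reg 7 = 0 := by rw [hf1.reg 7 rfl, e7]
    have d36 : s1.reg 36 = s'.reg 36 := hf1.reg 36 rfl
    have d37 : s1.reg 37 = s'.reg 37 := hf1.reg 37 rfl
    have b0 : s1.arr 0 = s.arr 0 := by rw [hf1.arr 0 rfl, a0]
    have b2 : s1.arr 2 = s'.arr 2 := hf1.arr 2 rfl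
    have b3 : s1.arr 3 = s'.arr 3 := hf1.arr 3 rfl
    have u0 : window n (s1.arr 1) 0 = W := by
      rw [← v0]; exact window_congr fun i _ h => plow i (by omega)
    clear hf1
    have hpos : s1.reg 28 - n = (M + 2) * n := by
      rw [p28, Nat.sub_eq_iff_eq_add (Nat.le_mul_of_pos_left n (by omega))]; ring
    generalize hA : window n (s1.arr 1) (s1.reg 28 - n) = A
    refine Run.seq (run_evalP d0 d2 (hG.congr b0) u0 hA) (fun s2 ⟨q32, q35, q33⟩ hf2 => ?_)
      (by unfold tapeTime; omega)
    have c0 : s2.reg 0 = n := by rw [hf2.reg 0 rfl, d0]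
    have c2 : s2.reg 2 = 1 := by rw [hf2.reg 2 rfl, d2]
    have c3 : s2.reg 3 = r := by rw [hf2.reg 3 rfl, d3]
    have c5 : s2.reg 5 = B := by rw [hf2.reg 5 rfl, d5]
    have c6 : s2.reg 6 = 7 * M := by rw [hf2.reg 6 rfl, d6]
    have c7 : s2.reg 7 = 0 := by rw [hf2.reg 7 rfl, d7]
    have c36 : s2.reg 36 = s'.reg 36 := by rw [hf2.reg 36 rfl, d36]
    have c37 : s2.reg 37 = s'.reg 37 := by rw [hf2.reg 37 rfl, d37]
    have f1 : s2.arr 1 = s1.arr 1 := hf2.arr 1 rfl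
    have f2 : s2.arr 2 = s'.arr 2 := by rw [hf2.arr 2 rfl, b2]
    have f3 : s2.arr 3 = s'.arr 3 := by rw [hf2.arr 3 rfl, b3]
    clear hf2
    refine Run.seq (run_updateP (r := r) (A := A) c0 c2 c3 (hb.congr c36 c37 f3)
      (by rw [f1, q32, hA]) q35 q33) (fun s3 ⟨t1, t2, t3⟩ hf3 => ?_) (by unfold tapeTime; omega)
    have g2 : s3.reg 2 = 1 := by rw [hf3.reg 2 rfl, c2]
    have g5 : s3.reg 5 = B := by rw [hf3.reg 5 rfl, c5]
    have g6 : s3.reg 6 = 7 * M := by rw [hf3.reg 6 rfl, c6]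
    have g7 : s3.reg 7 = 0 := by rw [hf3.reg 7 rfl, c7]
    have k1 : s3.arr 1 = s1.arr 1 := by rw [hf3.arr 1 rfl, f1]
    have k2 : s3.arr 2 = s'.arr 2 := by rw [hf3.arr 2 rfl, f2]
    clear hf3
    refine ((run_incrP (B := B) (K := 7 * M) g2 g5 g6 g7 (by rwa [k2])).mono_time
      (by unfold tapeTime; omega)).mono_post fun s4 ⟨r1, r2, r3⟩ hf4 => ?_
    rw [k2, hval, ← hN] at r2 r3
    have z36 : s4.reg 36 = s3.reg 36 := hf4.reg 36 rfl
    have z37 : s4.reg 37 = s3.reg 37 := hf4.reg 37 rfl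
    refine ⟨r1, r2, r3, t1.congr z36 z37 (hf4.arr 3 rfl), fun i hi => ?_,
      fun h X hh hX hlt hcand => ?_⟩
    · rw [hf4.arr 1 rfl, k1, plow i hi, hlow i hi]
    · refine Dominated.congr ?_ z36 z37
      rcases Nat.lt_or_eq_of_le (Nat.le_of_lt_succ hlt) with h8 | h8
      · exact t3 _ ((hdom h X hh hX h8 hcand).congr c36 c37)
      · have hsame := digitSum_injective (fun i _ => hh i) hbd (h8.trans hval.symm)
        have hwin := ptr X (hX.congr hsame) (M + 2) (by omega)
        rw [← hpos, hA] at hwin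
        rw [← hwin] at hcand ⊢
        exact t2 hcand
  · rintro s' ⟨-, -, -, h8, h9, h10⟩
    exact ⟨h8, h9, fun h X hh hX => h10 h X hh hX (digitSum_lt fun i _ => hh i)⟩

/-! ### One greedy step -/

/-- Adds the best candidate to the set `W` stored at the beginning of the bank `1` and subtracts
its size from the register `3`. -/
def roundP : Prog :=
  .forLoop 40 41 6 (.store 2 40 7) ;;
  .forLoop 40 41 0 (.load 13 1 40 ;; .sub 13 2 13 ;; .add 20 0 40 ;; .store 1 20 13 ;;
    .add 20 20 0 ;; .store 1 20 7) ;;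
  .const 36 0 ;; .const 37 0 ;; .const 43 1 ;; searchP ;;
  .forLoop 40 41 0 (.load 13 3 40 ;; .ite 13 (.store 1 40 2) .skip) ;; .sub 3 3 37

/-- A bound on the running time of a greedy step. -/
def roundTime (n M B : ℕ) : ℕ :=
  28 * M + 15 * n + 14 + (B + 1) ^ (7 * M) * (tapeTime n M + 1)

theorem run_roundP {n k M : ℕ} {G : SimpleGraph (Fin n)} {W : Finset (Fin n)} {s : State}
    (hn : s.reg 0 = n) (h2 : s.reg 2 = 1) (h3 : s.reg 3 = k - W.card) (hM : s.reg 4 = M)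
    (h5 : s.reg 5 = (M + 3) * n) (h6 : s.reg 6 = 7 * M) (h7 : s.reg 7 = 0) (h45 : s.reg 45 = 3 * n)
    (hG : HoldsGraph G s) (w0 : window n (s.arr 1) 0 = W) (hM2 : 2 ≤ M) (hWk : W.card < k)
    (hkn : k ≤ n) :
    Run roundP s (roundTime n M ((M + 3) * n)) fun s' => ∃ A, IsBestStep G k (M + 2) W A ∧
      window n (s'.arr 1) 0 = W ∪ A ∧ s'.reg 3 = k - W.card - A.card := by
  refine Run.seq (Run.forLoop (N := 7 * M) (T := 1) (fun j s' => ∀ i < j, s'.arr 2 i = 0)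
    h6 h2 rfl rfl rfl rfl rfl rfl (by simp) ?_ le_rfl) (fun s1 hs1 hf1 => ?_)
    (by unfold roundTime; omega)
  · intro j s' hj hf hi hI
    have e7 : s'.reg 7 = 0 := by rw [hf.reg 7 rfl, h7]
    refine Run.store fun i hij => ?_
    rcases Nat.lt_or_eq_of_le (Nat.le_of_lt_succ hij) with h | h
    · simp [e7, hI i h]
    · simp [hi, e7, h]
  have d0 : s1.reg 0 = n := by rw [hf1.reg 0 rfl, hn]
  have d2 : s1.reg 2 = 1 := by rw [hf1.reg 2 rfl, h2]
  have d3 : s1.reg 3 = k - W.card := by rw [hf1.reg 3 rfl, h3]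
  have d4 : s1.reg 4 = M := by rw [hf1.reg 4 rfl, hM]
  have d5 : s1.reg 5 = (M + 3) * n := by rw [hf1.reg 5 rfl, h5]
  have d6 : s1.reg 6 = 7 * M := by rw [hf1.reg 6 rfl, h6]
  have d7 : s1.reg 7 = 0 := by rw [hf1.reg 7 rfl, h7]
  have d45 : s1.reg 45 = 3 * n := by rw [hf1.reg 45 rfl, h45]
  have a0 : s1.arr 0 = s.arr 0 := hf1.arr 0 rfl
  have a1 : s1.arr 1 = s.arr 1 := hf1.arr 1 rfl
  clear hf1
  refine Run.seq (Run.forLoop (N := n) (T := 6) (fun j s' => ∀ v : Fin n,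
    (v ∈ W ↔ s'.arr 1 v.val ≠ 0) ∧ (v.val < j → (v ∉ W ↔ s'.arr 1 (n + v.val) ≠ 0)) ∧
    (v.val < j → s'.arr 1 (2 * n + v.val) = 0)) d0 d2 rfl rfl rfl rfl rfl rfl ?_ ?_ le_rfl)
    (fun s2 hs2 hf2 => ?_) (by unfold roundTime; omega)
  · intro v
    refine ⟨?_, fun h => by omega, fun h => by omega⟩
    rw [← w0, mem_window, Nat.zero_add]
    simp [a1]
  · intro j s' hj hf hi hI
    have e0 : s'.reg 0 = n := by rw [hf.reg 0 rfl, d0]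
    have e2 : s'.reg 2 = 1 := by rw [hf.reg 2 rfl, d2]
    have e7 : s'.reg 7 = 0 := by rw [hf.reg 7 rfl, d7]
    refine Run.load_seq (Run.sub_seq (Run.add_seq (Run.store_seq (Run.add_seq (Run.store ?_)))))
    intro v
    obtain ⟨i1, i2, i3⟩ := hI v
    have hv := v.isLt
    have k1 : v.val ≠ n + j + n := by omega
    have k2 : v.val ≠ n + j := by omega
    have k3 : n + v.val ≠ n + j + n := by omega
    have k4 : 2 * n + v.val = n + j + n ↔ v.val = j := by omega
    have k5 : 2 * n + v.val ≠ n + j := by omega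
    simp only [State.setReg_reg, State.setArr_reg, State.setReg_arr, State.setArr_arr, hi, e0, e2,
      e7]
    norm_num [k1, k2, k3, k4, k5]
    refine ⟨i1, fun hvj => ?_, fun hvj hne => i3 (by omega)⟩
    split_ifs with h
    · rw [i1, h]
      omega
    · exact i2 (by omega)
  have c0 : s2.reg 0 = n := by rw [hf2.reg 0 rfl, d0]
  have c2 : s2.reg 2 = 1 := by rw [hf2.reg 2 rfl, d2]
  have c3 : s2.reg 3 = k - W.card := by rw [hf2.reg 3 rfl, d3]
  have c4 : s2.reg 4 = M := by rw [hf2.reg 4 rfl, d4]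
  have c5 : s2.reg 5 = (M + 3) * n := by rw [hf2.reg 5 rfl, d5]
  have c6 : s2.reg 6 = 7 * M := by rw [hf2.reg 6 rfl, d6]
  have c7 : s2.reg 7 = 0 := by rw [hf2.reg 7 rfl, d7]
  have c45 : s2.reg 45 = 3 * n := by rw [hf2.reg 45 rfl, d45]
  have b0 : s2.arr 0 = s.arr 0 := by rw [hf2.arr 0 rfl, a0]
  have b2 : ∀ i < 7 * M, s2.arr 2 i = 0 := by rw [hf2.arr 2 rfl]; exact hs1
  clear hf2
  have u0 : window n (s2.arr 1) 0 = W := by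
    ext v; rw [mem_window, Nat.zero_add, (hs2 v).1]
  have u1 : window n (s2.arr 1) n = Wᶜ := by
    ext v; rw [mem_window, Finset.mem_compl, (hs2 v).2.1 v.isLt]
  have u2 : window n (s2.arr 1) (2 * n) = ∅ := by
    ext v; rw [mem_window, (hs2 v).2.2 v.isLt]; simp
  refine Run.const_seq (Run.const_seq (Run.const_seq ?_ ?_) ?_) ?_ <;>
    try (unfold roundTime; omega)
  refine Run.seq (run_searchP (n := n) (M := M) (B := (M + 3) * n) (r := k - W.card) (G := G)
    (W := W) (by simpa) (by simpa) (by simpa) (by simpa) (by simpa) (by simpa) (by simpa)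
    (by simpa) (by simp) (hG.congr (by simpa)) (by simpa) (by simpa) (by simpa)
    ⟨by simp, by simp, by simp, by simp⟩ (by simpa)) (fun s3 ⟨hbest, hlow, hdom⟩ hf3 => ?_)
    (by unfold roundTime; omega)
  have e0 : s3.reg 0 = n := by rw [hf3.reg 0 rfl]; simpa
  have e2 : s3.reg 2 = 1 := by rw [hf3.reg 2 rfl]; simpa
  have e3 : s3.reg 3 = k - W.card := by rw [hf3.reg 3 rfl]; simpa
  clear hf3
  have hcand : ∀ l A', Derivable G W l → l.length ≤ M + 2 → A' ∈ l →
      IsCandidate W (k - W.card) A' → Dominated G W s3 A' := by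
    intro l A' hl hlen hA' hc
    obtain ⟨h, X, hh, hX, hXA⟩ := hl.exists_tape (M := M) hA' (by omega)
    rw [← hXA] at hc ⊢
    exact hdom h X hh hX hc
  -- A single unused vertex is a candidate, so the search does find one.
  have h37 : s3.reg 37 ≠ 0 := by
    obtain ⟨v, hv⟩ : ∃ v, v ∉ W := by
      by_contra! hcon
      have : W = Finset.univ := Finset.eq_univ_of_forall hcon
      rw [this, Finset.card_univ, Fintype.card_fin] at hWk
      omega
    obtain ⟨l, hl, -, hvl, hlen⟩ := (Derivable.start (G := G) (W := W)).cluster {v}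
    refine (hcand l {v} hl (by simp at hlen; omega) hvl ⟨by simpa using hv, by simp, ?_⟩).ne_zero
    simp; omega
  have hA := hbest.candidate h37
  have hcard := hbest.card h37
  have hgain := hbest.gain h37
  generalize hAdef : window n (s3.arr 3) 0 = A at hA hcard hgain
  refine Run.seq (Run.forLoop (N := n) (T := 3) (fun j s' => ∀ v : Fin n,
    s'.arr 1 v.val ≠ 0 ↔ v ∈ W ∨ (v.val < j ∧ v ∈ A)) e0 e2 rfl rfl rfl rfl rfl rfl ?_ ?_ le_rfl)
    (fun s4 hs4 hf4 => ?_) (by unfold roundTime; omega)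
  · intro v
    have hv := v.isLt
    rw [← u0, mem_window, Nat.zero_add]
    simp [hlow v.val (by omega)]
  · intro j s' hj hf hi hI
    have g2 : s'.reg 2 = 1 := by rw [hf.reg 2 rfl, e2]
    have g3 : s'.arr 3 = s3.arr 3 := hf.arr 3 rfl
    have hjA : (⟨j, hj⟩ : Fin n) ∈ A ↔ s3.arr 3 j ≠ 0 := by
      rw [← hAdef, mem_window, Nat.zero_add]
    refine Run.load_seq (Run.ite (fun h => ?_) (fun h => ?_))
    · refine Run.store ?_
      intro v
      simp [hi, g3] at h
      have hjA' := hjA.2 h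
      simp only [State.setReg_reg, State.setReg_arr, State.setArr_arr, hi, g2]
      norm_num
      rcases eq_or_ne v.val j with h8 | h8
      · obtain rfl : v = ⟨j, hj⟩ := Fin.ext h8
        simp [hjA']
      · have : v.val ≤ j ↔ v.val < j := by omega
        simpa [h8, this] using hI v
    · refine Run.skip ?_
      intro v
      simp [hi, g3] at h
      have hjA' : (⟨j, hj⟩ : Fin n) ∉ A := fun h9 => hjA.1 h9 h
      simp only [State.setReg_arr, hI v]
      refine or_congr_right ⟨fun h9 => ⟨by omega, h9.2⟩, fun h9 => ⟨?_, h9.2⟩⟩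
      rcases Nat.lt_or_eq_of_le (Nat.le_of_lt_succ h9.1) with h10 | h10
      · exact h10
      · obtain rfl : v = ⟨j, hj⟩ := Fin.ext h10
        exact absurd h9.2 hjA'
  have f3 : s4.reg 3 = k - W.card := by rw [hf4.reg 3 rfl, e3]
  have f37 : s4.reg 37 = A.card := by rw [hf4.reg 37 rfl, hcard]
  refine Run.sub ⟨A, ⟨hA.subset_compl, hA.nonempty, hA.card_le,
    fun l A' hl hlen hA' h8 h9 h10 => ?_⟩, ?_, by simp [f3, f37]⟩ (by unfold roundTime; omega)
  · have := (hcand l A' hl hlen hA' ⟨h8, h9, h10⟩).le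
    rwa [hcard, hgain] at this
  · ext v
    rw [mem_window, Nat.zero_add, Finset.mem_union]
    simpa using hs4 v

/-! ### The algorithm -/

/-- A loop in which every round decreases the register of the guard. -/
theorem Run.loop_decreasing {p : Prog} {s : State} {x N T : ℕ} (I : State → Prop) (h0 : I s)
    (hN : s.reg x ≤ N)
    (hstep : ∀ s', Frame (.loop x p) s s' → I s' → s'.reg x ≠ 0 →
      Run p s' T fun s'' => I s'' ∧ s''.reg x < s'.reg x) :
    Run (.loop x p) s (N * (T + 1) + 1) fun s' => I s' ∧ s'.reg x = 0 := by
  have key : ∀ m s', s'.reg x ≤ m → Frame (.loop x p) s s' → I s' →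
      Run (.loop x p) s' (m * (T + 1) + 1) fun s'' => I s'' ∧ s''.reg x = 0 := by
    intro m
    induction m with
    | zero =>
      intro s' hm _ hI
      have hx : s'.reg x = 0 := by omega
      exact ⟨s', 1, .loopDone hx, by omega, hI, hx⟩
    | succ m ih =>
      intro s' hm hf hI
      by_cases hx : s'.reg x = 0
      · exact ⟨s', 1, .loopDone hx, by omega, hI, hx⟩
      · obtain ⟨s2, t, he, ht, hI2, hlt⟩ := hstep s' hf hI hx
        obtain ⟨s3, t', he', ht', hq⟩ := ih s2 (by omega)
          (hf.trans ⟨he.frame.reg, he.frame.arr⟩) hI2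
        refine ⟨s3, t + t' + 1, .loopStep hx he he', ?_, hq⟩
        rw [Nat.succ_mul]; omega
  exact key N s hN (Frame.refl _ _) h0

/-- Replaces the register `44` by the integer part of its square root, by adding up odd numbers. -/
def sqrtP : Prog :=
  .const 46 0 ;; .const 47 1 ;; .add 49 44 2 ;; .sub 48 49 47 ;;
  .loop 48 (.add 46 46 2 ;; .add 47 47 46 ;; .add 47 47 46 ;; .add 47 47 2 ;; .sub 48 49 47) ;;
  .copy 44 46

theorem run_sqrtP {y : ℕ} {s : State} (h2 : s.reg 2 = 1) (h44 : s.reg 44 = y) :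
    Run sqrtP s (y * 6 + 6) fun s' => s'.reg 44 = Nat.sqrt y := by
  have hy : Nat.sqrt y ≤ y := Nat.sqrt_le_self y
  have htest : ∀ c, (c + 1) ^ 2 ≤ y ↔ c < Nat.sqrt y := fun c => by
    rw [← Nat.le_sqrt', Nat.succ_le_iff]
  refine Run.const_seq (Run.const_seq (Run.add_seq (Run.sub_seq ?_)))
  refine Run.seq (Run.loop (T := 5) (N := Nat.sqrt y) (fun c s' => s'.reg 46 = c ∧
    s'.reg 47 = (c + 1) ^ 2 ∧ s'.reg 48 = y + 1 - (c + 1) ^ 2) ?_ ?_ ?_) (fun s' hs' hf => ?_)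
  · simp [h2, h44]
  · rintro s' ⟨-, -, h⟩
    have := (htest (Nat.sqrt y)).not.2 (lt_irrefl _)
    omega
  · rintro c s' hc hf ⟨h46, h47, h48⟩
    have e2 : s'.reg 2 = 1 := by rw [hf.reg 2 rfl]; simpa
    have e49 : s'.reg 49 = y + 1 := by rw [hf.reg 49 rfl]; simp [h2, h44]
    have := (htest c).2 hc
    refine ⟨by omega, Run.add_seq (Run.add_seq (Run.add_seq (Run.add_seq (Run.sub ?_))))⟩
    have hsq : (c + 1) ^ 2 + (c + 1) + (c + 1) + 1 = (c + 1 + 1) ^ 2 := by ring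
    simp [h46, h47, e2, e49, hsq]
  · exact Run.copy (by simpa using hs'.1)

/-- Takes `s` times the integer part of the square root of the register `44`. -/
def sqrtIterP : ℕ → Prog
  | 0 => .skip
  | s + 1 => sqrtIterP s ;; sqrtP

theorem run_sqrtIterP {n : ℕ} (m : ℕ) {s : State} (h2 : s.reg 2 = 1) (h44 : s.reg 44 = n) :
    Run (sqrtIterP m) s (m * (n * 6 + 6) + 1) fun s' => s'.reg 44 = clusterSize m n ∧
      s'.reg 0 = s.reg 0 ∧ s'.reg 1 = s.reg 1 ∧ s'.reg 2 = 1 ∧ s'.arr = s.arr := by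
  induction m with
  | zero => exact Run.skip (by simp [clusterSize, h2, h44])
  | succ m ih =>
    refine Run.seq ih (fun s' ⟨h, i0, i1, i2, ia⟩ _ => ?_) (by rw [Nat.succ_mul]; omega)
    have hle : clusterSize m n ≤ n :=
      (Nat.le_self_pow (by positivity) _).trans (clusterSize_pow_le m n)
    refine ((run_sqrtP i2 h).mono_time (by rw [Nat.succ_mul]; omega)).mono_post
      fun s'' hs hf => ⟨?_, ?_, ?_, ?_, ?_⟩
    · rw [hs, clusterSize_succ]
    · rw [hf.reg 0 rfl, i0]
    · rw [hf.reg 1 rfl, i1]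
    · rw [hf.reg 2 rfl, i2]
    · rw [← ia]
      funext a
      exact hf.arr a rfl

/-- The number of instructions of the programs that are tried. -/
def programLength (s C n : ℕ) : ℕ := C * (clusterSize s n + 1)

/-- Computes the parameters of the algorithm. -/
def setupP (s C : ℕ) : Prog :=
  .const 2 1 ;; .copy 44 0 ;; sqrtIterP s ;; .add 44 44 2 ;;
  .const 50 C ;; .mulLoop 4 44 50 ;; .const 50 7 ;; .mulLoop 6 4 50 ;;
  .const 50 3 ;; .mulLoop 45 0 50 ;; .add 50 50 4 ;; .mulLoop 5 0 50 ;; .const 7 0 ;; .copy 3 1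

/-- A bound on the running time of `setupP`. -/
def setupTime (s C n : ℕ) : ℕ :=
  s * (n * 6 + 6) + C * 4 + programLength s C n * 4 + 80

theorem run_setupP {n k : ℕ} (m C : ℕ) {s : State} (hn : s.reg 0 = n) (hk : s.reg 1 = k) :
    Run (setupP m C) s (setupTime m C n) fun s' => s'.reg 0 = n ∧ s'.reg 2 = 1 ∧ s'.reg 3 = k ∧
      s'.reg 4 = programLength m C n ∧ s'.reg 5 = (programLength m C n + 3) * n ∧
      s'.reg 6 = 7 * programLength m C n ∧ s'.reg 7 = 0 ∧ s'.reg 45 = 3 * n ∧ s'.arr = s.arr := by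
  unfold setupTime
  set M := programLength m C n with hMdef
  refine Run.const_seq (Run.copy_seq ?_)
  refine Run.seq (run_sqrtIterP (n := n) m (by simp) (by simpa using hn))
    fun s1 ⟨e44, e0, e1, e2, ea⟩ _ => ?_
  simp at e0 e1 ea
  rw [hn] at e0
  rw [hk] at e1
  refine Run.add_seq (Run.const_seq ?_)
  refine Run.seq (Run.mulLoop (a := clusterSize m n + 1) (b := C) (T := C * 4 + 4)
    (by simp [e44, e2]) (by simp) (by simpa using e2) (by simp) (by simp) (by simp) (by simp))
    fun s2 h4 hf => ?_
  have d0 : s2.reg 0 = n := by rw [hf.reg 0 rfl]; simpa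
  have d1 : s2.reg 1 = k := by rw [hf.reg 1 rfl]; simpa
  have d2 : s2.reg 2 = 1 := by rw [hf.reg 2 rfl]; simpa
  have da : s2.arr = s.arr := by
    rw [← ea]; funext a; rw [hf.arr a rfl]; simp
  replace h4 : s2.reg 4 = M := h4
  clear hf e44 e0 e1 e2 ea
  refine Run.const_seq ?_
  refine Run.seq (Run.mulLoop (a := M) (b := 7) (T := 32)
    (by simp [h4]) (by simp) (by simpa using d2) (by simp) (by simp) (by simp) (by simp))
    fun s3 h6 hf => ?_
  have e0 : s3.reg 0 = n := by rw [hf.reg 0 rfl]; simpa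
  have e1 : s3.reg 1 = k := by rw [hf.reg 1 rfl]; simpa
  have e2 : s3.reg 2 = 1 := by rw [hf.reg 2 rfl]; simpa
  have e4 : s3.reg 4 = M := by rw [hf.reg 4 rfl]; simpa
  have ea : s3.arr = s.arr := by
    rw [← da]; funext a; rw [hf.arr a rfl]; simp
  clear hf d0 d1 d2 da
  refine Run.const_seq ?_
  refine Run.seq (Run.mulLoop (a := n) (b := 3) (T := 16)
    (by simp [e0]) (by simp) (by simpa using e2) (by simp) (by simp) (by simp) (by simp))
    fun s4 h45 hf => ?_
  have d0 : s4.reg 0 = n := by rw [hf.reg 0 rfl]; simpa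
  have d1 : s4.reg 1 = k := by rw [hf.reg 1 rfl]; simpa
  have d2 : s4.reg 2 = 1 := by rw [hf.reg 2 rfl]; simpa
  have d4 : s4.reg 4 = M := by rw [hf.reg 4 rfl]; simpa
  have d6 : s4.reg 6 = 7 * M := by rw [hf.reg 6 rfl]; simpa
  have d50 : s4.reg 50 = 3 := by rw [hf.reg 50 rfl]; simp
  have da : s4.arr = s.arr := by
    rw [← ea]; funext a; rw [hf.arr a rfl]; simp
  clear hf e0 e1 e2 e4 ea
  refine Run.add_seq ?_
  refine Run.seq (Run.mulLoop (a := n) (b := M + 3) (T := (M + 3) * 4 + 4)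
    (by simp [d0]) (by simp [d50, d4, add_comm]) (by simpa using d2) (by simp) (by simp) (by simp)
    (by simp)) fun s5 h5 hf => ?_
  refine Run.const_seq (Run.copy ⟨?_, ?_, ?_, ?_, ?_, ?_, ?_, ?_, ?_⟩) <;>
    simp only [State.setReg_reg, State.setReg_arr] <;> norm_num
  · rw [hf.reg 0 rfl]; simpa
  · rw [hf.reg 2 rfl]; simpa
  · rw [hf.reg 1 rfl]; simpa
  · rw [hf.reg 4 rfl]; simpa
  · exact h5
  · rw [hf.reg 6 rfl]; simpa
  · rw [hf.reg 45 rfl]; simpa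
  · rw [← da]; funext a; rw [hf.arr a rfl]; simp

/-- The algorithm: greedy steps until there are `k` vertices.  The clusters have about
`n ^ (1 / 2 ^ s)` vertices, and the number of instructions is `C` times as large. -/
def mainP (s C : ℕ) : Prog := setupP s C ;; .loop 3 roundP

/-- A bound on the running time of the algorithm. -/
def mainTime (s C n : ℕ) : ℕ :=
  setupTime s C n +
    (n * (roundTime n (programLength s C n) ((programLength s C n + 3) * n) + 1) + 1)

theorem run_mainP {n k : ℕ} (m C : ℕ) (hC : 2 ≤ C) {G : SimpleGraph (Fin n)} {s : State}
    (hn : s.reg 0 = n) (hk : s.reg 1 = k) (hkn : k ≤ n) (hG : HoldsGraph G s)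
    (h1 : ∀ i, s.arr 1 i = 0) :
    Run (mainP m C) s (mainTime m C n) fun s' =>
      Greedy G k (programLength m C n + 2) (output n s') ∧ (output n s').card = k := by
  have hout : ∀ s' : State, window n (s'.arr 1) 0 = output n s' := by
    intro s'
    simp [window, output]
  refine Run.seq (run_setupP m C hn hk) (fun s1 ⟨e0, e2, e3, e4, e5, e6, e7, e45, ea⟩ _ => ?_)
    (by unfold mainTime; omega)
  have hM2 : 2 ≤ programLength m C n := hC.trans (Nat.le_mul_of_pos_right _ (by omega))
  refine (Run.loop_decreasing (N := n)
    (T := roundTime n (programLength m C n) ((programLength m C n + 3) * n))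
    (fun s' => Greedy G k (programLength m C n + 2) (output n s') ∧ (output n s').card ≤ k ∧
      s'.reg 3 = k - (output n s').card) ?_ (by omega) ?_).mono (by unfold mainTime; omega) ?_
  · have : output n s1 = ∅ := by
      simp [output, ea, h1]
    rw [this]
    exact ⟨.empty, by simp, by simpa using e3⟩
  · rintro s' hf ⟨hgr, hle, h3⟩ hne
    have hlt : (output n s').card < k := by omega
    have a0 : s'.arr 0 = s.arr 0 := by rw [hf.arr 0 rfl, ea]
    refine (run_roundP (k := k) (W := output n s') (by rw [hf.reg 0 rfl, e0])
      (by rw [hf.reg 2 rfl, e2]) h3 (by rw [hf.reg 4 rfl, e4]) (by rw [hf.reg 5 rfl, e5])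
      (by rw [hf.reg 6 rfl, e6]) (by rw [hf.reg 7 rfl, e7]) (by rw [hf.reg 45 rfl, e45])
      (hG.congr a0) (hout s') hM2 hlt hkn).mono le_rfl ?_
    rintro s'' ⟨A, hA, hw, h3'⟩
    have hpos := Finset.card_pos.2 hA.nonempty
    have hAle := hA.card_le
    rw [hout] at hw
    rw [hw, Finset.card_union_of_disjoint hA.disjoint]
    exact ⟨⟨hgr.step hA, by omega, by omega⟩, by omega⟩
  · rintro s' ⟨⟨hgr, hle, h3⟩, h0⟩
    exact ⟨hgr, by omega⟩

/-! ### The running time -/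

theorem mainTime_le (s C n : ℕ) :
    mainTime s C n ≤
      (200 * (s + 1) * (C + 1) * (n + 1) ^ 2) ^ (7 * programLength s C n + 6) := by
  set X := 200 * (s + 1) * (C + 1) * (n + 1) ^ 2 with hX
  have hm : clusterSize s n ≤ n :=
    (Nat.le_self_pow (by positivity) _).trans (clusterSize_pow_le s n)
  have hM : programLength s C n ≤ C * (n + 1) := Nat.mul_le_mul_left _ (by omega)
  unfold mainTime roundTime tapeTime instrTime setupTime
  generalize programLength s C n = M at *
  -- `X` exceeds every polynomial that occurs.
  have hXge : 100 * (n + 1) ^ 2 + 100 * (C * (n + 1)) + 6 * s * (n + 1) + C * n ^ 2 + 4 * C ≤ X := by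
    rw [hX]
    have : 0 ≤ s * C * n ^ 2 + s * C * n + s * C + s * n ^ 2 := by positivity
    nlinarith [Nat.zero_le (s * C * n ^ 2), Nat.zero_le (s * C * n), Nat.zero_le (s * C),
      Nat.zero_le (s * n ^ 2), Nat.zero_le (C * n ^ 2), Nat.zero_le (C * n), Nat.zero_le (s * n),
      Nat.zero_le (n ^ 2)]
  have hn2 : (n + 1) ^ 2 = n ^ 2 + 2 * n + 1 := by ring
  have hsn : 6 * s * (n + 1) = s * (n * 6 + 6) := by ring
  have hX2 : 2 ≤ X := by omega
  have hMX : M ≤ X := by omega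
  have hnX : n ≤ X := by omega
  have hB : (M + 3) * n + 1 ≤ X := by
    have h1 : (M + 3) * n ≤ (C * (n + 1) + 3) * n := Nat.mul_le_mul_right _ (by omega)
    have h2 : (C * (n + 1) + 3) * n = C * n ^ 2 + C * n + 3 * n := by ring
    have h3 : C * n ≤ C * (n + 1) := Nat.mul_le_mul_left _ (by omega)
    omega
  have hI : n * (n * 10 + 30) + 5 + 18 ≤ X := by
    have : n * (n * 10 + 30) = 10 * n ^ 2 + 30 * n := by ring
    omega
  have hE : n * (n * 20 + 23) = 20 * n ^ 2 + 23 * n := by ring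
  have hpow : ((M + 3) * n + 1) ^ (7 * M) ≤ X ^ (7 * M) := Nat.pow_le_pow_left hB _
  have hMI : M * (n * (n * 10 + 30) + 5 + 18) ≤ X * X := Nat.mul_le_mul hMX hI
  have htape : M * (n * (n * 10 + 30) + 5 + 18) + 5 + (n * (n * 20 + 23) + 8) + (n * 14 + 20) +
      (7 * M * 10 + 5) + 1 ≤ X ^ 3 := by
    have h1 : X * X + X ≤ X ^ 3 := by nlinarith
    omega
  have hround := Nat.mul_le_mul hpow htape
  rw [← pow_add] at hround
  have hX3 : X ≤ X ^ (7 * M + 3) := Nat.le_self_pow (by omega) _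
  have hX4 : 2 * X ^ (7 * M + 3) ≤ X ^ (7 * M + 4) := by
    rw [show 7 * M + 4 = 7 * M + 3 + 1 from rfl, pow_succ, mul_comm]
    exact Nat.mul_le_mul_left _ hX2
  have hX5 : X ≤ X ^ (7 * M + 5) := Nat.le_self_pow (by omega) _
  have hX6 : 2 * X ^ (7 * M + 5) ≤ X ^ (7 * M + 6) := by
    rw [show 7 * M + 6 = 7 * M + 5 + 1 from rfl, pow_succ X (7 * M + 5), mul_comm]
    exact Nat.mul_le_mul_left _ hX2
  have hall : ∀ R, R + 1 ≤ X ^ (7 * M + 4) → n * (R + 1) ≤ X ^ (7 * M + 5) := by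
    intro R hR
    calc n * (R + 1) ≤ X * X ^ (7 * M + 4) := Nat.mul_le_mul hnX hR
      _ = X ^ (7 * M + 5) := by rw [← pow_succ']
  have hMn : 28 * M + 15 * n + 15 ≤ X := by omega
  refine le_trans (Nat.add_le_add_left (Nat.add_le_add_right (hall _ ?_) 1) _) ?_ <;> omega

theorem isBigO_mainTime {ε : ℝ} {s : ℕ} (C : ℕ) (hε : 0 < ε) (hs : (1 : ℝ) / 2 ^ s ≤ 4 * ε) :
    (fun n : ℕ => (mainTime s C n : ℝ)) =O[atTop]
      (fun n : ℕ => (2 : ℝ) ^ ((n : ℝ) ^ (6 * ε))) := by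
  set c : ℝ := 1 / 2 ^ s with hc
  have hδ : 0 < 6 * ε - c := by linarith
  have hl2 : 0 < Real.log 2 := Real.log_pos (by norm_num)
  set K : ℝ := 200 * (s + 1) * (C + 1) * 4 with hK
  have hK0 : 0 < K := by positivity
  set D : ℝ := 14 * C + 6 with hD
  have hD0 : 0 < D := by positivity
  have hev : ∀ᶠ n : ℕ in atTop,
      D * (Real.log K + 2 * Real.log n) ≤ Real.log 2 * (n : ℝ) ^ (6 * ε - c) := by
    have h1 : (fun x : ℝ => Real.log K + 2 * Real.log x) =o[atTop]
        fun x : ℝ => x ^ (6 * ε - c) := by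
      refine IsLittleO.add ?_ ((isLittleO_log_rpow_atTop hδ).const_mul_left 2)
      exact isLittleO_const_left.2 (Or.inr
        (tendsto_norm_atTop_atTop.comp (tendsto_rpow_atTop hδ)))
    have h2 := (h1.bound (by positivity : 0 < Real.log 2 / D))
    filter_upwards [tendsto_natCast_atTop_atTop.eventually h2] with n hn
    rw [Real.norm_eq_abs, Real.norm_eq_abs, abs_of_nonneg (a := (n : ℝ) ^ (6 * ε - c))
      (by positivity)] at hn
    calc D * (Real.log K + 2 * Real.log n)
        ≤ D * (Real.log 2 / D * (n : ℝ) ^ (6 * ε - c)) :=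
          mul_le_mul_of_nonneg_left ((le_abs_self _).trans hn) hD0.le
      _ = Real.log 2 * (n : ℝ) ^ (6 * ε - c) := by field_simp
  refine IsBigO.of_bound 1 ?_
  filter_upwards [hev, eventually_ge_atTop 1] with n hn hn1
  have hn1R : (1 : ℝ) ≤ n := by exact_mod_cast hn1
  have hn0 : (0 : ℝ) < n := by linarith
  rw [one_mul, Real.norm_of_nonneg (by positivity), Real.norm_of_nonneg (by positivity)]
  have hcn : (1 : ℝ) ≤ (n : ℝ) ^ c := Real.one_le_rpow hn1R (by positivity)
  have hbase : ((200 * (s + 1) * (C + 1) * (n + 1) ^ 2 : ℕ) : ℝ) ≤ K * (n : ℝ) ^ 2 := by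
    push_cast
    rw [hK, mul_assoc (200 * ((s : ℝ) + 1) * (C + 1))]
    refine mul_le_mul_of_nonneg_left ?_ (by positivity)
    nlinarith
  have hX1 : (1 : ℝ) ≤ K * (n : ℝ) ^ 2 := by
    refine le_trans ?_ hbase
    exact_mod_cast (by positivity : 0 < 200 * (s + 1) * (C + 1) * (n + 1) ^ 2)
  have hexp : ((7 * programLength s C n + 6 : ℕ) : ℝ) ≤ D * (n : ℝ) ^ c := by
    have := clusterSize_le_rpow s n
    have hC0 : (0 : ℝ) ≤ C := Nat.cast_nonneg C
    unfold programLength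
    push_cast
    rw [hD]
    nlinarith [mul_le_mul_of_nonneg_left this hC0, mul_le_mul_of_nonneg_left hcn hC0]
  calc (mainTime s C n : ℝ)
      ≤ ((200 * (s + 1) * (C + 1) * (n + 1) ^ 2 : ℕ) : ℝ) ^ (7 * programLength s C n + 6) := by
        exact_mod_cast mainTime_le s C n
    _ ≤ (K * (n : ℝ) ^ 2) ^ (7 * programLength s C n + 6) :=
        pow_le_pow_left₀ (Nat.cast_nonneg _) hbase _
    _ = (K * (n : ℝ) ^ 2) ^ ((7 * programLength s C n + 6 : ℕ) : ℝ) :=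
        (Real.rpow_natCast _ _).symm
    _ ≤ (K * (n : ℝ) ^ 2) ^ (D * (n : ℝ) ^ c) := Real.rpow_le_rpow_of_exponent_le hX1 hexp
    _ = Real.exp ((n : ℝ) ^ c * (D * (Real.log K + 2 * Real.log n))) := by
        rw [Real.rpow_def_of_pos (by positivity), Real.log_mul hK0.ne' (by positivity),
          Real.log_pow]
        push_cast
        ring_nf
    _ ≤ Real.exp ((n : ℝ) ^ c * (Real.log 2 * (n : ℝ) ^ (6 * ε - c))) :=
        Real.exp_le_exp.2 (mul_le_mul_of_nonneg_left hn (by positivity))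
    _ = (2 : ℝ) ^ ((n : ℝ) ^ (6 * ε)) := by
        rw [Real.rpow_def_of_pos (by norm_num : (0 : ℝ) < 2)]
        congr 1
        rw [mul_left_comm, ← Real.rpow_add hn0]
        ring_nf

/-! ### The initial state -/

theorem holdsGraph_initState {n : ℕ} (G : SimpleGraph (Fin n)) (k : ℕ) (ω : ℕ → Bool) :
    HoldsGraph G (initState G k ω) := by
  intro u v
  simp only [initState, true_and, ne_eq, ite_eq_right_iff, one_ne_zero, imp_false, not_not]
  constructor
  · rintro ⟨u', v', h, e⟩
    have e' : v.val + n * u.val = v'.val + n * u'.val := by linarith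
    have hp : finProdFinEquiv (u, v) = finProdFinEquiv (u', v') := Fin.ext (by simpa using e')
    obtain ⟨rfl, rfl⟩ := Prod.ext_iff.1 (finProdFinEquiv.injective hp)
    exact h
  · exact fun h => ⟨u, v, h, rfl⟩

instance : IsProbabilityMeasure fairCoins := by
  unfold fairCoins
  infer_instance

end DkS

theorem theorem5p1 (ε : ℝ) (hε : 0 < ε) :
    ∃ (p : DkS.Prog) (T : ℕ → ℕ) (ρ : ℕ → ℝ),
      (fun n : ℕ => (T n : ℝ)) =O[atTop] (fun n : ℕ => (2 : ℝ) ^ ((n : ℝ) ^ (6 * ε))) ∧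
      DkS.IsSoftO ρ (fun n : ℕ => max 1 ((n : ℝ) ^ ((1 - ε) / 4))) ∧
      ∀ (n k : ℕ), 1 ≤ k → k ≤ n → ∀ G : SimpleGraph (Fin n),
        (∀ ω : ℕ → Bool, DkS.HaltsWithin p (DkS.initState G k ω) (T n)) ∧
        1 - 1 / (n : ℝ) ≤
          DkS.fairCoins.real {ω | ∃ (s : DkS.State) (t : ℕ),
            DkS.Exec p (DkS.initState G k ω) s t ∧
            DkS.IsApproxDensest G k (ρ n) (DkS.output n s)} := by
  classical
  obtain ⟨s, hs, hs'⟩ := DkS.exists_exponent hε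
  obtain ⟨J, hJ⟩ := DkS.eventually_suitable hε hs'
  -- For the finitely many `n` that are too small for the analysis, the ratio `n ^ 2` is enough.
  -- The factor `J + 12` leaves room for `J` steps with a cluster each, and for the other
  -- instructions.
  refine ⟨DkS.mainP s (J + 12), DkS.mainTime s (J + 12), fun n =>
    if DkS.Suitable n (DkS.clusterSize s n) J (DkS.ratio ε n) then 128 * DkS.ratio ε n
    else (n : ℝ) ^ 2, DkS.isBigO_mainTime _ hε hs,
    DkS.isSoftO_ratio ε (C := 128) (hJ.mono fun n hn => if_pos hn), fun n k hk hkn G => ?_⟩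
  have hrun : ∀ ω, DkS.Run (DkS.mainP s (J + 12)) (DkS.initState G k ω)
      (DkS.mainTime s (J + 12) n) fun s' =>
        DkS.Greedy G k (DkS.programLength s (J + 12) n + 2) (DkS.output n s') ∧
        (DkS.output n s').card = k := fun ω =>
    DkS.run_mainP s (J + 12) (by omega) rfl rfl hkn (DkS.holdsGraph_initState G k ω)
      (fun i => by simp [DkS.initState])
  refine ⟨fun ω => ?_, ?_⟩
  · obtain ⟨s', t, he, ht, -⟩ := hrun ω
    exact ⟨s', t, he, ht⟩
  -- The algorithm tosses no coins, so it succeeds for every outcome.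
  refine le_trans (b := DkS.fairCoins.real Set.univ) ?_
    (measureReal_mono (fun ω _ => ?_) (measure_ne_top _ _))
  · rw [probReal_univ]
    have : (0 : ℝ) ≤ 1 / n := by positivity
    linarith
  · obtain ⟨s', t, he, -, hg, hcard⟩ := hrun ω
    refine ⟨s', t, he, ?_⟩
    have hlen : J * (DkS.clusterSize s n + 1) + DkS.clusterSize s n + 10
        ≤ DkS.programLength s (J + 12) n + 2 := by
      have : (J + 12) * (DkS.clusterSize s n + 1)
          = J * (DkS.clusterSize s n + 1) + 12 * (DkS.clusterSize s n + 1) := add_mul _ _ _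
      unfold DkS.programLength
      omega
    beta_reduce
    split_ifs with h
    · exact hg.isApproxDensest hcard hk h hlen
    · exact hg.isApproxDensest_sq hcard hk hkn (by omega)
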